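/- **Setting.** Let $d\ge 1$. Mode $y\in\{0,\dots,d-1\}$ is discretised on $2^{n_y}$ points ($n_y\ge1$): $\hat x_y$ is the diagonal matrix with entries $a_y+i\,\Delta x_y$, $0\le i<2^{n_y}$, where $-1\le a_y<b_y\le 1$ and $\Delta x_y=(b_y-a_y)/(2^{n_y}-1)$; $\hat p_y$ is a periodic finite-difference matrix, i.e. a circulant $2^{n_y}\times 2^{n_y}$ matrix $\hat p_y=\sum_{|t|\le r_y}c_y(t)S^t$ with $S$ the cyclic shift ($S_{i,i+1}=1$, indices mod $2^{n_y}$) and complex stencil $c_y$, which may differ from mode to mode (the central difference is $r_y=1$, $c_y(\pm1)=\mp\frac{i}{2\Delta x_y}$, $c_y(0)=0$). Consider the $d$-mode Hamiltonian with $2^\gamma$ terms $$\hat H^{(d)}=\sum_{k=0}^{2^\gamma-1}\alpha_k\bigotimes_{y=0}^{d-1}R_{k,y},\qquad R_{k,y}\in\bigl\{P_{k,y}(\hat x_y)\,\hat p_y^{\,m_k^{(y)}},\ \hat p_y^{\,m_k^{(y)}}P_{k,y}(\hat x_y)\bigr\},$$ with $\alpha_k\in\mathbb C$ not all zero, a prescribed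 ordering for every $(k,y)$, and real polynomials $P_{k,y}$ of degree $q_k^{(y)}$ which contain only monomials of the parity of $q_k^{(y)}$ and satisfy $|P_{k,y}|<1$ on $[-1,1]$. Let $2^{l_{k(y)}}$ be the least power of two that is at least the number of non-zero entries in a row of $\hat p_y^{\,m_k^{(y)}}$ (and $l_{k(y)}=0$ if this matrix is zero), let $\mathcal N_{p^{m_k(y)}}>0$ be any number with $\mathcal N_{p^{m_k(y)}}\ge\max_{i,j}\bigl|(\hat p_y^{\,m_k^{(y)}})_{ij}\bigr|^2$, and put $$\mathcal N_{m_k(y)}=\sqrt{2^{l_{k(y)}}\mathcal N_{p^{m_k(y)}}},\qquad \mathcal N_H^{(d)}=\sum_{k=0}^{2^\gamma-1}|\alpha_k|\prod_{y=0}^{d-1}\mathcal N_{m_k(y)}.$$ Gates are arbitrary one-qubit unitaries and C-NOTs. A circuit implements an operator $A$ with $a$ pure ancillas if it maps $|\psi\rangle|0\rangle^{a}$ to $(A|\psi\rangle)|0\rangle^{a}$ for every $\psi$. **Statement.** For every $r$ there is a constant $C$, depending only on $r$, such that for all data as above with all $r_y\le r$ and $\gamma\le 2^{\sum_y n_y}$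 there exist 1. a $\gamma$-qubit unitary $U_\alpha$ with $$U_\alpha|0\rangle^\gamma=\frac1{\sqrt{\mathcal N_H^{(d)}}}\sum_{k}\sqrt{i^{\sum_y m_k^{(y)}}\,\alpha_k\prod_y\mathcal N_{m_k(y)}}\;|k\rangle^\gamma$$ (principal square roots); 2. for all $k,y$ a one-mode auxiliary, i.e. a unitary $A_{k,y}$ on $3+2n_y$ qubits with, for all $j$, $$A_{k,y}|0\rangle^3|0\rangle^{n_y}|j\rangle^{n_y}=\frac{(-i)^{m_k^{(y)}}}{\mathcal N_{m_k(y)}}\sum_i (R_{k,y})_{ij}|0\rangle^3|i\rangle^{n_y}|j\rangle^{n_y}+|\bot\rangle,$$ $|\bot\rangle$ orthogonal to all vectors $|0\rangle^3|\cdot\rangle$; such that, with $C^k_V=|k\rangle\langle k|\otimes V+\sum_{i\ne k}|i\rangle\langle i|\otimes I$, the operator $$A_H^{(d)}=(U_\alpha^{T}\otimes I)\Bigl(\prod_k C^k_{\bigotimes_y A_{k,y}}\Bigr)(U_\alpha\otimes I)$$ is unitary and for all coefficients $\phi_{j_0\dots j_{d-1}}\in\mathbb C$ $$A_H^{(d)}|0\rangle^\gamma\sum_{j}\phi_{j}\bigotimes_y|0\rangle^3|0\rangle^{n_y}|j_y\rangle^{n_y}=\frac1{\mathcal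 N_H^{(d)}}\sum_{i,j}\hat H^{(d)}_{i_0\dots i_{d-1},\,j_0\dots j_{d-1}}\,\phi_j\,|0\rangle^\gamma\bigotimes_y|0\rangle^3|i_y\rangle^{n_y}|j_y\rangle^{n_y}+|\bot\rangle,$$ where $|\bot\rangle$ is orthogonal to all states in which the $\gamma$ qubits and all $3d$ flag qubits are $0$. Moreover $A_H^{(d)}$ is implemented by a circuit with at most $$C\sum_{k=0}^{2^\gamma-1}\sum_{y=0}^{d-1}\bigl(q_k^{(y)}n_y^2+m_k^{(y)}n_y\bigr)$$ gates, where a summand with $q_k^{(y)}=m_k^{(y)}=0$ is to be read as $n_y$, and at most $C\sum_{y}n_y$ pure ancillas. -/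

import Mathlib

open scoped BigOperators Matrix

noncomputable section

/-! ## Quantum circuits of one-qubit gates and C-NOTs -/

/-- Computational basis states of a collection `W` of qubits. -/
abbrev QBasis (W : Type) : Type := W → Fin 2

/-- Operators on the qubits `W`, as matrices in the computational basis. -/
abbrev QOp (W : Type) : Type := Matrix (QBasis W) (QBasis W) ℂ

/-- Elementary gates: an arbitrary one-qubit unitary, or a C-NOT on two distinct qubits. -/
inductive QGate (W : Type) : Type
  | single (w : W) (U : Matrix.unitaryGroup (Fin 2) ℂ) : QGate W
  | cnot (c t : W) (hct : c ≠ t) : QGate W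

open Classical in
/-- The operator of an elementary gate. -/
def QGate.op {W : Type} : QGate W → QOp W
  | .single w U => fun x y => if ∀ v, v ≠ w → x v = y v then U.1 (x w) (y w) else 0
  | .cnot c t _ => fun x y => if x = Function.update y t (y t + y c) then 1 else 0

/-- A circuit is a list of elementary gates, the first one being applied first; its gate count
is its length. -/
def circuitOp {W : Type} [Fintype W] [DecidableEq W] : List (QGate W) → QOp W
  | [] => 1
  | g :: gs => circuitOp gs * g.op

/-- The circuit `gs` implements the operator `A` on the qubits `S` with `a` pure ancillas: on every
state of `S` with the ancillas in `|0⟩^a` it applies `A` and returns the ancillas to `|0⟩^a`. -/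
def ImplementsWithPureAncillas {S : Type} [Fintype S] [DecidableEq S] {a : ℕ}
    (gs : List (QGate (S ⊕ Fin a))) (A : QOp S) : Prop :=
  ∀ (x y : QBasis S) (z : QBasis (Fin a)),
    circuitOp gs (Sum.elim x z) (Sum.elim y 0) = if z = 0 then A x y else 0

/-- The basis state `|i⟩^n`; bit `b` of `i` has weight `2 ^ b`. -/
def ket {n : ℕ} (i : Fin (2 ^ n)) : QBasis (Fin n) := finFunctionFinEquiv.symm i

/-! ## The Hamiltonian and its matrix representation -/

/-- Discretisation of one mode on `2 ^ n` points of `[a, b] ⊆ [-1, 1]`, with periodic boundary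
conditions and a finite-difference stencil for the momentum. The central difference scheme is
`radius = 1`, `stencil 1 = -i / (2 Δx)`, `stencil (-1) = i / (2 Δx)`, `stencil 0 = 0`. -/
structure ModeGrid where
  n : ℕ
  n_pos : 0 < n
  a : ℝ
  b : ℝ
  neg_one_le_a : -1 ≤ a
  a_lt_b : a < b
  b_le_one : b ≤ 1
  radius : ℕ
  stencil : ℤ → ℂ

namespace ModeGrid

/-- The spacing of the grid, whose first point is `a` and whose last point is `b`. -/
def Δx (g : ModeGrid) : ℝ := (g.b - g.a) / (2 ^ g.n - 1)

/-- The grid point with index `i`. -/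
def point (g : ModeGrid) (i : Fin (2 ^ g.n)) : ℝ := g.a + (i : ℕ) * g.Δx

/-- The momentum matrix: the circulant matrix with entry `stencil t` at column `i + t` (modulo
`2 ^ n`) of row `i`, for `-radius ≤ t ≤ radius`. -/
def momentum (g : ModeGrid) : Matrix (Fin (2 ^ g.n)) (Fin (2 ^ g.n)) ℂ :=
  fun i j => ∑ t ∈ Finset.Icc (-(g.radius : ℤ)) g.radius,
    if ((j : ℕ) : ℤ) ≡ ((i : ℕ) : ℤ) + t [ZMOD 2 ^ g.n] then g.stencil t else 0

/-- The matrix `P(x̂)`, where `x̂` is the diagonal matrix of the grid points. -/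
def coordinatePoly (g : ModeGrid) (P : Polynomial ℝ) :
    Matrix (Fin (2 ^ g.n)) (Fin (2 ^ g.n)) ℂ :=
  Polynomial.aeval (Matrix.diagonal fun i => ((g.point i : ℝ) : ℂ)) P

open Classical in
/-- The number of non-zero entries in each row of the circulant matrix `p̂ ^ m`, counted in the
first row. -/
def sparsity (g : ModeGrid) (m : ℕ) : ℕ :=
  (Finset.univ.filter fun j : Fin (2 ^ g.n) =>
    (g.momentum ^ m) ⟨0, Nat.two_pow_pos g.n⟩ j ≠ 0).card

/-- `l = ⌈log₂ (sparsity of p̂ ^ m)⌉`. -/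
def logSparsity (g : ModeGrid) (m : ℕ) : ℕ := Nat.clog 2 (g.sparsity m)

end ModeGrid

/-- One tensor factor `P(x) p ^ m` (for `L = 0`) or `p ^ m P(x)` (for `L = 1`). -/
structure ModeFactor where
  P : Polynomial ℝ
  m : ℕ
  L : Fin 2
  parity : ∀ e : ℕ, P.coeff e ≠ 0 → e % 2 = P.natDegree % 2
  bounded : ∀ x : ℝ, x ∈ Set.Icc (-1 : ℝ) 1 → |P.eval x| < 1

/-- The degree of the polynomial of a factor. -/
def ModeFactor.q (f : ModeFactor) : ℕ := f.P.natDegree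

/-- The matrix of a factor on a grid. -/
def ModeFactor.matrix (f : ModeFactor) (g : ModeGrid) :
    Matrix (Fin (2 ^ g.n)) (Fin (2 ^ g.n)) ℂ :=
  if f.L = 0 then g.coordinatePoly f.P * g.momentum ^ f.m
  else g.momentum ^ f.m * g.coordinatePoly f.P

/-- A `d`-mode Hamiltonian with `2 ^ γ` terms, together with a discretisation of every mode. -/
structure MultiModeHamiltonian (d γ : ℕ) where
  grid : Fin d → ModeGrid
  α : Fin (2 ^ γ) → ℂ
  factor : Fin (2 ^ γ) → Fin d → ModeFactor

/-! ## Registers -/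

/-- The qubits of one mode: three flag qubits, the row register and the column register. -/
abbrev ModeQubits (n : ℕ) : Type := Fin 3 ⊕ (Fin n ⊕ Fin n)

/-- The basis state `|f⟩^3 |i⟩^n |j⟩^n` of one mode. -/
def modeKet {n : ℕ} (f : QBasis (Fin 3)) (i j : Fin (2 ^ n)) : QBasis (ModeQubits n) :=
  Sum.elim f (Sum.elim (ket i) (ket j))

namespace MultiModeHamiltonian

variable {d γ : ℕ}

/-- The number of qubits of the row (and of the column) register of mode `y`. -/
def n (H : MultiModeHamiltonian d γ) (y : Fin d) : ℕ := (H.grid y).n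

/-- Indices of rows and columns of the matrix of `H`. -/
abbrev Index (H : MultiModeHamiltonian d γ) : Type := (y : Fin d) → Fin (2 ^ H.n y)

/-- The matrix representation of `H`: entries of the linear combination of the Kronecker products
of the factors. -/
def matrix (H : MultiModeHamiltonian d γ) : Matrix H.Index H.Index ℂ :=
  fun i j => ∑ k, H.α k * ∏ y, (H.factor k y).matrix (H.grid y) (i y) (j y)

/-- All qubits except the pure ancillas: the `γ` qubits of the linear combination, then the
qubits of each mode. -/
abbrev Qubits (H : MultiModeHamiltonian d γ) : Type :=
  Fin γ ⊕ ((y : Fin d) × ModeQubits (H.n y))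

/-- The part of a basis state on the `γ` qubits of the linear combination. -/
def ctrl (H : MultiModeHamiltonian d γ) (x : QBasis H.Qubits) : QBasis (Fin γ) :=
  fun b => x (Sum.inl b)

/-- The part of a basis state on the qubits of mode `y`. -/
def mode (H : MultiModeHamiltonian d γ) (x : QBasis H.Qubits) (y : Fin d) :
    QBasis (ModeQubits (H.n y)) :=
  fun w => x (Sum.inr ⟨y, w⟩)

/-- The basis state `|0⟩^γ ⊗ ⨂_y |0⟩^3 |i_y⟩ |j_y⟩`. -/
def sysKet (H : MultiModeHamiltonian d γ) (i j : H.Index) : QBasis H.Qubits :=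
  Sum.elim 0 fun w => modeKet 0 (i w.1) (j w.1) w.2

/-- `x` has the `γ` qubits of the linear combination and all `3 d` flag qubits in state `0`. -/
def Flagged (H : MultiModeHamiltonian d γ) (x : QBasis H.Qubits) : Prop :=
  H.ctrl x = 0 ∧ ∀ y (e : Fin 3), H.mode x y (Sum.inl e) = 0

/-- The input `∑_j φ_j |0⟩^γ ⊗ ⨂_y |0⟩^3 |0⟩ |j_y⟩`. -/
def inputState (H : MultiModeHamiltonian d γ) (φ : H.Index → ℂ) : QBasis H.Qubits → ℂ :=
  ∑ j : H.Index, φ j • Pi.single (H.sysKet (fun _ => ⟨0, Nat.two_pow_pos _⟩) j) (1 : ℂ)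

/-- The vector `∑_{i,j} Ĥ_{ij} φ_j |0⟩^γ ⊗ ⨂_y |0⟩^3 |i_y⟩ |j_y⟩`. -/
def targetState (H : MultiModeHamiltonian d γ) (φ : H.Index → ℂ) : QBasis H.Qubits → ℂ :=
  ∑ i : H.Index, ∑ j : H.Index, (H.matrix i j * φ j) • Pi.single (H.sysKet i j) (1 : ℂ)

/-! ## The linear combination of unitaries -/

open Classical in
/-- `U ⊗ I`, with `U` acting on the `γ` qubits of the linear combination. -/
def onCtrl (H : MultiModeHamiltonian d γ) (U : QOp (Fin γ)) : QOp H.Qubits :=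
  fun x x' => if ∀ y, H.mode x y = H.mode x' y then U (H.ctrl x) (H.ctrl x') else 0

open Classical in
/-- The multi-control operator `|k⟩⟨k| ⊗ ⨂_y B_y + ∑_{i ≠ k} |i⟩⟨i| ⊗ I`. -/
def multiControl (H : MultiModeHamiltonian d γ) (k : Fin (2 ^ γ))
    (B : (y : Fin d) → QOp (ModeQubits (H.n y))) : QOp H.Qubits :=
  fun x x' =>
    if H.ctrl x = H.ctrl x' then
      if H.ctrl x = ket k then ∏ y, B y (H.mode x y) (H.mode x' y)
      else if x = x' then 1 else 0
    else 0

/-- `(Uᵀ ⊗ I) (∏_k C^k_{⨂_y B_{k,y}}) (U ⊗ I)`. -/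
def lcu (H : MultiModeHamiltonian d γ) (U : QOp (Fin γ))
    (B : Fin (2 ^ γ) → (y : Fin d) → QOp (ModeQubits (H.n y))) : QOp H.Qubits :=
  H.onCtrl Uᵀ * (List.ofFn fun k => H.multiControl k (B k)).prod * H.onCtrl U

/-- The normalisation constant `√(2 ^ l * N_{p^m})` of the factor of term `k` in mode `y`, where
`Np k y` is the chosen bound `N_{p^m}` for the squared entries of `p̂ ^ m`. -/
def modeNorm (H : MultiModeHamiltonian d γ) (Np : Fin (2 ^ γ) → Fin d → ℝ)
    (k : Fin (2 ^ γ)) (y : Fin d) : ℝ :=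
  Real.sqrt (2 ^ (H.grid y).logSparsity (H.factor k y).m * Np k y)

/-- The normalisation constant `∑_k |α_k| ∏_y √(2 ^ l * N_{p^m})`. -/
def norm (H : MultiModeHamiltonian d γ) (Np : Fin (2 ^ γ) → Fin d → ℝ) : ℝ :=
  ∑ k, ‖H.α k‖ * ∏ y, H.modeNorm Np k y

/-- The amplitude of `|k⟩` in the state prepared on the `γ` qubits (principal square root). -/
def lcuAmplitude (H : MultiModeHamiltonian d γ) (Np : Fin (2 ^ γ) → Fin d → ℝ)
    (k : Fin (2 ^ γ)) : ℂ :=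
  (Complex.I ^ (∑ y, (H.factor k y).m) * H.α k * ((∏ y, H.modeNorm Np k y : ℝ) : ℂ))
      ^ (1 / 2 : ℂ) / ((Real.sqrt (H.norm Np) : ℝ) : ℂ)

/-- `B` is a one-mode auxiliary of the factor of term `k` in mode `y`: a unitary with
`B |0⟩^3 |0⟩ |j⟩ = (-i) ^ m / √(2 ^ l * N_{p^m}) * ∑_i R_{ij} |0⟩^3 |i⟩ |j⟩ + …`,
where the omitted vector is orthogonal to `|0⟩^3`. The phase `(-i) ^ m` is undone by the
amplitudes `lcuAmplitude`. -/
def IsOneModeAuxiliary (H : MultiModeHamiltonian d γ) (Np : Fin (2 ^ γ) → Fin d → ℝ)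
    (k : Fin (2 ^ γ)) (y : Fin d) (B : QOp (ModeQubits (H.n y))) : Prop :=
  B ∈ Matrix.unitaryGroup (QBasis (ModeQubits (H.n y))) ℂ ∧
  ∀ i j j' : Fin (2 ^ H.n y),
    B (modeKet 0 i j') (modeKet 0 ⟨0, Nat.two_pow_pos _⟩ j) =
      if j' = j then
        (-Complex.I) ^ (H.factor k y).m / ((H.modeNorm Np k y : ℝ) : ℂ) *
          (H.factor k y).matrix (H.grid y) i j
      else 0

/-- `Np k y` is an admissible normalisation for the entries of `p̂_y ^ m`: it is positive and at
least the square of the maximum norm of that matrix. -/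
def IsMomentumNorm (H : MultiModeHamiltonian d γ) (Np : Fin (2 ^ γ) → Fin d → ℝ) : Prop :=
  ∀ k y, 0 < Np k y ∧ ∀ i j, ‖((H.grid y).momentum ^ (H.factor k y).m) i j‖ ^ 2 ≤ Np k y

/-- The gate bound `∑_k ∑_y (q n² + m n)`; a factor that is a mere constant (`q = m = 0`) is
counted with `n`. -/
def gateBound (H : MultiModeHamiltonian d γ) : ℕ :=
  ∑ k, ∑ y, ((H.factor k y).q * H.n y ^ 2 + (H.factor k y).m * H.n y +
    if (H.factor k y).q = 0 ∧ (H.factor k y).m = 0 then H.n y else 0)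

end MultiModeHamiltonian

end

/-! The construction is a linear combination of unitaries. Between zero states of the control
register, `Uᵀ`, the select operator and `U` multiply to `∑ k, U k 0 ^ 2 • V k` (`lcu_sysKet`). The
transpose, unlike the adjoint, squares the amplitudes without conjugation, so principal square roots
reproduce complex coefficients. The power of `I` in the amplitudes cancels the powers of `-I` in the
one-mode blocks, and the mode normalisations cancel as well.

One mode (`exists_modeCircuit`). A power `p̂ ^ m` is circulant, and its first column `κ` is
supported on shifts of size at most `radius * m` modulo `2 ^ n`. A factor therefore has entries `P
(x_i) * κ (i - j)` or `P (x_j) * κ (i - j)`. After a translation of the window to start at zero, the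
normalised `κ` is prepared as an amplitude vector on a few low qubits of the row register; the
missing norm goes to a flag. Modular additions turn the shift in the row register into the row
index, and `P` is applied while the column register holds `i` or `j`, according to the ordering.

Multiplication by `P` (`exists_polynomialCircuit`). A grid point is a convex combination of `1`,
`-1` and the signs of its binary digits. With the weights prepared on a scratch register of `O(log
n)` qubits, the coordinate is the zero block of an involution `T`. If `R` is `1` on the zero scratch
state and `-1` elsewhere, then `W = R T` has inverse `T R`, and `(W + W⁻¹) / 2` acts on zero scratch
states as the coordinate. Quantum signal processing realises `W⁻¹ ^ q * f (W²)`, where `f (w²) = w ^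
q * P ((w + w⁻¹) / 2)`; this equals `P ((W + W⁻¹) / 2)`. Parity makes `f` a polynomial. The bound
`|P| < 1` makes `1 - |f|²` positive on the unit circle, so `exists_spectral_factor` supplies a
complementary polynomial, and `signalReach_of_mul_conjReflect` peels off the rotations one at a
time. Each of the `q` steps costs `O(n²)` gates.

The scratch qubits are the high qubits of the row register, which are still zero at that moment.
They cannot be pure ancillas, since their return to zero is guaranteed only in the branch where the
flag is zero. If too few of them are free, then `2 ^ n = O(2 ^ w * n)` with `2 ^ w = O(1 + radius *
m)`, and one uniformly controlled rotation already meets the bound.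

Selection (`synthAnc_multiplex_register`). The product of multi-controls is a single select
operator. Unary iteration costs amortised `O(1)` gates per branch besides the controlled branches,
but one ancilla per control bit, which is too many when `γ` is large. It is therefore used on about
`2 log γ` bits only, once for each pattern of the others; a pattern test costs a polynomial in `γ`,
absorbed by the iterated block, and `O(log γ)` ancillas. The hypothesis on `γ` bounds `log γ` by the
number of row qubits.

At gate level everything reduces to `synth_mux`, the uniformly controlled one-qubit gate. -/

set_option linter.unusedSectionVars false

/-! ## Multiplexed operators -/

/-- `x` and `y` agree outside the register `f`. -/
def AgreeOff {S S' : Type} (f : S' ↪ S) (x y : QBasis S) : Prop :=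
  ∀ s, s ∉ Set.range f → x s = y s

/-- `A` does not depend on the bits in the register `f`. -/
def IndepOf {S S' α : Type} (f : S' ↪ S) (A : QBasis S → α) : Prop :=
  ∀ x y, AgreeOff f x y → A x = A y

open Classical in
/-- The operator which applies `A y` to the register `f` on the basis state `y`. -/
noncomputable def multiplex {S S' : Type} (f : S' ↪ S) (A : QBasis S → QOp S') : QOp S :=
  fun x y => if AgreeOff f x y then A y (x ∘ f) (y ∘ f) else 0

section Multiplex

variable {S S' S'' : Type} {α : Type}

theorem AgreeOff.refl (f : S' ↪ S) (x : QBasis S) : AgreeOff f x x := fun _ _ => rfl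

theorem AgreeOff.symm {f : S' ↪ S} {x y : QBasis S} (h : AgreeOff f x y) : AgreeOff f y x :=
  fun s hs => (h s hs).symm

theorem AgreeOff.trans {f : S' ↪ S} {x y z : QBasis S} (h : AgreeOff f x y)
    (h' : AgreeOff f y z) : AgreeOff f x z :=
  fun s hs => (h s hs).trans (h' s hs)

theorem agreeOff_extend (f : S' ↪ S) (v : QBasis S') (y : QBasis S) :
    AgreeOff f (Function.extend f v y) y :=
  fun _ hs => Function.extend_apply' _ _ _ (fun ⟨a, ha⟩ => hs ⟨a, ha⟩)

theorem extend_comp_embedding (f : S' ↪ S) (v : QBasis S') (y : QBasis S) :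
    Function.extend f v y ∘ f = v := by
  funext a
  simp [f.injective.extend_apply]

theorem AgreeOff.ext {f : S' ↪ S} {x y : QBasis S} (h : AgreeOff f x y) (h' : x ∘ f = y ∘ f) :
    x = y := by
  funext s
  by_cases hs : s ∈ Set.range f
  · obtain ⟨a, rfl⟩ := hs
    exact congrFun h' a
  · exact h s hs

theorem AgreeOff.eq_extend {f : S' ↪ S} {x y : QBasis S} (h : AgreeOff f x y) :
    x = Function.extend f (x ∘ f) y :=
  (h.trans (agreeOff_extend f _ y).symm).ext (extend_comp_embedding f _ y).symm

theorem agreeOff_extend_right {f : S' ↪ S} {x y : QBasis S} {v : QBasis S'} :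
    AgreeOff f x (Function.extend f v y) ↔ AgreeOff f x y :=
  ⟨fun h => h.trans (agreeOff_extend f v y), fun h => h.trans (agreeOff_extend f v y).symm⟩

theorem agreeOff_trans_iff (g : S'' ↪ S') (f : S' ↪ S) (x y : QBasis S) :
    AgreeOff (g.trans f) x y ↔ AgreeOff f x y ∧ AgreeOff g (x ∘ f) (y ∘ f) := by
  constructor
  · intro h
    refine ⟨fun _ hs => h _ ?_, fun _ hs => h (f _) ?_⟩
    · rintro ⟨a, rfl⟩
      exact hs ⟨g a, rfl⟩
    · rintro ⟨a, ha⟩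
      exact hs ⟨a, f.injective ha⟩
  · rintro ⟨h, h'⟩ s hs
    by_cases hf : s ∈ Set.range f
    · obtain ⟨a, rfl⟩ := hf
      refine h' a ?_
      rintro ⟨b, rfl⟩
      exact hs ⟨b, rfl⟩
    · exact h s hf

theorem IndepOf.const (f : S' ↪ S) (a : α) : IndepOf f (fun _ : QBasis S => a) :=
  fun _ _ _ => rfl

theorem IndepOf.comp {β : Type} {f : S' ↪ S} {A : QBasis S → α} (h : IndepOf f A) (g : α → β) :
    IndepOf f (fun y => g (A y)) := fun x y hxy => congrArg g (h x y hxy)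

theorem multiplex_of_agree {f : S' ↪ S} {A : QBasis S → QOp S'} {x y : QBasis S}
    (h : AgreeOff f x y) : multiplex f A x y = A y (x ∘ f) (y ∘ f) := if_pos h

theorem multiplex_of_not_agree {f : S' ↪ S} {A : QBasis S → QOp S'} {x y : QBasis S}
    (h : ¬ AgreeOff f x y) : multiplex f A x y = 0 := if_neg h

/-- Agreement off the smaller register splits into agreement off `f` and agreement off `g` inside
`f`. This lets a gate inside a controlled subcircuit be treated as one controlled gate on all
qubits. -/
theorem multiplex_trans (g : S'' ↪ S') (f : S' ↪ S) (A : QBasis S → QBasis S' → QOp S'') :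
    multiplex f (fun y => multiplex g (A y)) = multiplex (g.trans f) (fun y => A y (y ∘ f)) := by
  ext x y
  by_cases h : AgreeOff f x y
  · by_cases h' : AgreeOff g (x ∘ f) (y ∘ f)
    · rw [multiplex_of_agree h, multiplex_of_agree h',
        multiplex_of_agree ((agreeOff_trans_iff g f x y).2 ⟨h, h'⟩)]
      rfl
    · rw [multiplex_of_agree h, multiplex_of_not_agree h', multiplex_of_not_agree]
      exact fun h'' => h' ((agreeOff_trans_iff g f x y).1 h'').2
  · rw [multiplex_of_not_agree h, multiplex_of_not_agree]
    exact fun h'' => h ((agreeOff_trans_iff g f x y).1 h'').1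

theorem multiplex_conjTranspose (f : S' ↪ S) {A : QBasis S → QOp S'} (hA : IndepOf f A) :
    (multiplex f A)ᴴ = multiplex f (fun y => (A y)ᴴ) := by
  ext x y
  rw [Matrix.conjTranspose_apply]
  by_cases h : AgreeOff f x y
  · rw [multiplex_of_agree h, multiplex_of_agree h.symm, Matrix.conjTranspose_apply, hA x y h]
  · rw [multiplex_of_not_agree h, multiplex_of_not_agree (fun h' => h h'.symm), star_zero]

theorem multiplex_transpose (f : S' ↪ S) {A : QBasis S → QOp S'} (hA : IndepOf f A) :
    (multiplex f A)ᵀ = multiplex f (fun y => (A y)ᵀ) := by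
  ext x y
  rw [Matrix.transpose_apply]
  by_cases h : AgreeOff f x y
  · rw [multiplex_of_agree h, multiplex_of_agree h.symm, Matrix.transpose_apply, hA x y h]
  · rw [multiplex_of_not_agree h, multiplex_of_not_agree (fun h' => h h'.symm)]

variable [Fintype S] [DecidableEq S] [Fintype S'] [DecidableEq S'] [Fintype S''] [DecidableEq S'']

theorem multiplex_one (f : S' ↪ S) : multiplex f (fun _ => 1) = (1 : QOp S) := by
  ext x y
  by_cases h : AgreeOff f x y
  · rw [multiplex_of_agree h]
    by_cases hxy : x = y
    · rw [hxy, Matrix.one_apply_eq, Matrix.one_apply_eq]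
    · rw [Matrix.one_apply_ne hxy, Matrix.one_apply_ne (fun h' => hxy (h.ext h'))]
  · rw [multiplex_of_not_agree h, Matrix.one_apply_ne]
    rintro rfl
    exact h (AgreeOff.refl f x)

/-- Column `y` is supported on the states obtained from `y` by overwriting the register `f`, so the
sum is reindexed by the new contents. -/
theorem sum_mul_multiplex (f : S' ↪ S) (A : QBasis S → QOp S') (G : QBasis S → ℂ)
    (y : QBasis S) :
    ∑ w, G w * multiplex f A w y = ∑ v, G (Function.extend f v y) * A y v (y ∘ f) := by
  symm
  refine Finset.sum_of_injOn (fun v => Function.extend f v y) ?_ (by simp) ?_ ?_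
  · intro v _ v' _ h
    have := congrArg (fun z : QBasis S => z ∘ f) h
    simpa only [extend_comp_embedding] using this
  · intro w _ hw
    rw [multiplex_of_not_agree, mul_zero]
    intro h
    exact hw ⟨w ∘ f, by simp, h.eq_extend.symm⟩
  · intro v _
    rw [multiplex_of_agree (agreeOff_extend f v y), extend_comp_embedding]

/-- Only the left factor has to ignore the register: it is evaluated at the state that `B` has
already altered, whereas `B` sees the original column. -/
theorem multiplex_mul (f : S' ↪ S) {A : QBasis S → QOp S'} (B : QBasis S → QOp S')
    (hA : IndepOf f A) :
    multiplex f A * multiplex f B = multiplex f (fun y => A y * B y) := by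
  ext x y
  rw [Matrix.mul_apply, sum_mul_multiplex]
  by_cases h : AgreeOff f x y
  · rw [multiplex_of_agree h, Matrix.mul_apply]
    refine Finset.sum_congr rfl fun v _ => ?_
    rw [multiplex_of_agree (agreeOff_extend_right.2 h), extend_comp_embedding,
      hA _ y (agreeOff_extend f v y)]
  · rw [multiplex_of_not_agree h]
    refine Finset.sum_eq_zero fun v _ => ?_
    rw [multiplex_of_not_agree (fun h' => h (agreeOff_extend_right.1 h')), zero_mul]

theorem multiplex_mem_unitaryGroup (f : S' ↪ S) {A : QBasis S → QOp S'} (hA : IndepOf f A)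
    (hu : ∀ y, A y ∈ Matrix.unitaryGroup (QBasis S') ℂ) :
    multiplex f A ∈ Matrix.unitaryGroup (QBasis S) ℂ := by
  rw [Matrix.mem_unitaryGroup_iff, Matrix.star_eq_conjTranspose, multiplex_conjTranspose f hA,
    multiplex_mul f _ hA, ← multiplex_one f]
  congr 1
  funext y
  exact Matrix.mem_unitaryGroup_iff.1 (hu y)

/-- `A` acting on the register `f`. -/
noncomputable def onReg (f : S' ↪ S) (A : QOp S') : QOp S := multiplex f (fun _ => A)

theorem onReg_mul (f : S' ↪ S) (A B : QOp S') : onReg f (A * B) = onReg f A * onReg f B :=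
  (multiplex_mul f _ (IndepOf.const f A)).symm

theorem onReg_one (f : S' ↪ S) : onReg f (1 : QOp S') = 1 := multiplex_one f

theorem onReg_multiplex (g : S'' ↪ S') (f : S' ↪ S) (A : QBasis S' → QOp S'') :
    onReg f (multiplex g A) = multiplex (g.trans f) (fun y => A (y ∘ f)) :=
  multiplex_trans g f (fun _ => A)

theorem onReg_onReg (g : S'' ↪ S') (f : S' ↪ S) (A : QOp S'') :
    onReg f (onReg g A) = onReg (g.trans f) A :=
  multiplex_trans g f (fun _ _ => A)

end Multiplex

/-! ## Multiplexed one-qubit gates -/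

/-- The register which consists of one qubit. -/
def qubitReg {S : Type} (t : S) : Unit ↪ S := ⟨fun _ => t, fun _ _ _ => rfl⟩

/-- The operator of a one-qubit matrix. -/
def qubitOp (u : Matrix (Fin 2) (Fin 2) ℂ) : QOp Unit := u.submatrix (· ()) (· ())

/-- The operator which applies `u y` to the qubit `t` on the basis state `y`. -/
noncomputable def mux {S : Type} (t : S) (u : QBasis S → Matrix (Fin 2) (Fin 2) ℂ) : QOp S :=
  multiplex (qubitReg t) (fun y => qubitOp (u y))

/-- The Pauli matrix `X`. -/
def pauliX : Matrix (Fin 2) (Fin 2) ℂ := !![0, 1; 1, 0]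

section Mux

variable {S S' : Type}

@[simp]
theorem mem_range_qubitReg {s t : S} : s ∈ Set.range (qubitReg t) ↔ s = t := by
  constructor
  · rintro ⟨_, rfl⟩
    rfl
  · rintro rfl
    exact ⟨(), rfl⟩

theorem agreeOff_qubitReg {t : S} {x y : QBasis S} :
    AgreeOff (qubitReg t) x y ↔ ∀ s, s ≠ t → x s = y s := by
  simp only [AgreeOff, mem_range_qubitReg]

theorem qubitOp_mul (u v : Matrix (Fin 2) (Fin 2) ℂ) : qubitOp (u * v) = qubitOp u * qubitOp v :=
  Matrix.submatrix_mul _ _ _ _ _ (Equiv.funUnique Unit (Fin 2)).bijective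

theorem qubitOp_one : qubitOp 1 = 1 :=
  Matrix.submatrix_one_equiv (Equiv.funUnique Unit (Fin 2))

theorem mux_of_agree {t : S} {u : QBasis S → Matrix (Fin 2) (Fin 2) ℂ} {x y : QBasis S}
    (h : ∀ s, s ≠ t → x s = y s) : mux t u x y = u y (x t) (y t) :=
  multiplex_of_agree (agreeOff_qubitReg.2 h)

theorem mux_of_not_agree {t : S} {u : QBasis S → Matrix (Fin 2) (Fin 2) ℂ} {x y : QBasis S}
    (h : ¬ ∀ s, s ≠ t → x s = y s) : mux t u x y = 0 :=
  multiplex_of_not_agree (fun h' => h (agreeOff_qubitReg.1 h'))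

variable [Fintype S] [DecidableEq S] [Fintype S'] [DecidableEq S']

theorem mux_mul {t : S} {u v : QBasis S → Matrix (Fin 2) (Fin 2) ℂ}
    (hu : IndepOf (qubitReg t) u) : mux t u * mux t v = mux t (fun y => u y * v y) := by
  rw [mux, mux, multiplex_mul _ _ (hu.comp qubitOp)]
  simp only [← qubitOp_mul]
  rfl

theorem mux_one (t : S) : mux t (fun _ => 1) = (1 : QOp S) := by
  rw [mux, qubitOp_one, multiplex_one]

theorem mux_conjTranspose {t : S} {u : QBasis S → Matrix (Fin 2) (Fin 2) ℂ}
    (hu : IndepOf (qubitReg t) u) : (mux t u)ᴴ = mux t (fun y => (u y)ᴴ) := by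
  rw [mux, multiplex_conjTranspose _ (hu.comp qubitOp)]
  rfl

theorem mux_transpose {t : S} {u : QBasis S → Matrix (Fin 2) (Fin 2) ℂ}
    (hu : IndepOf (qubitReg t) u) : (mux t u)ᵀ = mux t (fun y => (u y)ᵀ) := by
  rw [mux, multiplex_transpose _ (hu.comp qubitOp)]
  rfl

theorem onReg_mux (f : S' ↪ S) (t : S') (u : QBasis S' → Matrix (Fin 2) (Fin 2) ℂ) :
    onReg f (mux t u) = mux (f t) (fun y => u (y ∘ f)) :=
  onReg_multiplex (qubitReg t) f _

theorem multiplex_mux (f : S' ↪ S) (t : S')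
    (u : QBasis S → QBasis S' → Matrix (Fin 2) (Fin 2) ℂ) :
    multiplex f (fun y => mux t (u y)) = mux (f t) (fun y => u y (y ∘ f)) :=
  multiplex_trans (qubitReg t) f (fun y y' => qubitOp (u y y'))

theorem mux_mem_unitaryGroup {t : S} {u : QBasis S → Matrix (Fin 2) (Fin 2) ℂ}
    (hu : IndepOf (qubitReg t) u) (hu' : ∀ y, u y ∈ Matrix.unitaryGroup (Fin 2) ℂ) :
    mux t u ∈ Matrix.unitaryGroup (QBasis S) ℂ := by
  rw [Matrix.mem_unitaryGroup_iff, Matrix.star_eq_conjTranspose, mux_conjTranspose hu,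
    mux_mul hu, ← mux_one t]
  congr 1
  funext y
  exact Matrix.mem_unitaryGroup_iff.1 (hu' y)

end Mux

/-! ## Gates and circuits -/

theorem pauliX_apply (a b : Fin 2) : pauliX a b = if a = b + 1 then 1 else 0 := by
  fin_cases a <;> fin_cases b <;> simp [pauliX]

theorem pauliX_mul_self : pauliX * pauliX = 1 := by
  ext a b
  fin_cases a <;> fin_cases b <;> simp [pauliX]

theorem pauliX_conjTranspose : pauliXᴴ = pauliX := by
  ext a b
  fin_cases a <;> fin_cases b <;> simp [pauliX]

theorem pauliX_transpose : pauliXᵀ = pauliX := by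
  ext a b
  fin_cases a <;> fin_cases b <;> simp [pauliX]

theorem pauliX_mem : pauliX ∈ Matrix.unitaryGroup (Fin 2) ℂ := by
  rw [Matrix.mem_unitaryGroup_iff, Matrix.star_eq_conjTranspose, pauliX_conjTranspose,
    pauliX_mul_self]

open Classical in
/-- The operator which maps the basis state `y` to the basis state `F y`. -/
noncomputable def basisMap {S : Type} (F : QBasis S → QBasis S) : QOp S :=
  fun x y => if x = F y then 1 else 0

theorem fin_two_cases (b : Fin 2) : b = 0 ∨ b = 1 := by
  fin_cases b <;> simp

/-- Conditional flips become maps of basis states, so that reversible arithmetic can be verified by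
composing functions. -/
theorem mux_flip {S : Type} [DecidableEq S] (t : S) (q : QBasis S → Fin 2) :
    mux t (fun y => if q y = 1 then pauliX else 1) =
      basisMap (fun y => Function.update y t (y t + q y)) := by
  classical
  ext x y
  have key : x = Function.update y t (y t + q y) ↔
      (∀ s, s ≠ t → x s = y s) ∧ x t = y t + q y := by
    constructor
    · rintro h
      exact ⟨fun s hs => by rw [h, Function.update_of_ne hs], by rw [h, Function.update_self]⟩
    · rintro ⟨h, h'⟩
      funext s
      by_cases hs : s = t
      · subst hs
        rw [h', Function.update_self]
      · rw [h s hs, Function.update_of_ne hs]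
  have e : basisMap (fun y => Function.update y t (y t + q y)) x y =
      if (∀ s, s ≠ t → x s = y s) ∧ x t = y t + q y then 1 else 0 := if_congr key rfl rfl
  rw [e]
  by_cases h : ∀ s, s ≠ t → x s = y s
  · rw [mux_of_agree h]
    rcases fin_two_cases (q y) with hc | hc
    · rw [hc, add_zero, if_neg (by decide : ¬ (0 : Fin 2) = 1), Matrix.one_apply]
      by_cases h3 : x t = y t
      · rw [if_pos h3, if_pos ⟨h, h3⟩]
      · rw [if_neg h3, if_neg (fun h' => h3 h'.2)]
    · rw [hc, if_pos rfl, pauliX_apply]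
      by_cases h3 : x t = y t + 1
      · rw [if_pos h3, if_pos ⟨h, h3⟩]
      · rw [if_neg h3, if_neg (fun h' => h3 h'.2)]
  · rw [mux_of_not_agree h, if_neg]
    exact fun h' => h h'.1

section BasisMap

variable {S : Type} [Fintype S] [DecidableEq S]

theorem mul_basisMap_apply (M : QOp S) (F : QBasis S → QBasis S) (x y : QBasis S) :
    (M * basisMap F) x y = M x (F y) := by
  simp [Matrix.mul_apply, basisMap]

theorem basisMap_mul (F G : QBasis S → QBasis S) :
    basisMap F * basisMap G = basisMap (F ∘ G) := by
  ext x y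
  rw [mul_basisMap_apply]
  rfl

theorem basisMap_mul_apply {F G : QBasis S → QBasis S} (hG : Function.LeftInverse G F)
    (hF : Function.RightInverse G F) (M : QOp S) (x y : QBasis S) :
    (basisMap F * M) x y = M (G x) y := by
  have h : ∀ w, x = F w ↔ w = G x := fun w =>
    ⟨fun h => by rw [h, hG], fun h => by rw [h, hF]⟩
  simp [Matrix.mul_apply, basisMap, h]

theorem basisMap_conjTranspose {F G : QBasis S → QBasis S} (hG : Function.LeftInverse G F)
    (hF : Function.RightInverse G F) : (basisMap F)ᴴ = basisMap G := by
  ext x y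
  have h : y = F x ↔ x = G y := ⟨fun h => by rw [h, hG], fun h => by rw [h, hF]⟩
  simp only [Matrix.conjTranspose_apply, basisMap, h]
  split_ifs <;> simp

theorem flip_involutive (t : S) {q : QBasis S → Fin 2} (hq : IndepOf (qubitReg t) q) :
    Function.Involutive (fun y : QBasis S => Function.update y t (y t + q y)) := by
  intro y
  have h : q (Function.update y t (y t + q y)) = q y :=
    hq _ _ (agreeOff_qubitReg.2 fun s hs => Function.update_of_ne hs _ _)
  have h2 : ∀ a b : Fin 2, a + b + b = a := by decide
  simp only [h, Function.update_self, Function.update_idem, h2, Function.update_eq_self]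

end BasisMap

namespace QGate

variable {S S' : Type}

theorem op_single (t : S) (U : Matrix.unitaryGroup (Fin 2) ℂ) :
    (QGate.single t U).op = mux t (fun _ => U.1) := by
  ext x y
  by_cases h : ∀ s, s ≠ t → x s = y s
  · rw [mux_of_agree h]
    exact if_pos h
  · rw [mux_of_not_agree h]
    exact if_neg h

theorem op_cnot {c t : S} (hct : c ≠ t) :
    (QGate.cnot c t hct).op = mux t (fun y => if y c = 1 then pauliX else 1) := by
  classical
  rw [mux_flip t (fun y => y c)]
  ext x y
  simp only [QGate.op, basisMap]

/-- Relabelling of the qubits of a gate. -/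
def map (f : S' ↪ S) : QGate S' → QGate S
  | .single w U => .single (f w) U
  | .cnot c t h => .cnot (f c) (f t) (fun h' => h (f.injective h'))

/-- The inverse gate. -/
def adjoint : QGate S → QGate S
  | .single w U => .single w (star U)
  | .cnot c t h => .cnot c t h

/-- The transposed gate. -/
def transpose : QGate S → QGate S
  | .single w U => .single w ⟨U.1ᵀ, by
      have := Matrix.mem_unitaryGroup_iff'.1 U.2
      rw [Matrix.mem_unitaryGroup_iff, Matrix.star_eq_conjTranspose]
      rw [Matrix.star_eq_conjTranspose] at this
      have h2 := congrArg Matrix.transpose this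
      rw [Matrix.transpose_mul, Matrix.transpose_one] at h2
      exact h2⟩
  | .cnot c t h => .cnot c t h

variable [Fintype S] [DecidableEq S] [Fintype S'] [DecidableEq S']

theorem indep_cnot {c t : S} (hct : c ≠ t) (u v : Matrix (Fin 2) (Fin 2) ℂ) :
    IndepOf (qubitReg t) (fun y : QBasis S => if y c = 1 then u else v) := by
  intro x y h
  simp only [agreeOff_qubitReg.1 h c hct]

theorem op_map (f : S' ↪ S) (g : QGate S') : (g.map f).op = onReg f g.op := by
  cases g with
  | single w U => rw [map, op_single, op_single, onReg_mux]
  | cnot c t h => rw [map, op_cnot, op_cnot, onReg_mux]; rfl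

theorem op_adjoint (g : QGate S) : g.adjoint.op = g.opᴴ := by
  cases g with
  | single w U => rw [adjoint, op_single, op_single, mux_conjTranspose (IndepOf.const _ _)]; rfl
  | cnot c t h =>
    rw [adjoint, op_cnot, mux_conjTranspose (indep_cnot h _ _)]
    congr 1
    funext y
    split_ifs
    · rw [pauliX_conjTranspose]
    · rw [Matrix.conjTranspose_one]

theorem op_transpose (g : QGate S) : g.transpose.op = g.opᵀ := by
  cases g with
  | single w U => rw [transpose, op_single, op_single, mux_transpose (IndepOf.const _ _)]
  | cnot c t h =>
    rw [transpose, op_cnot, mux_transpose (indep_cnot h _ _)]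
    congr 1
    funext y
    split_ifs
    · rw [pauliX_transpose]
    · rw [Matrix.transpose_one]

theorem op_mem_unitaryGroup (g : QGate S) : g.op ∈ Matrix.unitaryGroup (QBasis S) ℂ := by
  cases g with
  | single w U => rw [op_single]; exact mux_mem_unitaryGroup (IndepOf.const _ _) (fun _ => U.2)
  | cnot c t h =>
    rw [op_cnot]
    refine mux_mem_unitaryGroup (indep_cnot h _ _) (fun y => ?_)
    split_ifs
    · exact pauliX_mem
    · exact one_mem _

end QGate

section Circuit

variable {S S' : Type} [Fintype S] [DecidableEq S] [Fintype S'] [DecidableEq S']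

theorem circuitOp_append (gs hs : List (QGate S)) :
    circuitOp (gs ++ hs) = circuitOp hs * circuitOp gs := by
  induction gs with
  | nil => simp [circuitOp]
  | cons g gs ih => rw [List.cons_append, circuitOp, ih, circuitOp, Matrix.mul_assoc]

theorem circuitOp_singleton (g : QGate S) : circuitOp [g] = g.op := by
  simp [circuitOp]

theorem circuitOp_mem_unitaryGroup (gs : List (QGate S)) :
    circuitOp gs ∈ Matrix.unitaryGroup (QBasis S) ℂ := by
  induction gs with
  | nil => exact one_mem _
  | cons g gs ih => exact mul_mem ih g.op_mem_unitaryGroup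

theorem circuitOp_map (f : S' ↪ S) (gs : List (QGate S')) :
    circuitOp (gs.map (QGate.map f)) = onReg f (circuitOp gs) := by
  induction gs with
  | nil => exact (onReg_one f).symm
  | cons g gs ih => rw [List.map_cons, circuitOp, ih, circuitOp, onReg_mul, QGate.op_map]

theorem circuitOp_adjoint (gs : List (QGate S)) :
    circuitOp (gs.reverse.map QGate.adjoint) = (circuitOp gs)ᴴ := by
  induction gs with
  | nil => exact (Matrix.conjTranspose_one).symm
  | cons g gs ih =>
    rw [List.reverse_cons, List.map_append, circuitOp_append, ih, List.map_singleton,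
      circuitOp_singleton, circuitOp, Matrix.conjTranspose_mul, QGate.op_adjoint]

theorem circuitOp_transpose (gs : List (QGate S)) :
    circuitOp (gs.reverse.map QGate.transpose) = (circuitOp gs)ᵀ := by
  induction gs with
  | nil => exact (Matrix.transpose_one).symm
  | cons g gs ih =>
    rw [List.reverse_cons, List.map_append, circuitOp_append, ih, List.map_singleton,
      circuitOp_singleton, circuitOp, Matrix.transpose_mul, QGate.op_transpose]

/-- `A` is the operator of a circuit of at most `c` gates. -/
def Synth (A : QOp S) (c : ℕ) : Prop := ∃ gs : List (QGate S), gs.length ≤ c ∧ circuitOp gs = A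

namespace Synth

theorem one : Synth (1 : QOp S) 0 := ⟨[], le_rfl, rfl⟩

theorem gate (g : QGate S) : Synth g.op 1 := ⟨[g], le_rfl, circuitOp_singleton g⟩

theorem mul {A B : QOp S} {c c' : ℕ} (hA : Synth A c) (hB : Synth B c') :
    Synth (A * B) (c + c') := by
  obtain ⟨gs, hl, rfl⟩ := hA
  obtain ⟨hs, hl', rfl⟩ := hB
  exact ⟨hs ++ gs, by rw [List.length_append]; omega, circuitOp_append hs gs⟩

theorem mono {A : QOp S} {c c' : ℕ} (hA : Synth A c) (h : c ≤ c') : Synth A c' := by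
  obtain ⟨gs, hl, rfl⟩ := hA
  exact ⟨gs, hl.trans h, rfl⟩

theorem onReg {A : QOp S'} {c : ℕ} (hA : Synth A c) (f : S' ↪ S) : Synth (onReg f A) c := by
  obtain ⟨gs, hl, rfl⟩ := hA
  exact ⟨gs.map (QGate.map f), by rwa [List.length_map], circuitOp_map f gs⟩

theorem conjTranspose {A : QOp S} {c : ℕ} (hA : Synth A c) : Synth Aᴴ c := by
  obtain ⟨gs, hl, rfl⟩ := hA
  exact ⟨gs.reverse.map QGate.adjoint, by rwa [List.length_map, List.length_reverse],
    circuitOp_adjoint gs⟩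

/-- The transpose of a one-qubit unitary is unitary and a C-NOT is symmetric. This is what provides
the outer `Uᵀ` of the linear combination at the price of `U`. -/
theorem transpose {A : QOp S} {c : ℕ} (hA : Synth A c) : Synth Aᵀ c := by
  obtain ⟨gs, hl, rfl⟩ := hA
  exact ⟨gs.reverse.map QGate.transpose, by rwa [List.length_map, List.length_reverse],
    circuitOp_transpose gs⟩

theorem mem_unitaryGroup {A : QOp S} {c : ℕ} (hA : Synth A c) :
    A ∈ Matrix.unitaryGroup (QBasis S) ℂ := by
  obtain ⟨gs, _, rfl⟩ := hA
  exact circuitOp_mem_unitaryGroup gs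

theorem single (t : S) {u : Matrix (Fin 2) (Fin 2) ℂ} (hu : u ∈ Matrix.unitaryGroup (Fin 2) ℂ) :
    Synth (mux t (fun _ => u)) 1 := by
  rw [← QGate.op_single t ⟨u, hu⟩]
  exact gate _

theorem cnot {c t : S} (hct : c ≠ t) :
    Synth (mux t (fun y => if y c = 1 then pauliX else 1)) 1 := by
  rw [← QGate.op_cnot hct]
  exact gate _

end Synth

end Circuit

/-! ## Uniformly controlled gates -/

/-- `A` depends only on the bits in `K`. -/
def DependsOnBits {S α : Type} (K : Finset S) (A : QBasis S → α) : Prop :=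
  ∀ x y, (∀ s ∈ K, x s = y s) → A x = A y

/-- Rotation of the first axis towards the second one. -/
noncomputable def rotY (θ : ℝ) : Matrix (Fin 2) (Fin 2) ℂ :=
  !![(Real.cos θ : ℂ), -(Real.sin θ : ℂ); (Real.sin θ : ℂ), (Real.cos θ : ℂ)]

/-- The phases `θ` on `|0⟩` and `-θ` on `|1⟩`. -/
noncomputable def rotZ (θ : ℝ) : Matrix (Fin 2) (Fin 2) ℂ :=
  Matrix.diagonal (fun b => if b = 0 then Complex.exp (θ * Complex.I)
    else Complex.exp (-θ * Complex.I))

/-- A one-parameter group of one-qubit unitaries which is inverted by conjugation with `X`. -/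
structure IsRotation (R : ℝ → Matrix (Fin 2) (Fin 2) ℂ) : Prop where
  mem : ∀ θ, R θ ∈ Matrix.unitaryGroup (Fin 2) ℂ
  add : ∀ θ θ', R (θ + θ') = R θ * R θ'
  conj : ∀ θ, pauliX * R θ * pauliX = R (-θ)

theorem isRotation_rotY : IsRotation rotY where
  mem θ := by
    rw [Matrix.mem_unitaryGroup_iff, Matrix.star_eq_conjTranspose]
    have h : (Real.sin θ : ℂ) ^ 2 + (Real.cos θ : ℂ) ^ 2 = 1 := by
      exact_mod_cast Real.sin_sq_add_cos_sq θ
    ext a b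
    fin_cases a <;> fin_cases b <;>
      simp [rotY, Matrix.mul_apply, Fin.sum_univ_two, -Complex.ofReal_sin,
        -Complex.ofReal_cos] <;> first | linear_combination h | ring
  add θ θ' := by
    have hc : (Real.cos (θ + θ') : ℂ) = Real.cos θ * Real.cos θ' - Real.sin θ * Real.sin θ' := by
      exact_mod_cast Real.cos_add θ θ'
    have hs : (Real.sin (θ + θ') : ℂ) = Real.sin θ * Real.cos θ' + Real.cos θ * Real.sin θ' := by
      exact_mod_cast Real.sin_add θ θ'
    ext a b
    fin_cases a <;> fin_cases b <;>
      simp only [rotY, hc, hs, Matrix.mul_apply, Fin.sum_univ_two, Fin.zero_eta, Fin.mk_one,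
        Matrix.of_apply, Matrix.cons_val_zero, Matrix.cons_val_one, Matrix.cons_val'] <;>
      simp [-Complex.ofReal_sin, -Complex.ofReal_cos] <;> ring
  conj θ := by
    ext a b
    fin_cases a <;> fin_cases b <;>
      simp [rotY, pauliX, Matrix.mul_apply, Fin.sum_univ_two]

theorem isRotation_rotZ : IsRotation rotZ where
  mem θ := by
    rw [Matrix.mem_unitaryGroup_iff, Matrix.star_eq_conjTranspose]
    ext a b
    fin_cases a <;> fin_cases b <;>
      simp [rotZ, ← Complex.exp_conj, ← Complex.exp_add]
  add θ θ' := by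
    ext a b
    fin_cases a <;> fin_cases b <;>
      simp [rotZ, ← Complex.exp_add] <;> ring_nf
  conj θ := by
    ext a b
    simp only [rotZ, Matrix.mul_apply (M := pauliX * _), Matrix.mul_diagonal, Fin.sum_univ_two]
    fin_cases a <;> fin_cases b <;> simp [pauliX]

/-- The moduli of the first column are a cosine and a sine; its phases go into the left diagonal,
and the determinant fixes the remaining phase on the right. -/
theorem exists_euler_angles {u : Matrix (Fin 2) (Fin 2) ℂ}
    (hu : u ∈ Matrix.unitaryGroup (Fin 2) ℂ) :
    ∃ (α ε : Fin 2 → ℝ) (θ : ℝ),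
      u = Matrix.diagonal (fun b => Complex.exp (α b * Complex.I)) * rotY θ *
        Matrix.diagonal (fun b => Complex.exp (ε b * Complex.I)) := by
  have h1 := Matrix.mem_unitaryGroup_iff'.1 hu
  have h2 := Matrix.mem_unitaryGroup_iff.1 hu
  rw [Matrix.star_eq_conjTranspose] at h1 h2
  have e00 := congrFun (congrFun h1 0) 0
  have e01 := congrFun (congrFun h1 0) 1
  simp only [Matrix.mul_apply, Fin.sum_univ_two, Matrix.conjTranspose_apply, Matrix.one_apply,
    if_true, Fin.reduceEq, if_false, RCLike.star_def] at e00 e01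
  set D : ℂ := u.det with hD
  have hDn : ‖D‖ = 1 := by
    exact CStarRing.norm_of_mem_unitary (Matrix.det_of_mem_unitary hu)
  have hDe : D = u 0 0 * u 1 1 - u 0 1 * u 1 0 := by rw [hD, Matrix.det_fin_two]
  -- A `2 × 2` unitary is determined by its first column and its determinant.
  have u01 : u 0 1 = -D * (starRingEnd ℂ) (u 1 0) := by
    rw [hDe]; linear_combination (-u 0 1) * e00 + u 0 0 * e01
  have u11 : u 1 1 = D * (starRingEnd ℂ) (u 0 0) := by
    rw [hDe]; linear_combination (-u 1 1) * e00 + u 1 0 * e01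
  have hsq : ‖u 0 0‖ ^ 2 + ‖u 1 0‖ ^ 2 = 1 := by
    have h3 : ((‖u 0 0‖ ^ 2 + ‖u 1 0‖ ^ 2 : ℝ) : ℂ) = 1 := by
      push_cast
      rw [← Complex.conj_mul', ← Complex.conj_mul', e00]
    exact_mod_cast h3
  have hcos : Real.cos (Real.arccos ‖u 0 0‖) = ‖u 0 0‖ :=
    Real.cos_arccos (by linarith [norm_nonneg (u 0 0)]) (by nlinarith [norm_nonneg (u 0 0)])
  have hsin : Real.sin (Real.arccos ‖u 0 0‖) = ‖u 1 0‖ := by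
    rw [Real.sin_arccos, ← hsq, add_sub_cancel_left, Real.sqrt_sq (norm_nonneg _)]
  have p0 := Complex.norm_mul_exp_arg_mul_I (u 0 0)
  have p1 := Complex.norm_mul_exp_arg_mul_I (u 1 0)
  have pD := Complex.norm_mul_exp_arg_mul_I D
  rw [hDn, Complex.ofReal_one, one_mul] at pD
  have c0 := congrArg (starRingEnd ℂ) p0
  have c1 := congrArg (starRingEnd ℂ) p1
  rw [map_mul, Complex.conj_ofReal, ← Complex.exp_conj, map_mul, Complex.conj_ofReal,
    Complex.conj_I] at c0 c1
  have i0 : Complex.exp ((u 0 0).arg * Complex.I) * Complex.exp ((u 0 0).arg * -Complex.I) = 1 := by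
    rw [← Complex.exp_add]; simp
  have i1 : Complex.exp ((u 1 0).arg * Complex.I) * Complex.exp ((u 1 0).arg * -Complex.I) = 1 := by
    rw [← Complex.exp_add]; simp
  refine ⟨![(u 0 0).arg, (u 1 0).arg], ![0, D.arg - (u 0 0).arg - (u 1 0).arg],
    Real.arccos ‖u 0 0‖, ?_⟩
  have ex : Complex.exp (((D.arg - (u 0 0).arg - (u 1 0).arg : ℝ) : ℂ) * Complex.I) =
      D * Complex.exp ((u 0 0).arg * -Complex.I) * Complex.exp ((u 1 0).arg * -Complex.I) := by
    have h : ((D.arg - (u 0 0).arg - (u 1 0).arg : ℝ) : ℂ) * Complex.I =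
        D.arg * Complex.I + (u 0 0).arg * -Complex.I + (u 1 0).arg * -Complex.I := by
      push_cast
      ring
    rw [h, Complex.exp_add, Complex.exp_add, pD]
  ext a b
  rw [Matrix.mul_diagonal, Matrix.diagonal_mul]
  fin_cases a <;> fin_cases b
  · simp only [rotY, hcos, hsin, Fin.zero_eta, Matrix.cons_val_zero, Matrix.of_apply,
      Complex.ofReal_zero, zero_mul, Complex.exp_zero, Matrix.cons_val']
    linear_combination -p0
  · simp only [rotY, hcos, hsin, Fin.zero_eta, Fin.mk_one, Matrix.cons_val_zero,
      Matrix.cons_val_one, Matrix.of_apply, Matrix.cons_val', ex, u01, ← c1]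
    linear_combination (D * ‖u 1 0‖ * Complex.exp ((u 1 0).arg * -Complex.I)) * i0
  · simp only [rotY, hcos, hsin, Fin.zero_eta, Fin.mk_one, Matrix.cons_val_zero,
      Matrix.cons_val_one, Matrix.of_apply, Matrix.cons_val', Complex.ofReal_zero, zero_mul,
      Complex.exp_zero]
    linear_combination -p1
  · simp only [rotY, hcos, hsin, Fin.mk_one, Matrix.cons_val_zero,
      Matrix.cons_val_one, Matrix.of_apply, Matrix.cons_val', ex, u11, ← c0]
    linear_combination -(D * ‖u 0 0‖ * Complex.exp ((u 0 0).arg * -Complex.I)) * i1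

section Mux

variable {S : Type} [Fintype S] [DecidableEq S]

theorem DependsOnBits.indepOf {α : Type} {K : Finset S} {A : QBasis S → α}
    (h : DependsOnBits K A) {t : S} (ht : t ∉ K) : IndepOf (qubitReg t) A := by
  intro x y hxy
  refine h x y fun s hs => agreeOff_qubitReg.1 hxy s ?_
  rintro rfl
  exact ht hs

theorem DependsOnBits.comp {α β : Type} {K : Finset S} {A : QBasis S → α}
    (h : DependsOnBits K A) (g : α → β) : DependsOnBits K (fun y => g (A y)) :=
  fun x y hxy => congrArg g (h x y hxy)

theorem DependsOnBits.update {α : Type} {K : Finset S} {s : S} {A : QBasis S → α}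
    (h : DependsOnBits (insert s K) A) (b : Fin 2) :
    DependsOnBits K (fun y => A (Function.update y s b)) := by
  intro x y hxy
  refine h _ _ fun s' hs' => ?_
  by_cases e : s' = s
  · subst e
    rw [Function.update_self, Function.update_self]
  · rw [Function.update_of_ne e, Function.update_of_ne e]
    exact hxy s' ((Finset.mem_insert.1 hs').resolve_left e)

/-- A control is removed by half-sum and half-difference of the angles: two C-NOTs around the second
rotation invert it exactly when the control is set. The count obeys `c ↦ 2 c + 2` from `1`, which `3
* 2 ^ k - 2` solves. -/
theorem synth_mux_rotation {R : ℝ → Matrix (Fin 2) (Fin 2) ℂ} (hR : IsRotation R) (t : S)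
    (K : Finset S) (ht : t ∉ K) :
    ∀ θ : QBasis S → ℝ, DependsOnBits K θ →
      Synth (mux t (fun y => R (θ y))) (3 * 2 ^ K.card - 2) := by
  induction K using Finset.induction_on with
  | empty =>
    intro θ hθ
    have : (fun y => R (θ y)) = fun _ => R (θ 0) := by
      funext y
      rw [hθ y 0 (by simp)]
    rw [this]
    exact (Synth.single t (hR.mem _)).mono (by simp)
  | insert s K hs ih =>
    intro θ hθ
    have hst : s ≠ t := fun h => ht (h ▸ Finset.mem_insert_self s K)
    have htK : t ∉ K := fun h => ht (Finset.mem_insert_of_mem h)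
    have ha : DependsOnBits K
        (fun y => (θ (Function.update y s 0) + θ (Function.update y s 1)) / 2) := by
      intro x y hxy
      have h0 := hθ.update 0 x y hxy
      have h1 := hθ.update 1 x y hxy
      simp only at h0 h1
      simp only [h0, h1]
    have hb : DependsOnBits K
        (fun y => (θ (Function.update y s 0) - θ (Function.update y s 1)) / 2) := by
      intro x y hxy
      have h0 := hθ.update 0 x y hxy
      have h1 := hθ.update 1 x y hxy
      simp only at h0 h1
      simp only [h0, h1]
    have hc := Synth.cnot hst
    have key := (((ih htK _ ha).mul hc).mul (ih htK _ hb)).mul hc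
    have hX : IndepOf (qubitReg t) (fun y : QBasis S => if y s = 1 then pauliX else 1) :=
      QGate.indep_cnot hst _ _
    have hra := (ha.comp R).indepOf htK
    have hrb := (hb.comp R).indepOf htK
    rw [mux_mul hra, mux_mul (fun x y h => by simp only [hra x y h, hX x y h]),
      mux_mul (fun x y h => by simp only [hra x y h, hX x y h, hrb x y h])] at key
    have e : (fun y => R (θ y)) = fun y =>
        R ((θ (Function.update y s 0) + θ (Function.update y s 1)) / 2) *
          (if y s = 1 then pauliX else 1) *
          R ((θ (Function.update y s 0) - θ (Function.update y s 1)) / 2) *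
          (if y s = 1 then pauliX else 1) := by
      funext y
      rcases fin_two_cases (y s) with h | h
      · rw [h, if_neg (by decide), mul_one, mul_one, ← hR.add]
        congr 1
        rw [← h, Function.update_eq_self]
        ring
      · rw [h, if_pos rfl, Matrix.mul_assoc, Matrix.mul_assoc, ← Matrix.mul_assoc pauliX,
          hR.conj, ← hR.add]
        congr 1
        rw [← h, Function.update_eq_self]
        ring
    rw [e]
    refine key.mono ?_
    rw [Finset.card_insert_of_notMem hs, pow_succ]
    have : 1 ≤ 2 ^ K.card := Nat.one_le_two_pow
    omega

theorem mux_diagonal (t : S) (d : QBasis S → Fin 2 → ℂ) :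
    mux t (fun y => Matrix.diagonal (d y)) = Matrix.diagonal (fun y => d y (y t)) := by
  ext x y
  by_cases h : ∀ s, s ≠ t → x s = y s
  · rw [mux_of_agree h]
    by_cases hxy : x t = y t
    · have : x = y := by
        funext s
        by_cases hs : s = t
        · rw [hs, hxy]
        · exact h s hs
      subst this
      rw [Matrix.diagonal_apply_eq, Matrix.diagonal_apply_eq]
    · rw [Matrix.diagonal_apply_ne _ hxy, Matrix.diagonal_apply_ne]
      rintro rfl
      exact hxy rfl
  · rw [mux_of_not_agree h, Matrix.diagonal_apply_ne]
    rintro rfl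
    exact h fun _ _ => rfl

/-- The mean of the phase over a bit no longer depends on that bit, and the deviation is a uniformly
controlled `rotZ` on it. A qubit must exist to carry the global phase left when `K` is empty. -/
theorem synth_diagonal [Nonempty S] (K : Finset S) :
    ∀ φ : QBasis S → ℝ, DependsOnBits K φ →
      Synth (Matrix.diagonal fun y => Complex.exp (φ y * Complex.I)) (3 * 2 ^ K.card) := by
  induction K using Finset.induction_on with
  | empty =>
    intro φ hφ
    obtain ⟨t⟩ := ‹Nonempty S›
    have : (Matrix.diagonal fun y : QBasis S => Complex.exp (φ y * Complex.I)) =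
        mux t (fun _ => Matrix.diagonal fun _ => Complex.exp (φ 0 * Complex.I)) := by
      rw [mux_diagonal]
      congr 1
      funext y
      rw [hφ y 0 (by simp)]
    rw [this]
    refine (Synth.single t ?_).mono (by simp)
    rw [Matrix.mem_unitaryGroup_iff, Matrix.star_eq_conjTranspose, Matrix.diagonal_conjTranspose,
      Matrix.diagonal_mul_diagonal, ← Matrix.diagonal_one]
    congr 1
    funext b
    simp [← Complex.exp_conj, ← Complex.exp_add]
  | insert s K hs ih =>
    intro φ hφ
    have ha : DependsOnBits K
        (fun y => (φ (Function.update y s 0) + φ (Function.update y s 1)) / 2) := by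
      intro x y hxy
      have h0 := hφ.update 0 x y hxy
      have h1 := hφ.update 1 x y hxy
      simp only at h0 h1
      simp only [h0, h1]
    have hb : DependsOnBits K
        (fun y => (φ (Function.update y s 0) - φ (Function.update y s 1)) / 2) := by
      intro x y hxy
      have h0 := hφ.update 0 x y hxy
      have h1 := hφ.update 1 x y hxy
      simp only at h0 h1
      simp only [h0, h1]
    have key := (ih _ ha).mul (synth_mux_rotation isRotation_rotZ s K hs _ hb)
    simp only [rotZ] at key
    rw [mux_diagonal, Matrix.diagonal_mul_diagonal] at key
    have e : (fun y => Complex.exp (φ y * Complex.I)) = fun y =>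
        Complex.exp ((((φ (Function.update y s 0) + φ (Function.update y s 1)) / 2 : ℝ) : ℂ) *
          Complex.I) * if y s = 0 then
          Complex.exp ((((φ (Function.update y s 0) - φ (Function.update y s 1)) / 2 : ℝ) : ℂ) *
            Complex.I) else
          Complex.exp (-(((φ (Function.update y s 0) - φ (Function.update y s 1)) / 2 : ℝ) : ℂ) *
            Complex.I) := by
      funext y
      rcases fin_two_cases (y s) with h | h
      · rw [if_pos h, ← Complex.exp_add, ← h, Function.update_eq_self]
        congr 1
        push_cast
        ring
      · rw [if_neg (by rw [h]; decide), ← Complex.exp_add, ← h, Function.update_eq_self]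
        congr 1
        push_cast
        ring
    rw [e]
    refine key.mono ?_
    rw [Finset.card_insert_of_notMem hs, pow_succ]
    have : 1 ≤ 2 ^ K.card := Nat.one_le_two_pow
    omega

/-- Two diagonal operators on `K` and `t` cost `3 * 2 ^ (k + 1)` each and the rotation between them
less than `3 * 2 ^ k`, which gives the constant `15`. -/
theorem synth_mux {t : S} {K : Finset S} (ht : t ∉ K)
    {u : QBasis S → Matrix (Fin 2) (Fin 2) ℂ} (hu : DependsOnBits K u)
    (hu' : ∀ y, u y ∈ Matrix.unitaryGroup (Fin 2) ℂ) : Synth (mux t u) (15 * 2 ^ K.card) := by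
  classical
  have : Nonempty S := ⟨t⟩
  -- The angles are chosen as functions of the matrix, not of `y`, so that they inherit the
  -- dependence of `u` on `K` alone; non-unitary matrices receive the default zero.
  have hE : ∀ v : Matrix (Fin 2) (Fin 2) ℂ, ∃ p : (Fin 2 → ℝ) × (Fin 2 → ℝ) × ℝ,
      v ∈ Matrix.unitaryGroup (Fin 2) ℂ →
      v = Matrix.diagonal (fun b => Complex.exp (p.1 b * Complex.I)) * rotY p.2.2 *
        Matrix.diagonal (fun b => Complex.exp (p.2.1 b * Complex.I)) := by
    intro v
    by_cases hv : v ∈ Matrix.unitaryGroup (Fin 2) ℂ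
    · obtain ⟨α, ε, θ, h⟩ := exists_euler_angles hv
      exact ⟨(α, ε, θ), fun _ => h⟩
    · exact ⟨(0, 0, 0), fun h => absurd h hv⟩
  choose p hp using hE
  have dep : ∀ a : Matrix (Fin 2) (Fin 2) ℂ → Fin 2 → ℝ,
      DependsOnBits (insert t K) (fun y => a (u y) (y t)) := by
    intro a x y hxy
    simp only [hu x y (fun s hs => hxy s (Finset.mem_insert_of_mem hs)),
      hxy t (Finset.mem_insert_self t K)]
  have k1 := synth_diagonal _ _ (dep fun v => (p v).1)
  have k2 := synth_mux_rotation isRotation_rotY t K ht _ (hu.comp fun v => (p v).2.2)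
  have k3 := synth_diagonal _ _ (dep fun v => (p v).2.1)
  rw [← mux_diagonal t (fun y b => Complex.exp ((p (u y)).1 b * Complex.I))] at k1
  rw [← mux_diagonal t (fun y b => Complex.exp ((p (u y)).2.1 b * Complex.I))] at k3
  have key := (k1.mul k2).mul k3
  have hi := hu.indepOf ht
  rw [mux_mul (fun x y h => by simp only [hi x y h]),
    mux_mul (fun x y h => by simp only [hi x y h])] at key
  have e : u = fun y => Matrix.diagonal (fun b => Complex.exp ((p (u y)).1 b * Complex.I)) *
      rotY (p (u y)).2.2 *
        Matrix.diagonal (fun b => Complex.exp ((p (u y)).2.1 b * Complex.I)) :=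
    funext fun y => hp (u y) (hu' y)
  rw [e]
  refine key.mono ?_
  rw [Finset.card_insert_of_notMem ht, pow_succ]
  omega

end Mux

/-! ## Circuits with pure ancillas -/

section Ancillas

variable {S S' Z : Type} [Fintype S] [DecidableEq S] [Fintype S'] [DecidableEq S']
  [Fintype Z] [DecidableEq Z]

theorem control_eq_mul {f : S' ↪ S} {z : S} (hz : z ∉ Set.range f) (A B : QOp S') :
    multiplex f (fun y => if y z = 1 then A * B else 1) =
      multiplex f (fun y => if y z = 1 then A else 1) *
        multiplex f (fun y => if y z = 1 then B else 1) := by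
  rw [multiplex_mul _ _ fun x y h => by simp only [h z hz]]
  congr 1
  funext y
  split_ifs
  · rfl
  · rw [mul_one]

/-- Gates are controlled one by one. The worst case is a C-NOT, which becomes an `X` with two
controls and costs `15 * 2 ^ 2 = 60`. -/
theorem Synth.control {A : QOp S'} {c : ℕ} (hA : Synth A c) {f : S' ↪ S} {z : S}
    (hz : z ∉ Set.range f) :
    Synth (multiplex f (fun y => if y z = 1 then A else 1)) (60 * c) := by
  obtain ⟨gs, hl, rfl⟩ := hA
  refine Synth.mono ?_ (Nat.mul_le_mul_left 60 hl)
  clear hl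
  induction gs with
  | nil =>
    simp only [circuitOp, ite_self]
    rw [multiplex_one]
    exact Synth.one
  | cons g gs ih =>
    rw [circuitOp, control_eq_mul hz, List.length_cons, mul_add, mul_one]
    refine ih.mul ?_
    cases g with
    | single w U =>
      have e : (fun y : QBasis S => if y z = 1 then (QGate.single w U).op else 1) =
          fun y => mux w (fun _ => if y z = 1 then U.1 else 1) := by
        funext y
        split_ifs
        · rw [QGate.op_single]
        · rw [mux_one]
      rw [e, multiplex_mux]
      have hw : f w ∉ ({z} : Finset S) := by
        rw [Finset.mem_singleton]
        rintro rfl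
        exact hz ⟨w, rfl⟩
      refine (synth_mux hw (fun x y h => ?_) fun y => ?_).mono (by simp)
      · simp only [h z (Finset.mem_singleton_self z)]
      · split_ifs
        · exact U.2
        · exact one_mem _
    | cnot s t hst =>
      have e : (fun y : QBasis S => if y z = 1 then (QGate.cnot s t hst).op else 1) =
          fun y => mux t (fun y' => if y z = 1 ∧ y' s = 1 then pauliX else 1) := by
        funext y
        split_ifs with h
        · rw [QGate.op_cnot]
          simp [h]
        · simp only [h, false_and, if_false]
          rw [mux_one]
      rw [e, multiplex_mux]
      have hw : f t ∉ ({z, f s} : Finset S) := by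
        rw [Finset.mem_insert, Finset.mem_singleton]
        rintro (rfl | h)
        · exact hz ⟨t, rfl⟩
        · exact hst (f.injective h.symm)
      refine (synth_mux hw (fun x y h => ?_) fun y => ?_).mono ?_
      · simp only [h z (by simp), Function.comp_apply, h (f s) (by simp)]
      · split_ifs
        · exact pauliX_mem
        · exact one_mem _
      · calc 15 * 2 ^ ({z, f s} : Finset S).card ≤ 15 * 2 ^ 2 :=
              Nat.mul_le_mul_left _ (Nat.pow_le_pow_right (by norm_num) Finset.card_le_two)
          _ = 60 := rfl

/-- On states with the ancillas in `|0⟩`, `M` acts as `A` and returns the ancillas to `|0⟩`. -/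
def Restricts (M : QOp (S ⊕ Z)) (A : QOp S) : Prop :=
  ∀ (x y : QBasis S) (z : QBasis Z), M (Sum.elim x z) (Sum.elim y 0) = if z = 0 then A x y else 0

theorem sum_qbasis_sum (G : QBasis (S ⊕ Z) → ℂ) :
    ∑ w, G w = ∑ x : QBasis S, ∑ z : QBasis Z, G (Sum.elim x z) := by
  rw [← Fintype.sum_prod_type' (f := fun x z => G (Sum.elim x z))]
  exact Fintype.sum_equiv (Equiv.sumArrowEquivProdArrow S Z (Fin 2)) _ _
    (fun w => by
      congr 1
      funext s
      cases s <;> rfl)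

theorem Restricts.mul {M N : QOp (S ⊕ Z)} {A B : QOp S} (hM : Restricts M A)
    (hN : Restricts N B) : Restricts (M * N) (A * B) := by
  intro x y z
  rw [Matrix.mul_apply, sum_qbasis_sum]
  simp only [hN _ y, mul_ite, mul_zero, Finset.sum_ite_eq', Finset.mem_univ,
    if_true]
  simp only [hM x, ite_mul, zero_mul, Matrix.mul_apply]
  split_ifs
  · rfl
  · exact Finset.sum_const_zero

theorem agreeOff_sumMap {f : S' ↪ S} {x y : QBasis S} {z z' : QBasis Z} :
    AgreeOff (f.sumMap (Function.Embedding.refl Z)) (Sum.elim x z) (Sum.elim y z') ↔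
      AgreeOff f x y := by
  constructor
  · intro h s hs
    refine h (Sum.inl s) ?_
    rintro ⟨a | a, ha⟩
    · exact hs ⟨a, Sum.inl.inj ha⟩
    · cases ha
  · rintro h (s | s) hs
    · refine h s ?_
      rintro ⟨a, rfl⟩
      exact hs ⟨Sum.inl a, rfl⟩
    · exact absurd ⟨Sum.inr s, rfl⟩ hs

theorem restricts_multiplex {f : S' ↪ S} {M : QBasis (S ⊕ Z) → QOp (S' ⊕ Z)}
    {A : QBasis S → QOp S'} (h : ∀ y, Restricts (M (Sum.elim y 0)) (A y)) :
    Restricts (multiplex (f.sumMap (Function.Embedding.refl Z)) M) (multiplex f A) := by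
  intro x y z
  by_cases hxy : AgreeOff f x y
  · rw [multiplex_of_agree (agreeOff_sumMap.2 hxy), multiplex_of_agree hxy, ← h y]
    congr 1 <;> funext s <;> cases s <;> rfl
  · rw [multiplex_of_not_agree (fun h' => hxy (agreeOff_sumMap.1 h')),
      multiplex_of_not_agree hxy, ite_self]

theorem agreeOff_inl {x y : QBasis S} {z z' : QBasis Z} :
    AgreeOff (Function.Embedding.inl : S ↪ S ⊕ Z) (Sum.elim x z) (Sum.elim y z') ↔ z = z' := by
  constructor
  · intro h
    funext s
    exact h (Sum.inr s) (by rintro ⟨a, ha⟩; cases ha)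
  · rintro rfl (s | s) hs
    · exact absurd ⟨s, rfl⟩ hs
    · rfl

theorem restricts_onReg_inl (A : QOp S) :
    Restricts (onReg (Function.Embedding.inl : S ↪ S ⊕ Z) A) A := by
  intro x y z
  by_cases h : z = 0
  · rw [if_pos h]
    exact multiplex_of_agree (agreeOff_inl.2 h)
  · rw [if_neg h]
    exact multiplex_of_not_agree (fun h' => h (agreeOff_inl.1 h'))

/-- The columns of `M` with zero ancillas vanish off the zero ancilla state, so their inner products
are those of the columns of `A`. -/
theorem Restricts.sum_conj_mul {M : QOp (S ⊕ Z)} {A : QOp S} (hM : Restricts M A)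
    (hu : M ∈ Matrix.unitaryGroup (QBasis (S ⊕ Z)) ℂ) :
    A ∈ Matrix.unitaryGroup (QBasis S) ℂ := by
  rw [Matrix.mem_unitaryGroup_iff'] at hu ⊢
  ext y y'
  have := congrFun (congrFun hu (Sum.elim y 0)) (Sum.elim y' 0)
  rw [Matrix.mul_apply, sum_qbasis_sum] at this
  have h2 : ∀ x : QBasis S, ∑ z : QBasis Z, star M (Sum.elim y 0) (Sum.elim x z) *
      M (Sum.elim x z) (Sum.elim y' 0) = star A y x * A x y' := by
    intro x
    rw [Finset.sum_eq_single 0]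
    · rw [hM, if_pos rfl]
      congr 1
      exact congrArg star ((hM x y 0).trans (if_pos rfl))
    · intro z _ hz
      rw [hM, if_neg hz, mul_zero]
    · simp
  rw [Finset.sum_congr rfl fun x _ => h2 x, ← Matrix.mul_apply] at this
  rw [this, Matrix.one_apply, Matrix.one_apply]
  congr 1
  rw [eq_iff_iff]
  constructor
  · intro h
    funext s
    exact congrFun h (Sum.inl s)
  · rintro rfl
    rfl

/-- On zero ancillas `M * (Aᴴ ⊗ 1)` is the identity, so applying `Mᴴ` to such a state is the same as
applying `Aᴴ ⊗ 1`. -/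
theorem Restricts.conjTranspose {M : QOp (S ⊕ Z)} {A : QOp S} (hM : Restricts M A)
    (hu : M ∈ Matrix.unitaryGroup (QBasis (S ⊕ Z)) ℂ) : Restricts Mᴴ Aᴴ := by
  have hA := Matrix.mem_unitaryGroup_iff.1 (hM.sum_conj_mul hu)
  have hu' := Matrix.mem_unitaryGroup_iff'.1 hu
  rw [Matrix.star_eq_conjTranspose] at hA hu'
  have h1 : Restricts (M * onReg (Function.Embedding.inl : S ↪ S ⊕ Z) Aᴴ) (A * Aᴴ) :=
    hM.mul (restricts_onReg_inl _)
  rw [hA] at h1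
  intro x y z
  have h2 : Mᴴ (Sum.elim x z) (Sum.elim y 0) =
      (Mᴴ * (M * onReg (Function.Embedding.inl : S ↪ S ⊕ Z) Aᴴ)) (Sum.elim x z) (Sum.elim y 0) := by
    rw [Matrix.mul_apply, sum_qbasis_sum]
    simp only [h1 _ y, mul_ite, mul_zero, Finset.sum_ite_eq', Finset.mem_univ, if_true,
      Matrix.one_apply, mul_one]
  rw [h2, ← Matrix.mul_assoc, hu', Matrix.one_mul]
  exact restricts_onReg_inl _ x y z

/-- `A` is implemented by a circuit of at most `c` gates with `a` pure ancillas. -/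
def SynthAnc (A : QOp S) (c a : ℕ) : Prop :=
  ∃ gs : List (QGate (S ⊕ Fin a)), gs.length ≤ c ∧ ImplementsWithPureAncillas gs A

theorem synthAnc_iff {A : QOp S} {c a : ℕ} :
    SynthAnc A c a ↔ ∃ M : QOp (S ⊕ Fin a), Synth M c ∧ Restricts M A := by
  constructor
  · rintro ⟨gs, hl, h⟩
    exact ⟨circuitOp gs, ⟨gs, hl, rfl⟩, h⟩
  · rintro ⟨_, ⟨gs, hl, rfl⟩, h⟩
    exact ⟨gs, hl, h⟩

theorem Synth.anc {A : QOp S} {c : ℕ} (hA : Synth A c) (a : ℕ) : SynthAnc A c a :=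
  synthAnc_iff.2 ⟨_, hA.onReg Function.Embedding.inl, restricts_onReg_inl A⟩

/-- Ancillas outside the range of `e` are left untouched, so a circuit may be granted more ancillas
than it uses. -/
theorem SynthAnc.relabel {A : QOp S} {c a : ℕ} {M : QOp (S ⊕ Z)} (hM : Synth M c)
    (hA : Restricts M A) (e : Z ↪ Fin a) : SynthAnc A c a := by
  refine synthAnc_iff.2 ⟨_, hM.onReg ((Function.Embedding.refl S).sumMap e), fun x y z => ?_⟩
  have hy : (Sum.elim y (0 : QBasis (Fin a))) ∘ (Function.Embedding.refl S).sumMap e =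
      Sum.elim y 0 := by
    funext s
    cases s <;> rfl
  have hx : (Sum.elim x z) ∘ (Function.Embedding.refl S).sumMap e = Sum.elim x (z ∘ e) := by
    funext s
    cases s <;> rfl
  have key : z = 0 ↔ AgreeOff ((Function.Embedding.refl S).sumMap e) (Sum.elim x z)
      (Sum.elim y (0 : QBasis (Fin a))) ∧ z ∘ e = 0 := by
    constructor
    · rintro rfl
      refine ⟨?_, rfl⟩
      rintro (s | s) hs
      · exact absurd ⟨Sum.inl s, rfl⟩ hs
      · rfl
    · rintro ⟨h, h'⟩
      funext s
      by_cases hs : s ∈ Set.range e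
      · obtain ⟨b, rfl⟩ := hs
        exact congrFun h' b
      · refine h (Sum.inr s) ?_
        rintro ⟨b | b, hb⟩
        · cases hb
        · exact hs ⟨b, Sum.inr.inj hb⟩
  by_cases h : AgreeOff ((Function.Embedding.refl S).sumMap e) (Sum.elim x z)
      (Sum.elim y (0 : QBasis (Fin a)))
  · rw [_root_.onReg, multiplex_of_agree h, hy, hx, hA]
    simp only [key, h, true_and]
  · rw [_root_.onReg, multiplex_of_not_agree h, if_neg (fun h' => h (key.1 h').1)]

namespace SynthAnc

theorem mono {A : QOp S} {c c' a a' : ℕ} (hA : SynthAnc A c a) (hc : c ≤ c') (ha : a ≤ a') :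
    SynthAnc A c' a' := by
  obtain ⟨M, hM, h⟩ := synthAnc_iff.1 hA
  exact relabel (hM.mono hc) h (Fin.castLEEmb ha)

theorem mul {A B : QOp S} {c c' a : ℕ} (hA : SynthAnc A c a) (hB : SynthAnc B c' a) :
    SynthAnc (A * B) (c + c') a := by
  obtain ⟨M, hM, h⟩ := synthAnc_iff.1 hA
  obtain ⟨N, hN, h'⟩ := synthAnc_iff.1 hB
  exact synthAnc_iff.2 ⟨_, hM.mul hN, h.mul h'⟩

theorem onReg {A : QOp S'} {c a : ℕ} (hA : SynthAnc A c a) (f : S' ↪ S) :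
    SynthAnc (onReg f A) c a := by
  obtain ⟨M, hM, h⟩ := synthAnc_iff.1 hA
  exact synthAnc_iff.2 ⟨_, hM.onReg (f.sumMap (Function.Embedding.refl _)),
    restricts_multiplex fun _ => h⟩

theorem conjTranspose {A : QOp S} {c a : ℕ} (hA : SynthAnc A c a) : SynthAnc Aᴴ c a := by
  obtain ⟨M, hM, h⟩ := synthAnc_iff.1 hA
  exact synthAnc_iff.2 ⟨_, hM.conjTranspose, h.conjTranspose hM.mem_unitaryGroup⟩

theorem mem_unitaryGroup {A : QOp S} {c a : ℕ} (hA : SynthAnc A c a) :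
    A ∈ Matrix.unitaryGroup (QBasis S) ℂ := by
  obtain ⟨M, hM, h⟩ := synthAnc_iff.1 hA
  exact h.sum_conj_mul hM.mem_unitaryGroup

theorem control {A : QOp S'} {c a : ℕ} (hA : SynthAnc A c a) {f : S' ↪ S} {z : S}
    (hz : z ∉ Set.range f) :
    SynthAnc (multiplex f (fun y => if y z = 1 then A else 1)) (60 * c) a := by
  obtain ⟨M, hM, h⟩ := synthAnc_iff.1 hA
  refine synthAnc_iff.2 ⟨_, hM.control (f := f.sumMap (Function.Embedding.refl _))
    (z := Sum.inl z) ?_, restricts_multiplex fun y => ?_⟩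
  · rintro ⟨b | b, hb⟩
    · exact hz ⟨b, Sum.inl.inj hb⟩
    · cases hb
  · change Restricts (if y z = 1 then M else 1) (if y z = 1 then A else 1)
    by_cases hy : y z = 1
    · rw [if_pos hy, if_pos hy]
      exact h
    · rw [if_neg hy, if_neg hy]
      have := restricts_onReg_inl (Z := Fin a) (1 : QOp S')
      rwa [onReg_one] at this

/-- Some qubits may be turned into ancillas. -/
theorem of_restricts {b : ℕ} {A : QOp S} {M : QOp (S ⊕ Fin b)} {c a : ℕ} (hM : SynthAnc M c a)
    (h : Restricts M A) : SynthAnc A c (b + a) := by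
  obtain ⟨N, hN, h'⟩ := synthAnc_iff.1 hM
  refine relabel (hN.onReg (Equiv.sumAssoc S (Fin b) (Fin a)).toEmbedding) (fun x y z => ?_)
    finSumFinEquiv.toEmbedding
  have hag : AgreeOff (Equiv.sumAssoc S (Fin b) (Fin a)).toEmbedding (Sum.elim x z)
      (Sum.elim y 0) := fun s hs => absurd ⟨(Equiv.sumAssoc S (Fin b) (Fin a)).symm s, by simp⟩ hs
  have hy : (Sum.elim y (0 : QBasis (Fin b ⊕ Fin a))) ∘
      (Equiv.sumAssoc S (Fin b) (Fin a)).toEmbedding = Sum.elim (Sum.elim y 0) 0 := by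
    funext s
    rcases s with (s | s) | s <;> rfl
  have hx : (Sum.elim x z) ∘ (Equiv.sumAssoc S (Fin b) (Fin a)).toEmbedding =
      Sum.elim (Sum.elim x (z ∘ Sum.inl)) (z ∘ Sum.inr) := by
    funext s
    rcases s with (s | s) | s <;> rfl
  rw [_root_.onReg, multiplex_of_agree hag, hy, hx, h', h]
  have key : z = 0 ↔ z ∘ Sum.inr = 0 ∧ z ∘ Sum.inl = 0 := by
    constructor
    · rintro rfl
      exact ⟨rfl, rfl⟩
    · rintro ⟨h1, h2⟩
      funext s
      rcases s with s | s
      · exact congrFun h2 s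
      · exact congrFun h1 s
  simp only [key, ite_and]

end SynthAnc

end Ancillas

/-! ## Select operators -/

section Select

/-- The ancilla added to a set of qubits. -/
abbrev newQubit {S : Type} : S ⊕ Fin 1 := Sum.inr 0

variable {S S' : Type} [Fintype S] [DecidableEq S] [Fintype S'] [DecidableEq S']

theorem agreeOff_trans_inl {f : S' ↪ S} {x y : QBasis S} {z z' : QBasis (Fin 1)} :
    AgreeOff (f.trans (Function.Embedding.inl : S ↪ S ⊕ Fin 1)) (Sum.elim x z) (Sum.elim y z') ↔
      AgreeOff f x y ∧ z = z' := by
  rw [agreeOff_trans_iff, agreeOff_inl, and_comm]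
  rfl

/-- A select operator may be controlled by a predicate which is computed into an ancilla. -/
theorem SynthAnc.multiplex_of_predicate {f : S' ↪ S} {p : QBasis S → Fin 2} (hp : IndepOf f p)
    {G : QBasis (S ⊕ Fin 1) → QOp S'} {c t a : ℕ}
    (hG : SynthAnc (multiplex (f.trans Function.Embedding.inl) G) c a)
    (ht : SynthAnc (mux (newQubit : S ⊕ Fin 1)
      (fun y => if p (y ∘ Sum.inl) = 1 then pauliX else 1)) t a) :
    SynthAnc (multiplex f (fun y => G (Sum.elim y (fun _ => p y)))) (c + 2 * t) (1 + a) := by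
  -- Compute, use, uncompute. The second computation erases the ancilla because `p` ignores the
  -- register `f` on which `G` acts.
  refine SynthAnc.of_restricts ((ht.mul (hG.mul ht)).mono (by omega) le_rfl) ?_
  have hq : IndepOf (qubitReg (newQubit : S ⊕ Fin 1)) fun y => p (y ∘ Sum.inl) := by
    intro x y h
    exact congrArg p (funext fun s => agreeOff_qubitReg.1 h _ (by simp))
  intro x y z
  have hi := flip_involutive newQubit hq
  rw [mux_flip newQubit (fun y => p (y ∘ Sum.inl)),
    basisMap_mul_apply hi.leftInverse hi.rightInverse, mul_basisMap_apply]
  have e : ∀ (x : QBasis S) (z : QBasis (Fin 1)),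
      Function.update (Sum.elim x z) newQubit (Sum.elim x z newQubit + p (Sum.elim x z ∘ Sum.inl))
        = Sum.elim x (fun i => z i + p x) := by
    intro x z
    funext s
    rcases s with s | s
    · rw [Function.update_of_ne (by simp)]
      rfl
    · rw [Subsingleton.elim s 0, Function.update_self]
      rfl
  simp only [e, Pi.zero_apply, zero_add]
  by_cases h : AgreeOff f x y
  · have key : ((fun i => z i + p x) = fun _ => p y) ↔ z = 0 := by
      rw [hp x y h]
      constructor
      · intro h'
        funext i
        simpa using congrFun h' i
      · rintro rfl
        simp
    by_cases hz : z = 0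
    · rw [multiplex_of_agree (agreeOff_trans_inl.2 ⟨h, key.2 hz⟩), if_pos hz,
        multiplex_of_agree h]
      rfl
    · rw [multiplex_of_not_agree (fun h' => hz (key.1 (agreeOff_trans_inl.1 h').2)), if_neg hz]
  · rw [multiplex_of_not_agree (fun h' => h (agreeOff_trans_inl.1 h').1),
      multiplex_of_not_agree h, ite_self]

theorem ite_pauliX_mem (p : Prop) [Decidable p] :
    (if p then pauliX else 1) ∈ Matrix.unitaryGroup (Fin 2) ℂ := by
  split_ifs
  · exact pauliX_mem
  · exact one_mem _

theorem synthAnc_toffoli {t s s' : S} (hs : s ≠ t) (hs' : s' ≠ t) (b b' : Fin 2) (a : ℕ) :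
    SynthAnc (mux t (fun y => if y s = b ∧ y s' = b' then pauliX else 1)) 60 a := by
  refine ((synth_mux (K := {s, s'}) (by simp [hs.symm, hs'.symm]) (fun x y h => ?_)
    fun y => ite_pauliX_mem _).mono ?_).anc a
  · rw [h s (by simp), h s' (by simp)]
  · calc 15 * 2 ^ ({s, s'} : Finset S).card ≤ 15 * 2 ^ 2 :=
          Nat.mul_le_mul_left _ (Nat.pow_le_pow_right (by norm_num) Finset.card_le_two)
      _ = 60 := rfl

theorem DependsOnBits.forall_eq (K : Finset S) (p : QBasis S) :
    DependsOnBits K (fun y : QBasis S => ∀ s ∈ K, y s = p s) := by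
  intro x y h
  refine propext (forall₂_congr fun s hs => ?_)
  rw [h s hs]

/-- The multi-controlled `X` with `2 ^ h` controls, computed by halving the set of controls. -/
theorem synthAnc_multiControlledX (h : ℕ) :
    ∀ (S : Type) [Fintype S] [DecidableEq S] (t : S) (K : Finset S) (p : QBasis S),
      t ∉ K → K.card ≤ 2 ^ h →
      SynthAnc (mux t (fun y => if ∀ s ∈ K, y s = p s then pauliX else 1))
        (60 * 4 ^ h - 20) (2 * h) := by
  induction h with
  | zero =>
    intro S _ _ t K p ht hK
    refine ((synth_mux ht ?_ fun y => ite_pauliX_mem _).mono ?_).anc _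
    · intro x y h
      have := DependsOnBits.forall_eq K p x y h
      simp only [this]
    · calc 15 * 2 ^ K.card ≤ 15 * 2 ^ 1 :=
            Nat.mul_le_mul_left _ (Nat.pow_le_pow_right (by norm_num) (by simpa using hK))
        _ ≤ _ := by norm_num
  | succ h ih =>
    intro S _ _ t K p ht hK
    -- Each half of the controls is computed into its own ancilla, and a Toffoli gate combines the
    -- two.
    obtain ⟨K₁, hK₁, hc⟩ := Finset.exists_subset_card_eq (s := K) (n := min K.card (2 ^ h))
      (min_le_left _ _)
    have hc₁ : K₁.card ≤ 2 ^ h := by rw [hc]; exact min_le_right _ _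
    have hc₂ : (K \ K₁).card ≤ 2 ^ h := by
      rw [Finset.card_sdiff_of_subset hK₁, hc]
      rw [pow_succ] at hK
      omega
    have ht₁ : t ∉ K₁ := fun h' => ht (hK₁ h')
    have ht₂ : t ∉ K \ K₁ := fun h' => ht (Finset.mem_sdiff.1 h').1
    let e₁ : S ↪ S ⊕ Fin 1 := Function.Embedding.inl
    let e₂ : S ⊕ Fin 1 ↪ (S ⊕ Fin 1) ⊕ Fin 1 := Function.Embedding.inl
    have c₁ := ih (S ⊕ Fin 1) newQubit (K₁.map e₁) (Sum.elim p 0) (by simp [e₁])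
      (by rwa [Finset.card_map])
    have c₂ := ih ((S ⊕ Fin 1) ⊕ Fin 1) newQubit ((K \ K₁).map (e₁.trans e₂))
      (Sum.elim (Sum.elim p 0) 0) (by simp [e₁, e₂]) (by rwa [Finset.card_map])
    have c₃ := synthAnc_toffoli (t := e₂ (e₁ t)) (s := e₂ newQubit) (s' := newQubit)
      (by simp [e₁, e₂]) (by simp [e₁, e₂]) 1 1 (2 * h)
    have i₂ : IndepOf (qubitReg (e₁ t)) fun y : QBasis (S ⊕ Fin 1) =>
        if ∀ s ∈ K \ K₁, y (e₁ s) = p s then (1 : Fin 2) else 0 := by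
      intro x y hxy
      have := DependsOnBits.forall_eq (K \ K₁) p (x ∘ e₁) (y ∘ e₁) fun s hs =>
        agreeOff_qubitReg.1 hxy _ fun h' => ht₂ (e₁.injective h' ▸ hs)
      simp only [Function.comp_apply] at this
      simp only [this]
    have i₁ : IndepOf (qubitReg t) fun y : QBasis S =>
        if ∀ s ∈ K₁, y s = p s then (1 : Fin 2) else 0 := by
      intro x y hxy
      have := DependsOnBits.forall_eq K₁ p x y fun s hs =>
        agreeOff_qubitReg.1 hxy _ fun h' => ht₁ (h' ▸ hs)
      simp only [this]
    have one_iff : ∀ (q : Prop) [Decidable q], (if q then (1 : Fin 2) else 0) = 1 ↔ q := by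
      intro q _
      split_ifs with hq <;> simp [hq]
    have k₂ := SynthAnc.multiplex_of_predicate (t := 60 * 4 ^ h - 20) i₂ c₃ (by
      convert c₂ using 5
      rw [one_iff, Finset.forall_mem_map]
      rfl)
    have k₁ := SynthAnc.multiplex_of_predicate (f := qubitReg t) (t := 60 * 4 ^ h - 20) i₁ k₂
      ((by
        convert c₁ using 5
        rw [one_iff]
        simp [e₁] : SynthAnc _ (60 * 4 ^ h - 20) (2 * h)).mono le_rfl (by omega))
    -- The recursion `c ↦ 4 c + 60`, with fixed point `-20`: both halves are computed and uncomputed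
    -- once.
    have hc₃ : 60 + 2 * (60 * 4 ^ h - 20) + 2 * (60 * 4 ^ h - 20) ≤ 60 * 4 ^ (h + 1) - 20 := by
      rw [pow_succ]
      have : 1 ≤ 4 ^ h := Nat.one_le_pow _ _ (by norm_num)
      omega
    convert k₁.mono hc₃ (show _ ≤ 2 * (h + 1) by omega) using 1
    rw [mux]
    congr 1
    funext y
    congr 1
    refine if_congr ?_ rfl rfl
    have hs : (∀ s ∈ K, y s = p s) ↔ (∀ s ∈ K₁, y s = p s) ∧ ∀ s ∈ K \ K₁, y s = p s := by
      constructor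
      · intro h'
        exact ⟨fun s hs => h' s (hK₁ hs), fun s hs => h' s (Finset.mem_sdiff.1 hs).1⟩
      · rintro ⟨h₁, h₂⟩ s hs
        by_cases hs₁ : s ∈ K₁
        · exact h₁ s hs₁
        · exact h₂ s (Finset.mem_sdiff.2 ⟨hs, hs₁⟩)
    rw [hs]
    refine and_congr (one_iff _).symm (one_iff (∀ s ∈ K \ K₁, y s = p s)).symm

end Select

/-! ### Selection over a control register by unary iteration. -/

section Select

variable {S' : Type} [Fintype S'] [DecidableEq S']

theorem sum_qbasis_succ {L : ℕ} {M : Type} [AddCommMonoid M] (g : QBasis (Fin (L + 1)) → M) :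
    ∑ b, g b = ∑ b : QBasis (Fin L), g (Fin.cons 0 b) + ∑ b : QBasis (Fin L), g (Fin.cons 1 b) := by
  rw [← Fin.sum_univ_two (fun i => ∑ b : QBasis (Fin L), g (Fin.cons i b)),
    ← Fintype.sum_prod_type' (f := fun (i : Fin 2) (b : QBasis (Fin L)) => g (Fin.cons i b))]
  exact (Fintype.sum_equiv (Fin.consEquiv (fun _ => Fin 2)) _ _ (fun _ => rfl)).symm

theorem ite_eq_one_iff (q : Prop) [Decidable q] : (if q then (1 : Fin 2) else 0) = 1 ↔ q := by
  split_ifs with hq <;> simp [hq]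

/-- Unary iteration over `L` control bits, with one ancilla per bit. -/
theorem synthAnc_controlledSelect (a : ℕ) (L : ℕ) :
    ∀ (S : Type) [Fintype S] [DecidableEq S] (f : S' ↪ S) (c : Fin L ↪ S) (z : S)
      (A : QBasis (Fin L) → QOp S') (cost : QBasis (Fin L) → ℕ),
      z ∉ Set.range f → (∀ i, c i ∉ Set.range f) → (∀ i, c i ≠ z) →
      (∀ b, SynthAnc (A b) (cost b) a) →
      SynthAnc (multiplex f (fun y => if y z = 1 then A (y ∘ c) else 1))
        (60 * ∑ b, cost b + (240 * 2 ^ L - 240)) (L + a) := by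
  induction L with
  | zero =>
    intro S _ _ f c z A cost hz _ _ hA
    have h := (hA 0).control hz
    rw [Fintype.sum_subsingleton _ (0 : QBasis (Fin 0))]
    convert h.mono (show _ ≤ 60 * cost 0 + (240 * 2 ^ 0 - 240) by omega)
      (show a ≤ 0 + a by omega) using 6
  | succ L ih =>
    intro S _ _ f c z A cost hz hcf hcz hA
    -- For each value `b` of the first control bit, one Toffoli gate puts "active and bit equal to
    -- `b`" into a fresh ancilla, which then serves as the control for the remaining bits.
    have half : ∀ b : Fin 2, SynthAnc
        (multiplex f (fun y => if y z = 1 ∧ y (c 0) = b then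
          A (Fin.cons b (fun i => y (c i.succ))) else 1))
        (60 * ∑ b' : QBasis (Fin L), cost (Fin.cons b b') + (240 * 2 ^ L - 240) + 2 * 60) (1 + (L + a)) := by
      intro b
      have k := ih (S ⊕ Fin 1) (f.trans Function.Embedding.inl)
        (((Fin.succEmb L).trans c).trans Function.Embedding.inl) newQubit
        (fun b' => A (Fin.cons b b')) (fun b' => cost (Fin.cons b b'))
        (by rintro ⟨i, hi⟩; cases hi)
        (fun i => by rintro ⟨j, hj⟩; exact hcf i.succ ⟨j, Sum.inl.inj hj⟩)
        (fun i => by simp) (fun b' => hA _)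
      have hp : IndepOf f (fun y : QBasis S => if y z = 1 ∧ y (c 0) = b then (1 : Fin 2) else 0) := by
        intro x y h
        simp only [h z hz, h _ (hcf 0)]
      have k' := SynthAnc.multiplex_of_predicate (t := 60) hp k (by
        convert synthAnc_toffoli (t := (newQubit : S ⊕ Fin 1)) (s := Sum.inl z)
          (s' := Sum.inl (c 0)) (by simp) (by simp) 1 b _ using 5
        rw [ite_eq_one_iff]
        rfl)
      convert k' using 4
      · exact (ite_eq_one_iff _).symm
      · rfl
    have key := (half 0).mul (half 1)
    rw [multiplex_mul] at key
    -- The overhead doubles and gains four Toffoli gates, `c ↦ 2 c + 240`.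
    · have hc : 60 * ∑ b' : QBasis (Fin L), cost (Fin.cons 0 b') + (240 * 2 ^ L - 240) + 2 * 60 +
          (60 * ∑ b' : QBasis (Fin L), cost (Fin.cons 1 b') + (240 * 2 ^ L - 240) + 2 * 60) ≤
          60 * ∑ b, cost b + (240 * 2 ^ (L + 1) - 240) := by
        rw [sum_qbasis_succ, pow_succ]
        have : 1 ≤ 2 ^ L := Nat.one_le_two_pow
        omega
      · convert key.mono hc (show 1 + (L + a) ≤ L + 1 + a by omega) using 2
        funext y
        have hy : y ∘ c = Fin.cons (y (c 0)) fun i => y (c i.succ) := by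
          funext i
          refine Fin.cases ?_ (fun i => ?_) i <;> rfl
        by_cases h : y z = 1
        · rcases fin_two_cases (y (c 0)) with h' | h'
          · simp [h, h', hy]
          · simp [h, h', hy]
        · simp [h]
    · intro x y h
      simp only [h z hz, h _ (hcf _)]

/-- The select operator over `T + L` control bits: unary iteration over `L` bits for each pattern
of the other `T` bits. -/
theorem synthAnc_select {S : Type} [Fintype S] [DecidableEq S] (a T L h : ℕ) (hT : T ≤ 2 ^ h)
    (f : S' ↪ S) (c : Fin T ↪ S) (c' : Fin L ↪ S)
    (A : QBasis (Fin T) → QBasis (Fin L) → QOp S') (cost : QBasis (Fin T) → QBasis (Fin L) → ℕ)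
    (hcf : ∀ i, c i ∉ Set.range f) (hcf' : ∀ i, c' i ∉ Set.range f)
    (hA : ∀ t b, SynthAnc (A t b) (cost t b) a) :
    SynthAnc (multiplex f (fun y => A (y ∘ c) (y ∘ c')))
      (60 * ∑ t, ∑ b, cost t b + 2 ^ T * (240 * 2 ^ L + 120 * 4 ^ h)) (1 + (L + a + 2 * h)) := by
  have one : ∀ t : QBasis (Fin T), SynthAnc
      (multiplex f (fun y => if y ∘ c = t then A t (y ∘ c') else 1))
      (60 * ∑ b, cost t b + (240 * 2 ^ L + 120 * 4 ^ h)) (1 + (L + a + 2 * h)) := by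
    intro t
    have k := synthAnc_controlledSelect a L (S ⊕ Fin 1) (f.trans Function.Embedding.inl)
      (c'.trans Function.Embedding.inl) newQubit (A t) (cost t)
      (by rintro ⟨i, hi⟩; cases hi)
      (fun i => by rintro ⟨j, hj⟩; exact hcf' i ⟨j, Sum.inl.inj hj⟩)
      (fun i => by simp) (hA t)
    have hp : IndepOf f (fun y : QBasis S => if y ∘ c = t then (1 : Fin 2) else 0) := by
      intro x y hxy
      have : x ∘ c = y ∘ c := funext fun i => hxy _ (hcf i)
      simp only [this]
    have m := synthAnc_multiControlledX h (S ⊕ Fin 1) newQubit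
      (Finset.univ.map (c.trans Function.Embedding.inl))
      (Function.extend (c.trans Function.Embedding.inl) t 0) (by simp) (by simpa using hT)
    have k' := SynthAnc.multiplex_of_predicate (t := 60 * 4 ^ h) hp
      (k.mono le_rfl (show _ ≤ L + a + 2 * h by omega)) ((by
        convert m using 5
        rw [ite_eq_one_iff, Finset.forall_mem_map]
        simp only [(c.trans Function.Embedding.inl).injective.extend_apply, Finset.mem_univ,
          true_implies, funext_iff]
        rfl : SynthAnc _ _ _).mono (by omega) (by omega))
    convert k'.mono (show _ ≤ 60 * ∑ b, cost t b + (240 * 2 ^ L + 120 * 4 ^ h) by omega)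
      le_rfl using 4
    · exact (ite_eq_one_iff _).symm
    · rfl
  -- Operators for different patterns are active on disjoint control states, so their product
  -- selects the union; the ancillas are clean and reused from pattern to pattern.
  have all : ∀ s : Finset (QBasis (Fin T)), SynthAnc
      (multiplex f (fun y => if y ∘ c ∈ s then A (y ∘ c) (y ∘ c') else 1))
      (∑ t ∈ s, (60 * ∑ b, cost t b + (240 * 2 ^ L + 120 * 4 ^ h))) (1 + (L + a + 2 * h)) := by
    intro s
    induction s using Finset.induction_on with
    | empty =>
      simp only [Finset.notMem_empty, if_false]
      rw [multiplex_one]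
      exact (Synth.one.anc _).mono (by simp) le_rfl
    | insert t s ht ih =>
      have key := (one t).mul ih
      rw [multiplex_mul] at key
      · rw [Finset.sum_insert ht]
        convert key using 2
        funext y
        by_cases h : y ∘ c = t
        · simp [h, ht]
        · simp [h]
      · intro x y hxy
        have : x ∘ c = y ∘ c := funext fun i => hxy _ (hcf i)
        have h' : x ∘ c' = y ∘ c' := funext fun i => hxy _ (hcf' i)
        simp only [this, h']
  have := all Finset.univ
  simp only [Finset.mem_univ, if_true] at this
  refine this.mono (le_of_eq ?_) le_rfl
  rw [Finset.sum_add_distrib, Finset.mul_sum]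
  simp

end Select

/-! ## Tensor products -/

section Tensor

variable {d : ℕ} {ι : Fin d → Type} [∀ y, Fintype (ι y)] [∀ y, DecidableEq (ι y)]

/-- The tensor product of operators on the parts of a set of qubits. -/
def tensorOp (B : (y : Fin d) → QOp (ι y)) : QOp ((y : Fin d) × ι y) :=
  fun x x' => ∏ y, B y (fun w => x ⟨y, w⟩) (fun w => x' ⟨y, w⟩)

/-- The modes are treated one after another with the same ancillas, so gate counts add while `a`
does not grow. The induction carries the operator that acts on a subset of the modes and is the
identity on the others. -/
theorem synthAnc_tensorOp {B : (y : Fin d) → QOp (ι y)} {cost : Fin d → ℕ} {a : ℕ}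
    (hB : ∀ y, SynthAnc (B y) (cost y) a) : SynthAnc (tensorOp B) (∑ y, cost y) a := by
  classical
  have all : ∀ s : Finset (Fin d), ∃ M : QOp ((y : Fin d) × ι y),
      (∀ x x', M x x' = if ∀ y, y ∉ s → ∀ w, x ⟨y, w⟩ = x' ⟨y, w⟩ then
          ∏ y ∈ s, B y (fun w => x ⟨y, w⟩) (fun w => x' ⟨y, w⟩) else 0) ∧
        SynthAnc M (∑ y ∈ s, cost y) a := by
    intro s
    induction s using Finset.induction_on with
    | empty =>
      refine ⟨1, fun x x' => ?_, (Synth.one.anc a).mono (by simp) le_rfl⟩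
      rw [Matrix.one_apply]
      simp only [Finset.notMem_empty, not_false_eq_true, true_implies, Finset.prod_empty]
      refine if_congr ⟨fun h => ?_, fun h => ?_⟩ rfl rfl
      · intro y w
        rw [h]
      · funext ⟨y, w⟩
        exact h y w
    | insert y s hy ih =>
      obtain ⟨M, hM, ih⟩ := ih
      rw [Finset.sum_insert hy, add_comm]
      refine ⟨_, fun x x' => ?_, ih.mul ((hB y).onReg (Function.Embedding.sigmaMk (β := ι) y))⟩
      rw [Matrix.mul_apply, onReg, sum_mul_multiplex]
      have e : ∀ (v : QBasis (ι y)) (y' : Fin d) (w : ι y'), y' ≠ y →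
          Function.extend (Function.Embedding.sigmaMk (β := ι) y) v x' ⟨y', w⟩ = x' ⟨y', w⟩ := by
        intro v y' w h
        refine Function.extend_apply' _ _ _ ?_
        rintro ⟨b, hb⟩
        exact h (congrArg Sigma.fst hb).symm
      have e' : ∀ (v : QBasis (ι y)) (w : ι y),
          Function.extend (Function.Embedding.sigmaMk (β := ι) y) v x' ⟨y, w⟩ = v w := fun v w =>
        (Function.Embedding.sigmaMk (β := ι) y).injective.extend_apply v x' w
      rw [Finset.sum_eq_single (fun w => x ⟨y, w⟩)]
      · have hiff : (∀ y', y' ∉ insert y s → ∀ w, x ⟨y', w⟩ = x' ⟨y', w⟩) ↔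
            ∀ y', y' ∉ s → ∀ w, x ⟨y', w⟩ = Function.extend (Function.Embedding.sigmaMk (β := ι) y)
              (fun w => x ⟨y, w⟩) x' ⟨y', w⟩ := by
          constructor
          · intro h y' hy' w
            by_cases hyy : y' = y
            · subst hyy
              rw [e']
            · rw [e _ _ _ hyy]
              exact h y' (by simp [hyy, hy']) w
          · intro h y' hy' w
            rw [Finset.mem_insert, not_or] at hy'
            rw [h y' hy'.2 w, e _ _ _ hy'.1]
        by_cases h : ∀ y', y' ∉ insert y s → ∀ w, x ⟨y', w⟩ = x' ⟨y', w⟩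
        · rw [if_pos h, hM, if_pos (hiff.1 h), Finset.prod_insert hy, mul_comm]
          congr 1
          refine Finset.prod_congr rfl fun y' hy' => ?_
          congr 1
          funext w
          rw [e _ _ _ (fun h' => hy (h' ▸ hy'))]
        · rw [if_neg h, hM, if_neg (fun h' => h (hiff.2 h')), zero_mul]
      · intro v _ hv
        rw [hM, if_neg, zero_mul]
        intro h
        refine hv (funext fun w => ?_)
        rw [h y hy w, e']
      · simp
  obtain ⟨M, hM, h⟩ := all Finset.univ
  have e : tensorOp B = M := by
    ext x x'
    simp [hM, tensorOp]
  rw [e]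
  exact h

end Tensor

/-! ## State preparation -/

section StatePreparation

/-- The equations are kept multiplied by the norm, so the zero vector needs no exclusion: any
unitary serves there. -/
theorem exists_unitary_first_column (a b : ℂ) :
    ∃ u ∈ Matrix.unitaryGroup (Fin 2) ℂ,
      u 0 0 * (Real.sqrt (‖a‖ ^ 2 + ‖b‖ ^ 2) : ℝ) = a ∧
      u 1 0 * (Real.sqrt (‖a‖ ^ 2 + ‖b‖ ^ 2) : ℝ) = b := by
  set r := Real.sqrt (‖a‖ ^ 2 + ‖b‖ ^ 2) with hr
  by_cases h : r = 0
  · have h0 : ‖a‖ ^ 2 + ‖b‖ ^ 2 = 0 := (Real.sqrt_eq_zero (by positivity)).1 h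
    have ha : ‖a‖ = 0 := by nlinarith [sq_nonneg ‖a‖, sq_nonneg ‖b‖]
    have hb : ‖b‖ = 0 := by nlinarith [sq_nonneg ‖a‖, sq_nonneg ‖b‖]
    exact ⟨1, one_mem _, by simp [h, norm_eq_zero.1 ha], by simp [h, norm_eq_zero.1 hb]⟩
  · have hc : (r : ℂ) ≠ 0 := by exact_mod_cast h
    have hn : (starRingEnd ℂ) a * a + (starRingEnd ℂ) b * b = r * r := by
      rw [Complex.conj_mul', Complex.conj_mul']
      have : ‖a‖ ^ 2 + ‖b‖ ^ 2 = r * r := (Real.mul_self_sqrt (by positivity)).symm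
      exact_mod_cast this
    refine ⟨!![a / r, -(starRingEnd ℂ) b / r; b / r, (starRingEnd ℂ) a / r], ?_, ?_, ?_⟩
    · rw [Matrix.mem_unitaryGroup_iff, Matrix.star_eq_conjTranspose]
      ext i j
      fin_cases i <;> fin_cases j <;>
        simp [Matrix.mul_apply, Fin.sum_univ_two] <;> field_simp <;>
          first
          | linear_combination hn
          | ring
    · simp [hc]
    · simp [hc]

/-- Every unit vector on `k` qubits is prepared by `15 * 2 ^ k` gates. -/
theorem exists_statePreparation (k : ℕ) : ∀ v : QBasis (Fin k) → ℂ, ∑ x, ‖v x‖ ^ 2 = 1 →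
    ∃ V ∈ Matrix.unitaryGroup (QBasis (Fin k)) ℂ, (∀ x, V x 0 = v x) ∧
      ∀ (S : Type) [Fintype S] [DecidableEq S] [Nonempty S] (f : Fin k ↪ S),
        Synth (onReg f V) (15 * 2 ^ k) := by
  induction k with
  | zero =>
    intro v hv
    have hv0 : ‖v 0‖ = 1 := by
      have : ‖v 0‖ ^ 2 = 1 := by
        rw [← hv, Fintype.sum_subsingleton _ (0 : QBasis (Fin 0))]
      exact (pow_eq_one_iff_of_nonneg (norm_nonneg _) two_ne_zero).1 this
    have hstar : v 0 * star (v 0) = 1 := by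
      rw [Complex.star_def, Complex.mul_conj', hv0]
      simp
    refine ⟨v 0 • 1, ?_, fun x => ?_, ?_⟩
    · rw [Matrix.mem_unitaryGroup_iff, star_smul, star_one, smul_mul_smul_comm, hstar, one_mul,
        one_smul]
    · rw [Subsingleton.elim x 0]
      simp
    · intro S _ _ hS f
      obtain ⟨t⟩ := hS
      -- On the empty register the state is a global phase; it is applied as a one-qubit gate on an
      -- arbitrary qubit of `S`.
      have h : onReg f (v 0 • 1) = mux t (fun _ => v 0 • 1) := by
        ext x y
        have h1 : onReg f (v 0 • 1) x y = v 0 * (1 : QOp S) x y := by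
          rw [← onReg_one f]
          by_cases h : AgreeOff f x y
          · simp [onReg, multiplex_of_agree h]
          · simp [onReg, multiplex_of_not_agree h]
        have h2 : mux t (fun _ => v 0 • 1) x y = v 0 * (1 : QOp S) x y := by
          rw [← mux_one t]
          by_cases h : ∀ s, s ≠ t → x s = y s
          · simp [mux_of_agree h]
          · simp [mux_of_not_agree h]
        rw [h1, h2]
      rw [h]
      refine (Synth.single t ?_).mono (by norm_num)
      rw [Matrix.mem_unitaryGroup_iff, star_smul, star_one, smul_mul_smul_comm, hstar, one_mul,
        one_smul]
  | succ k ih =>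
    intro v hv
    -- The norms of the pairs differing in bit `0` are prepared on the other bits; a multiplexed
    -- gate on bit `0` then splits each norm into the two amplitudes.
    obtain ⟨V, hV, hV0, hVs⟩ := ih
      (fun x => (Real.sqrt (‖v (Fin.cons 0 x)‖ ^ 2 + ‖v (Fin.cons 1 x)‖ ^ 2) : ℝ)) (by
        rw [← hv, sum_qbasis_succ, ← Finset.sum_add_distrib]
        refine Finset.sum_congr rfl fun x _ => ?_
        rw [Complex.norm_real, Real.norm_eq_abs, sq_abs, Real.sq_sqrt (by positivity)])
    choose u hu hu0 hu1 using fun x : QBasis (Fin k) =>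
      exists_unitary_first_column (v (Fin.cons 0 x)) (v (Fin.cons 1 x))
    let g : Fin k ↪ Fin (k + 1) := Fin.succEmb k
    have hd : DependsOnBits (Finset.univ.map g) (fun y : QBasis (Fin (k + 1)) => u (y ∘ g)) := by
      intro x y h
      have : x ∘ g = y ∘ g := funext fun i => h _ (by simp)
      simp only [this]
    have h0 : (0 : Fin (k + 1)) ∉ Finset.univ.map g := by simp [g, Fin.succ_ne_zero]
    refine ⟨mux 0 (fun y => u (y ∘ g)) * onReg g V, ?_, fun x => ?_, ?_⟩
    · exact mul_mem (mux_mem_unitaryGroup (hd.indepOf h0) fun y => hu _)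
        (multiplex_mem_unitaryGroup g (IndepOf.const _ _) fun _ => hV)
    · rw [Matrix.mul_apply, onReg, sum_mul_multiplex, Finset.sum_eq_single (x ∘ g)]
      · have hx : ∀ s, s ≠ 0 → x s = Function.extend g (x ∘ g) 0 s := by
          intro s hs
          obtain ⟨i, rfl⟩ := Fin.exists_succ_eq.2 hs
          exact (g.injective.extend_apply (x ∘ g) 0 i).symm
        have h00 : Function.extend g (x ∘ g) (0 : QBasis (Fin (k + 1))) 0 = 0 :=
          Function.extend_apply' _ _ _ (by rintro ⟨i, hi⟩; exact Fin.succ_ne_zero i hi)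
        have hz : (0 : QBasis (Fin (k + 1))) ∘ g = 0 := rfl
        have hxc : x = Fin.cons (x 0) (x ∘ g) := (Fin.cons_self_tail x).symm
        rw [mux_of_agree hx, extend_comp_embedding, h00, hz, hV0]
        rcases fin_two_cases (x 0) with h | h
        · rw [h] at hxc ⊢
          rw [hu0, ← hxc]
        · rw [h] at hxc ⊢
          rw [hu1, ← hxc]
      · intro w _ hw
        rw [mux_of_not_agree, zero_mul]
        intro h
        refine hw (funext fun i => ?_)
        have := h (g i) (Fin.succ_ne_zero i)
        rw [g.injective.extend_apply] at this
        exact this.symm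
      · simp
    · intro S _ _ _ f
      rw [onReg_mul, onReg_mux, onReg_onReg]
      refine ((synth_mux (K := (Finset.univ.map g).map f) ?_ ?_ fun y => hu _).mul
        (hVs S (g.trans f))).mono ?_
      · rw [Finset.mem_map' f]
        exact h0
      · intro x y h
        exact hd _ _ fun s hs => h (f s) (Finset.mem_map_of_mem f hs)
      · simp only [Finset.card_map, Finset.card_univ, Fintype.card_fin, pow_succ]
        omega

end StatePreparation

/-! ## Modular adders -/

section Adder

variable {S : Type} [Fintype S] [DecidableEq S]

theorem basisMap_id : basisMap (fun y : QBasis S => y) = 1 := by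
  ext x y
  simp [basisMap, Matrix.one_apply]

/-- Addition of the bit `q y` to the qubit `t`. -/
def flipMap (t : S) (q : QBasis S → Fin 2) (y : QBasis S) : QBasis S :=
  Function.update y t (y t + q y)

theorem synth_flipMap_bit {s t : S} (h : s ≠ t) : Synth (basisMap (flipMap t fun y => y s)) 1 := by
  have := Synth.cnot h
  rwa [mux_flip t fun y => y s] at this

theorem synth_flipMap_mul {s s' t : S} (h : s ≠ t) (h' : s' ≠ t) :
    Synth (basisMap (flipMap t fun y => y s * y s')) 60 := by
  have := synth_mux (K := {s, s'}) (t := t) (by simp [h.symm, h'.symm])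
    (u := fun y => if y s * y s' = 1 then pauliX else 1)
    (fun x y e => by simp only [e s (by simp), e s' (by simp)]) fun y => ite_pauliX_mem _
  rw [mux_flip t fun y => y s * y s'] at this
  refine this.mono ?_
  calc 15 * 2 ^ ({s, s'} : Finset S).card ≤ 15 * 2 ^ 2 :=
        Nat.mul_le_mul_left _ (Nat.pow_le_pow_right (by norm_num) Finset.card_le_two)
    _ = 60 := rfl

/-- The number stored in a register. -/
def regVal {S : Type} {n : ℕ} (f : Fin n → S) (y : QBasis S) : ℕ :=
  ∑ i, (y (f i) : ℕ) * 2 ^ (i : ℕ)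

theorem regVal_succ {n : ℕ} (f : Fin (n + 1) → S) (y : QBasis S) :
    regVal f y = (y (f 0) : ℕ) + 2 * regVal (fun i => f i.succ) y := by
  rw [regVal, Fin.sum_univ_succ, regVal, Finset.mul_sum]
  simp only [Fin.val_zero, pow_zero, mul_one, Fin.val_succ, pow_succ]
  congr 1
  refine Finset.sum_congr rfl fun i _ => by ring

theorem regVal_congr {n : ℕ} {f : Fin n → S} {x y : QBasis S} (h : ∀ i, x (f i) = y (f i)) :
    regVal f x = regVal f y :=
  Finset.sum_congr rfl fun i _ => by rw [h]

/-- The ripple-carry adder of Cuccaro, Draper, Kutin and Moulton, without carry-out. -/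
theorem exists_rippleCarryAdder (n : ℕ) :
    ∀ (a b : Fin n → S) (c : S), Function.Injective a → Function.Injective b →
      (∀ i j, a i ≠ b j) → (∀ i, a i ≠ c) → (∀ i, b i ≠ c) →
      ∃ F : QBasis S → QBasis S, Synth (basisMap F) (200 * n) ∧
        ∀ y, (∀ s, (∀ i, b i ≠ s) → F y s = y s) ∧
          regVal b (F y) ≡ regVal b y + regVal a y + y c [MOD 2 ^ n] := by
  induction n with
  | zero =>
    intro a b c _ _ _ _ _
    refine ⟨id, ?_, fun y => ⟨fun _ _ => rfl, ?_⟩⟩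
    · exact (basisMap_id (S := S)).symm ▸ Synth.one.mono (Nat.zero_le _)
    · simp [Nat.modEq_one]
  | succ n ih =>
    intro a b c ha hb hab hac hbc
    obtain ⟨F, hF, hFy⟩ := ih (fun i => a i.succ) (fun i => b i.succ) (a 0)
      (fun i j h => Fin.succ_injective _ (ha h)) (fun i j h => Fin.succ_injective _ (hb h))
      (fun i j => hab _ _) (fun i h => Fin.succ_ne_zero i (ha h)) (fun i h => hab _ _ h.symm)
    -- Read from right to left: three flips leave the carry, a majority, in `a 0`, which is the
    -- carry-in of the adder `F` on the higher digits; three more restore `a 0` and `c` and form the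
    -- sum digit.
    refine ⟨flipMap (b 0) (fun y => y c) ∘ flipMap c (fun y => y (a 0)) ∘
      flipMap (a 0) (fun y => y c * y (b 0)) ∘ F ∘ flipMap (a 0) (fun y => y c * y (b 0)) ∘
      flipMap c (fun y => y (a 0)) ∘ flipMap (b 0) (fun y => y (a 0)), ?_, fun y => ?_⟩
    · simp only [← basisMap_mul]
      refine ((synth_flipMap_bit (hbc 0).symm).mul <| (synth_flipMap_bit (hac 0)).mul <|
        (synth_flipMap_mul (hac 0).symm (hab 0 0).symm).mul <| hF.mul <|
        (synth_flipMap_mul (hac 0).symm (hab 0 0).symm).mul <|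
        (synth_flipMap_bit (hac 0)).mul (synth_flipMap_bit (hab 0 0))).mono (by omega)
    · obtain ⟨y₁, hy₁⟩ : ∃ y₁, y₁ = flipMap (a 0) (fun y => y c * y (b 0))
        (flipMap c (fun y => y (a 0)) (flipMap (b 0) (fun y => y (a 0)) y)) := ⟨_, rfl⟩
      have hb₁ : y₁ (b 0) = y (b 0) + y (a 0) := by
        simp [hy₁, flipMap, Function.update_apply, (hab 0 0).symm, hbc 0]
      have hc₁ : y₁ c = y c + y (a 0) := by
        simp [hy₁, flipMap, Function.update_apply, (hac 0).symm, (hbc 0).symm, hab 0 0]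
      have ha₁ : y₁ (a 0) = y (a 0) + (y c + y (a 0)) * (y (b 0) + y (a 0)) := by
        simp [hy₁, flipMap, (hac 0), (hbc 0).symm, hab 0 0,
          hbc 0]
      have ho₁ : ∀ s, s ≠ a 0 → s ≠ b 0 → s ≠ c → y₁ s = y s := by
        intro s h1 h2 h3
        simp [hy₁, flipMap, Function.update_apply, h1, h2, h3]
      obtain ⟨hF1, hF2⟩ := hFy y₁
      set y₂ := F y₁ with hy₂
      have hb₂ : y₂ (b 0) = y (b 0) + y (a 0) := by
        rw [hF1 _ fun i h => Fin.succ_ne_zero i (hb h), hb₁]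
      have hc₂ : y₂ c = y c + y (a 0) := by rw [hF1 _ fun i h => hbc _ h, hc₁]
      have ha₂ : y₂ (a 0) = y (a 0) + (y c + y (a 0)) * (y (b 0) + y (a 0)) := by
        rw [hF1 _ fun i h => hab _ _ h.symm, ha₁]
      -- In characteristic two `p + (r + p) * (q + p)` is the majority of the three bits; the last
      -- identity is the full adder over the natural numbers.
      have bits : ∀ p q r : Fin 2, p + (r + p) * (q + p) + (r + p) * (q + p) = p ∧
          r + p + p = r ∧ ((q + p + r : Fin 2) : ℕ) + 2 * ((p + (r + p) * (q + p) : Fin 2) : ℕ) =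
            (q : ℕ) + p + r := by decide
      obtain ⟨e₁, e₂, e₃⟩ := bits (y (a 0)) (y (b 0)) (y c)
      set y₃ := flipMap (b 0) (fun y => y c) (flipMap c (fun y => y (a 0))
        (flipMap (a 0) (fun y => y c * y (b 0)) y₂)) with hy₃
      have ha₃ : y₃ (a 0) = y (a 0) := by
        simp [hy₃, flipMap, Function.update_apply, hac 0, hab 0 0, ha₂, hb₂, hc₂, e₁]
      have hc₃ : y₃ c = y c := by
        simp [hy₃, flipMap, Function.update_apply, (hac 0).symm, (hbc 0).symm, ha₂, hb₂, hc₂, e₁,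
          e₂]
      have hb₃ : y₃ (b 0) = y (b 0) + y (a 0) + y c := by
        simp [hy₃, flipMap, (hac 0).symm, hbc 0, (hab 0 0).symm, ha₂, hb₂,
          hc₂, e₁, e₂]
      have ho₃ : ∀ s, s ≠ a 0 → s ≠ b 0 → s ≠ c → y₃ s = y₂ s := by
        intro s h1 h2 h3
        simp [hy₃, flipMap, Function.update_apply, h1, h2, h3]
      have hres : (flipMap (b 0) (fun y => y c) ∘ flipMap c (fun y => y (a 0)) ∘
          flipMap (a 0) (fun y => y c * y (b 0)) ∘ F ∘ flipMap (a 0) (fun y => y c * y (b 0)) ∘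
          flipMap c (fun y => y (a 0)) ∘ flipMap (b 0) (fun y => y (a 0))) y = y₃ := by
        simp only [Function.comp_apply, hy₃, hy₂, hy₁]
      rw [hres]
      constructor
      · intro s hs
        by_cases h1 : s = a 0
        · rw [h1, ha₃]
        by_cases h3 : s = c
        · rw [h3, hc₃]
        rw [ho₃ s h1 (hs 0).symm h3, hF1 s fun i => hs _, ho₁ s h1 (hs 0).symm h3]
      · have t₁ : regVal (fun i => b i.succ) y₃ = regVal (fun i => b i.succ) y₂ :=
          regVal_congr fun i => ho₃ _ (hab _ _).symm (fun h => Fin.succ_ne_zero i (hb h)) (hbc _)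
        have t₂ : regVal (fun i => b i.succ) y₁ = regVal (fun i => b i.succ) y :=
          regVal_congr fun i => ho₁ _ (hab _ _).symm (fun h => Fin.succ_ne_zero i (hb h)) (hbc _)
        have t₃ : regVal (fun i => a i.succ) y₁ = regVal (fun i => a i.succ) y :=
          regVal_congr fun i => ho₁ _ (fun h => Fin.succ_ne_zero i (ha h)) (hab _ _) (hac _)
        rw [t₂, t₃, ha₁] at hF2
        rw [regVal_succ b, regVal_succ b, regVal_succ a, t₁, hb₃]
        have h2 := (Nat.ModEq.mul_left' 2 hF2).add_left
          ((y (b 0) + y (a 0) + y c : Fin 2) : ℕ)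
        rw [pow_succ, mul_comm (2 ^ n) 2]
        have h3 : ((y (b 0) + y (a 0) + y c : Fin 2) : ℕ) +
            2 * (regVal (fun i => b i.succ) y + regVal (fun i => a i.succ) y +
              ((y (a 0) + (y c + y (a 0)) * (y (b 0) + y (a 0)) : Fin 2) : ℕ)) =
            (y (b 0) : ℕ) + 2 * regVal (fun i => b i.succ) y +
              ((y (a 0) : ℕ) + 2 * regVal (fun i => a i.succ) y) + y c := by
          linear_combination e₃
        rwa [h3] at h2

/-- The number stored in a register of `n` qubits. -/
def regNum {S : Type} {n : ℕ} (f : Fin n ↪ S) (y : QBasis S) : Fin (2 ^ n) :=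
  finFunctionFinEquiv (y ∘ f)

theorem val_regNum {n : ℕ} (f : Fin n ↪ S) (y : QBasis S) : (regNum f y : ℕ) = regVal f y := by
  rw [regNum, finFunctionFinEquiv_apply]
  rfl

/-- Replacement of the number stored in a register. -/
noncomputable def setReg {S : Type} {n : ℕ} (f : Fin n ↪ S) (v : Fin (2 ^ n)) (y : QBasis S) : QBasis S :=
  Function.extend f (ket v) y

theorem setReg_apply {n : ℕ} (f : Fin n ↪ S) (v : Fin (2 ^ n)) (y : QBasis S) (i : Fin n) :
    setReg f v y (f i) = ket v i := f.injective.extend_apply _ _ _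

theorem setReg_apply_of_ne {n : ℕ} (f : Fin n ↪ S) (v : Fin (2 ^ n)) (y : QBasis S) {s : S}
    (h : ∀ i, f i ≠ s) : setReg f v y s = y s :=
  Function.extend_apply' _ _ _ fun ⟨i, hi⟩ => h i hi

theorem regNum_setReg {n : ℕ} (f : Fin n ↪ S) (v : Fin (2 ^ n)) (y : QBasis S) :
    regNum f (setReg f v y) = v := by
  rw [regNum, setReg, extend_comp_embedding, ket, Equiv.apply_symm_apply]

theorem setReg_setReg {n : ℕ} (f : Fin n ↪ S) (v w : Fin (2 ^ n)) (y : QBasis S) :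
    setReg f v (setReg f w y) = setReg f v y := by
  funext s
  by_cases h : ∃ i, f i = s
  · obtain ⟨i, rfl⟩ := h
    rw [setReg_apply, setReg_apply]
  · rw [not_exists] at h
    rw [setReg_apply_of_ne _ _ _ h, setReg_apply_of_ne _ _ _ h, setReg_apply_of_ne _ _ _ h]

theorem setReg_regNum {n : ℕ} (f : Fin n ↪ S) (y : QBasis S) : setReg f (regNum f y) y = y := by
  funext s
  by_cases h : ∃ i, f i = s
  · obtain ⟨i, rfl⟩ := h
    rw [setReg_apply, ket, regNum, Equiv.symm_apply_apply]
    rfl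
  · rw [not_exists] at h
    rw [setReg_apply_of_ne _ _ _ h]

theorem regNum_setReg_of_disjoint {n m : ℕ} {f : Fin n ↪ S} {g : Fin m ↪ S}
    (h : ∀ i j, f i ≠ g j) (v : Fin (2 ^ m)) (y : QBasis S) :
    regNum f (setReg g v y) = regNum f y := by
  rw [regNum, regNum]
  congr 1
  funext i
  exact setReg_apply_of_ne _ _ _ fun j => (h i j).symm

theorem eq_setReg {n : ℕ} {f : Fin n ↪ S} {x y : QBasis S} {v : Fin (2 ^ n)}
    (h : ∀ s, (∀ i, f i ≠ s) → x s = y s) (hv : regNum f x = v) : x = setReg f v y := by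
  funext s
  by_cases hs : ∃ i, f i = s
  · obtain ⟨i, rfl⟩ := hs
    rw [setReg_apply, ← hv, ket, regNum, Equiv.symm_apply_apply]
    rfl
  · rw [not_exists] at hs
    rw [setReg_apply_of_ne _ _ _ hs, h s hs]

/-- Addition of the number in the register `a` to the register `b`. -/
noncomputable def addReg {n : ℕ} (a b : Fin n ↪ S) (y : QBasis S) : QBasis S :=
  setReg b (regNum b y + regNum a y) y

/-- Subtraction of the number in the register `a` from the register `b`. -/
noncomputable def subReg {n : ℕ} (a b : Fin n ↪ S) (y : QBasis S) : QBasis S :=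
  setReg b (regNum b y - regNum a y) y

/-- Addition of a constant to a register. -/
noncomputable def addConst {n : ℕ} (v : Fin (2 ^ n)) (b : Fin n ↪ S) (y : QBasis S) : QBasis S :=
  setReg b (regNum b y + v) y

theorem restricts_basisMap {Z : Type} [Fintype Z] [DecidableEq Z] {F : QBasis (S ⊕ Z) → QBasis (S ⊕ Z)}
    {G : QBasis S → QBasis S} (h : ∀ y, F (Sum.elim y 0) = Sum.elim (G y) 0) :
    Restricts (basisMap F) (basisMap G) := by
  intro x y z
  simp only [basisMap, h]
  by_cases hz : z = 0
  · subst hz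
    rw [if_pos rfl]
    congr 1
    refine propext ⟨fun h' => ?_, fun h' => by rw [h']⟩
    funext s
    exact congrFun h' (Sum.inl s)
  · rw [if_neg hz, if_neg]
    intro h'
    refine hz (funext fun s => ?_)
    exact congrFun h' (Sum.inr s)

theorem synthAnc_addReg {n : ℕ} {a b : Fin n ↪ S} (hab : ∀ i j, a i ≠ b j) :
    SynthAnc (basisMap (addReg a b)) (200 * n) 1 := by
  obtain ⟨F, hF, hFy⟩ := exists_rippleCarryAdder n (fun i => (Sum.inl (a i) : S ⊕ Fin 1))
    (fun i => Sum.inl (b i)) newQubit (fun i j h => a.injective (Sum.inl.inj h))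
    (fun i j h => b.injective (Sum.inl.inj h)) (fun i j h => hab i j (Sum.inl.inj h))
    (fun i => by simp) (fun i => by simp)
  refine synthAnc_iff.2 ⟨_, hF, restricts_basisMap fun y => ?_⟩
  obtain ⟨h1, h2⟩ := hFy (Sum.elim y 0)
  have h3 : F (Sum.elim y 0) ∘ Sum.inl = addReg a b y := by
    refine eq_setReg (fun s hs => ?_) ?_
    · exact h1 (Sum.inl s) fun i h => hs i (Sum.inl.inj h)
    · apply Fin.ext
      rw [Fin.val_add, val_regNum, val_regNum, val_regNum]
      have h4 : regVal (fun i => (Sum.inl (b i) : S ⊕ Fin 1)) (F (Sum.elim y 0)) < 2 ^ n := by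
        have := (regNum b (F (Sum.elim y 0) ∘ Sum.inl)).isLt
        rw [val_regNum] at this
        exact this
      exact (Nat.mod_eq_of_lt h4).symm.trans h2
  funext s
  rcases s with s | s
  · exact congrFun h3 s
  · rw [h1 (Sum.inr s) fun i => by simp]
    rfl

theorem synth_addBits (k : QBasis S) (A : Finset S) :
    Synth (basisMap fun (y : QBasis S) s => if s ∈ A then y s + k s else y s) A.card := by
  induction A using Finset.induction_on with
  | empty =>
    simp only [Finset.notMem_empty, if_false]
    rw [basisMap_id]
    exact Synth.one
  | insert s A hs ih =>
    rw [Finset.card_insert_of_notMem hs, add_comm]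
    have h1 : Synth (basisMap (flipMap s fun _ : QBasis S => k s)) 1 := by
      have := Synth.single s (ite_pauliX_mem (k s = 1))
      rwa [mux_flip s fun _ => k s] at this
    have h2 := h1.mul ih
    rw [basisMap_mul] at h2
    convert h2 using 3
    funext s'
    by_cases h : s' = s
    · subst h
      simp [flipMap, hs]
    · simp [flipMap, h]

/-- The constant is written into `n` ancillas, added and erased; one more ancilla is the zero
carry-in of the adder. -/
theorem synthAnc_addConst {n : ℕ} (v : Fin (2 ^ n)) (b : Fin n ↪ S) :
    SynthAnc (basisMap (addConst v b)) (202 * n) (n + 1) := by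
  have h1 := (synth_addBits (Sum.elim 0 (ket v) : QBasis (S ⊕ Fin n))
    (Finset.univ.map Function.Embedding.inr)).anc 1
  have h2 := synthAnc_addReg (a := (Function.Embedding.inr : Fin n ↪ S ⊕ Fin n))
    (b := b.trans Function.Embedding.inl) (fun i j => by simp)
  have h3 := (h1.mul (h2.mul h1)).mono (c' := 202 * n)
    (by simp only [Finset.card_map, Finset.card_univ, Fintype.card_fin]; omega) le_rfl
  refine h3.of_restricts ?_
  rw [basisMap_mul, basisMap_mul]
  refine restricts_basisMap fun y => ?_
  have e1 : (fun s => if s ∈ Finset.univ.map (Function.Embedding.inr : Fin n ↪ S ⊕ Fin n) then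
      (Sum.elim y (0 : QBasis (Fin n)) s + (Sum.elim 0 (ket v) : QBasis (S ⊕ Fin n)) s : Fin 2)
      else Sum.elim y (0 : QBasis (Fin n)) s) = Sum.elim y (ket v) := by
    funext s
    rcases s with s | s <;> simp
  have e2 : addReg (Function.Embedding.inr : Fin n ↪ S ⊕ Fin n) (b.trans Function.Embedding.inl)
      (Sum.elim y (ket v)) = Sum.elim (addConst v b y) (ket v) := by
    symm
    refine eq_setReg (fun s hs => ?_) ?_
    · rcases s with s | s
      · exact setReg_apply_of_ne _ _ _ fun i h => hs i (congrArg Sum.inl h)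
      · rfl
    · have : regNum (Function.Embedding.inr : Fin n ↪ S ⊕ Fin n) (Sum.elim y (ket v)) = v :=
        finFunctionFinEquiv.apply_symm_apply v
      rw [this]
      exact regNum_setReg b _ y
  simp only [Function.comp_apply]
  rw [e1, e2]
  funext s
  rcases s with s | s
  · simp
  · have : ∀ p : Fin 2, p + p = 0 := by decide
    simp [this]

theorem subReg_addReg {n : ℕ} {a b : Fin n ↪ S} (hab : ∀ i j, a i ≠ b j) (y : QBasis S) :
    subReg a b (addReg a b y) = y := by
  rw [subReg, addReg, setReg_setReg, regNum_setReg, regNum_setReg_of_disjoint hab,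
    add_sub_cancel_right, setReg_regNum]

theorem addReg_subReg {n : ℕ} {a b : Fin n ↪ S} (hab : ∀ i j, a i ≠ b j) (y : QBasis S) :
    addReg a b (subReg a b y) = y := by
  rw [subReg, addReg, setReg_setReg, regNum_setReg, regNum_setReg_of_disjoint hab,
    sub_add_cancel, setReg_regNum]

theorem synthAnc_subReg {n : ℕ} {a b : Fin n ↪ S} (hab : ∀ i j, a i ≠ b j) :
    SynthAnc (basisMap (subReg a b)) (200 * n) 1 := by
  have := (synthAnc_addReg hab).conjTranspose
  rwa [basisMap_conjTranspose (subReg_addReg hab) (addReg_subReg hab)] at this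

end Adder

/-! ## Spectral factorisation and quantum signal processing -/

section SignalProcessing

open Polynomial

/-- The polynomial with the conjugated coefficients of `f`, read from degree `N` downwards. -/
noncomputable def conjReflect (N : ℕ) (f : ℂ[X]) : ℂ[X] := (f.map (starRingEnd ℂ)).reflect N

theorem coeff_conjReflect (N : ℕ) (f : ℂ[X]) (i : ℕ) :
    (conjReflect N f).coeff i = (starRingEnd ℂ) (f.coeff (revAt N i)) := by
  rw [conjReflect, coeff_reflect, coeff_map]

theorem conjReflect_mul {M N : ℕ} {f g : ℂ[X]} (hf : f.natDegree ≤ M) (hg : g.natDegree ≤ N) :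
    conjReflect (M + N) (f * g) = conjReflect M f * conjReflect N g := by
  rw [conjReflect, Polynomial.map_mul]
  exact reflect_mul _ _ (natDegree_map_le.trans hf) (natDegree_map_le.trans hg)

theorem conjReflect_add (N : ℕ) (f g : ℂ[X]) :
    conjReflect N (f + g) = conjReflect N f + conjReflect N g := by
  rw [conjReflect, Polynomial.map_add, reflect_add]
  rfl

theorem conjReflect_C_mul (N : ℕ) (a : ℂ) (f : ℂ[X]) :
    conjReflect N (C a * f) = C ((starRingEnd ℂ) a) * conjReflect N f := by
  rw [conjReflect, Polynomial.map_mul, map_C, reflect_C_mul]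
  rfl

theorem conjReflect_X_mul {N : ℕ} {f : ℂ[X]} (hf : f.natDegree ≤ N) :
    conjReflect (N + 1) (X * f) = conjReflect N f := by
  rw [add_comm N 1, conjReflect_mul natDegree_X_le hf]
  have : conjReflect 1 X = 1 := by
    rw [conjReflect, map_X, reflect_one_X]
  rw [this, one_mul]

theorem conjReflect_succ {N : ℕ} {f : ℂ[X]} (hf : f.natDegree ≤ N) :
    conjReflect (N + 1) f = X * conjReflect N f := by
  have h := conjReflect_mul (M := 1) (f := (1 : ℂ[X])) (by simp) hf
  have : conjReflect 1 1 = X := by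
    rw [conjReflect, Polynomial.map_one, reflect_one, pow_one]
  rwa [one_mul, this, add_comm] at h

/-- For a polynomial fixed by `conjReflect`, this pairs each non-zero root with its mirror image in
the unit circle. -/
theorem eval_conjReflect_mul_pow {N : ℕ} {f : ℂ[X]} (hf : f.natDegree ≤ N) {x : ℂ} (hx : x ≠ 0) :
    (conjReflect N f).eval x⁻¹ * x ^ N = (starRingEnd ℂ) (f.eval ((starRingEnd ℂ) x)) := by
  have := invertibleOfNonzero hx
  have h := eval₂_reflect_mul_pow (RingHom.id ℂ) x N (f.map (starRingEnd ℂ))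
    (natDegree_map_le.trans hf)
  rw [invOf_eq_inv] at h
  rw [conjReflect, ← eval₂_id, h, eval₂_id, eval_map]
  nth_rewrite 1 [← Complex.conj_conj x]
  exact eval₂_hom _ _

theorem eval_conjReflect_of_norm_eq_one {N : ℕ} {f : ℂ[X]} (hf : f.natDegree ≤ N) {z : ℂ}
    (hz : ‖z‖ = 1) : (conjReflect N f).eval z = z ^ N * (starRingEnd ℂ) (f.eval z) := by
  have hz0 : z ≠ 0 := by
    rintro rfl
    simp at hz
  have h := eval_conjReflect_mul_pow hf (inv_ne_zero hz0)
  have hc : (starRingEnd ℂ) z⁻¹ = z := by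
    rw [map_inv₀, Complex.inv_def, Complex.conj_conj, Complex.normSq_conj, Complex.normSq_eq_norm_sq,
      hz]
    simp
  rw [hc, inv_inv] at h
  rw [← h, inv_pow, mul_comm, mul_assoc, inv_mul_cancel₀ (pow_ne_zero _ hz0), mul_one]

theorem infinite_unit_circle : Set.Infinite {z : ℂ | ‖z‖ = 1} := by
  refine Set.infinite_of_injOn_mapsTo (s := Set.Ioo (0 : ℝ) 1)
    (f := fun t => Complex.exp (t * Complex.I)) ?_ ?_ (Set.Ioo_infinite one_pos)
  · intro t ht s hs h
    have h1 := congrArg Complex.re h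
    simp only [Complex.exp_ofReal_mul_I_re] at h1
    have hpi := Real.pi_gt_three
    exact Real.injOn_cos ⟨ht.1.le, by linarith [ht.2]⟩ ⟨hs.1.le, by linarith [hs.2]⟩ h1
  · intro t _
    exact Complex.norm_exp_ofReal_mul_I t

theorem eq_of_eval_eq_on_circle {f g : ℂ[X]} (h : ∀ z : ℂ, ‖z‖ = 1 → f.eval z = g.eval z) :
    f = g :=
  eq_of_infinite_eval_eq f g (infinite_unit_circle.mono h)

/-- On the unit circle `h / z ^ q` is real, so both sides agree there, and the circle is infinite.
-/
theorem conjReflect_eq_self {q : ℕ} {h : ℂ[X]} (hd : h.natDegree ≤ 2 * q)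
    (hh : ∀ z : ℂ, ‖z‖ = 1 → ∃ r : ℝ, 0 < r ∧ h.eval z = r * z ^ q) : conjReflect (2 * q) h = h := by
  refine eq_of_eval_eq_on_circle fun z hz => ?_
  obtain ⟨r, _, hr⟩ := hh z hz
  have h1 : z * (starRingEnd ℂ) z = 1 := by
    rw [Complex.mul_conj', hz]
    simp
  rw [eval_conjReflect_of_norm_eq_one hd hz, hr, map_mul, map_pow, Complex.conj_ofReal, two_mul,
    pow_add]
  calc z ^ q * z ^ q * (r * (starRingEnd ℂ) z ^ q) = r * z ^ q * (z * (starRingEnd ℂ) z) ^ q := by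
        rw [mul_pow]; ring
    _ = _ := by rw [h1, one_pow, mul_one]

/-- The theorem of Fejér and Riesz for trigonometric polynomials which are positive on the unit
circle. -/
theorem exists_spectral_factor (q : ℕ) : ∀ h : ℂ[X], h.natDegree ≤ 2 * q →
    (∀ z : ℂ, ‖z‖ = 1 → ∃ r : ℝ, 0 < r ∧ h.eval z = r * z ^ q) →
    ∃ g : ℂ[X], g.natDegree ≤ q ∧ h = g * conjReflect q g := by
  induction q with
  | zero =>
    intro h hd hh
    obtain ⟨r, hr, hr1⟩ := hh 1 (by simp)
    rw [eq_C_of_natDegree_le_zero hd] at hr1 ⊢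
    simp only [eval_C, pow_zero, mul_one] at hr1
    refine ⟨C ((Real.sqrt r : ℝ) : ℂ), by simp, ?_⟩
    have : conjReflect 0 (C ((Real.sqrt r : ℝ) : ℂ)) = C ((Real.sqrt r : ℝ) : ℂ) := by
      rw [conjReflect, map_C, Complex.conj_ofReal, reflect_C]
      simp
    rw [this, ← C_mul, hr1]
    congr 1
    exact_mod_cast (Real.mul_self_sqrt hr.le).symm
  | succ q ih =>
    intro h hd hh
    have hsym := conjReflect_eq_self hd hh
    have htop : h.coeff (2 * (q + 1)) = (starRingEnd ℂ) (h.coeff 0) := by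
      have := congrArg (fun p => coeff p (2 * (q + 1))) hsym
      simp only [coeff_conjReflect] at this
      rw [revAt_le le_rfl, Nat.sub_self] at this
      exact this.symm
    have hz0 : ∀ z : ℂ, ‖z‖ = 1 → z ≠ 0 := by
      rintro z hz rfl
      simp at hz
    -- By symmetry a vanishing constant coefficient forces the coefficient in degree `2 * (q + 1)`
    -- to vanish as well, so division by `X` lowers `q` by one. Otherwise `h` has a root, which is
    -- not zero.
    by_cases h0 : h.coeff 0 = 0
    · rw [h0, map_zero] at htop
      have hX : X * h.divX = h := by
        have := divX_mul_X_add h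
        rw [h0, C_0, add_zero, mul_comm] at this
        exact this
      have hd' : h.divX.natDegree ≤ 2 * q := by
        rw [natDegree_divX_eq_natDegree_tsub_one]
        have : h.natDegree ≠ 2 * (q + 1) := by
          intro h'
          rw [← h', coeff_natDegree, leadingCoeff_eq_zero] at htop
          rw [htop, natDegree_zero] at h'
          omega
        omega
      obtain ⟨g, hg, hgh⟩ := ih h.divX hd' fun z hz => by
        obtain ⟨r, hr, hr1⟩ := hh z hz
        refine ⟨r, hr, mul_left_cancel₀ (hz0 z hz) ?_⟩
        rw [← hX, eval_mul, eval_X] at hr1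
        rw [hr1]
        ring
      refine ⟨g, hg.trans (Nat.le_succ q), ?_⟩
      rw [conjReflect_succ hg, ← hX, hgh]
      ring
    · have htop0 : h.coeff (2 * (q + 1)) ≠ 0 := by
        rw [htop]
        exact (_root_.map_ne_zero _).2 h0
      have hdeg : h.natDegree = 2 * (q + 1) := le_antisymm hd (le_natDegree_of_ne_zero htop0)
      have hne : h ≠ 0 := by
        rintro rfl
        simp at h0
      obtain ⟨a, ha⟩ := Complex.exists_root (f := h)
        (natDegree_pos_iff_degree_pos.1 (by omega))
      have ha0 : a ≠ 0 := by
        rintro rfl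
        rw [IsRoot.def, ← coeff_zero_eq_eval_zero] at ha
        exact h0 ha
      have hca : (starRingEnd ℂ) a ≠ 0 := (_root_.map_ne_zero _).2 ha0
      -- Strict positivity keeps the roots off the circle. Hence `a` and its mirror image are
      -- distinct and may be divided out together, without regard to multiplicities.
      have ha1 : ‖a‖ ≠ 1 := by
        intro h1
        obtain ⟨r, hr, hr1⟩ := hh a h1
        rw [IsRoot.def.1 ha] at hr1
        exact mul_ne_zero (by exact_mod_cast hr.ne') (pow_ne_zero _ ha0) hr1.symm
      have hb : h.IsRoot ((starRingEnd ℂ) a)⁻¹ := by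
        have := eval_conjReflect_mul_pow hd hca
        rw [hsym, Complex.conj_conj, IsRoot.def.1 ha, map_zero] at this
        exact (mul_eq_zero.1 this).resolve_right (pow_ne_zero _ hca)
      have hab : a ≠ ((starRingEnd ℂ) a)⁻¹ := by
        intro h'
        have h2 : a * (starRingEnd ℂ) a = 1 := by
          nth_rewrite 1 [h']
          exact inv_mul_cancel₀ hca
        rw [Complex.mul_conj'] at h2
        have h3 : ‖a‖ ^ 2 = 1 := by exact_mod_cast h2
        exact ha1 ((pow_eq_one_iff_of_nonneg (norm_nonneg _) two_ne_zero).1 h3)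
      obtain ⟨k, hk⟩ : (X - C a) * (X - C ((starRingEnd ℂ) a)⁻¹) ∣ h :=
        (isCoprime_X_sub_C_of_isUnit_sub (sub_ne_zero.2 hab).isUnit).mul_dvd
          (dvd_iff_isRoot.2 ha) (dvd_iff_isRoot.2 hb)
      have hk' : h = (X - C a) * (1 - C ((starRingEnd ℂ) a) * X) *
          (C (-((starRingEnd ℂ) a)⁻¹) * k) := by
        have h1 : C ((starRingEnd ℂ) a) * C ((starRingEnd ℂ) a)⁻¹ = (1 : ℂ[X]) := by
          rw [← C_mul, mul_inv_cancel₀ hca, C_1]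
        rw [hk, C_neg]
        linear_combination (C a - X) * k * X * h1
      obtain ⟨k', hkk⟩ : ∃ k', k' = C (-((starRingEnd ℂ) a)⁻¹) * k := ⟨_, rfl⟩
      rw [← hkk] at hk'
      have hk0 : k' ≠ 0 := by
        rintro rfl
        rw [mul_zero] at hk'
        exact hne hk'
      have hlin : (1 - C ((starRingEnd ℂ) a) * X).natDegree = 1 := by
        have : 1 - C ((starRingEnd ℂ) a) * X = C (-(starRingEnd ℂ) a) * X + C 1 := by
          rw [C_neg, C_1]; ring
        rw [this]
        exact natDegree_linear (neg_ne_zero.2 hca)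
      have hlin0 : (1 - C ((starRingEnd ℂ) a) * X) ≠ 0 := by
        intro h'
        rw [h', natDegree_zero] at hlin
        omega
      have hdk : k'.natDegree ≤ 2 * q := by
        have := congrArg natDegree hk'
        rw [natDegree_mul (mul_ne_zero (X_sub_C_ne_zero a) hlin0) hk0,
          natDegree_mul (X_sub_C_ne_zero a) hlin0, natDegree_X_sub_C, hlin, hdeg] at this
        omega
      obtain ⟨g, hg, hgh⟩ := ih k' hdk fun z hz => by
        obtain ⟨r, hr, hr1⟩ := hh z hz
        have hza : z - a ≠ 0 := by
          intro h'
          rw [sub_eq_zero.1 h'] at hz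
          exact ha1 hz
        -- On the circle the removed factor `(z - a) * (1 - conj a * z)` is `z` times `‖z - a‖ ^ 2`,
        -- so the quotient is again positive.
        refine ⟨r / ‖z - a‖ ^ 2, div_pos hr (by positivity), ?_⟩
        have h1 : z * (starRingEnd ℂ) z = 1 := by
          rw [Complex.mul_conj', hz]
          simp
        have h2 : (z - a) * (1 - (starRingEnd ℂ) a * z) = z * (‖z - a‖ ^ 2 : ℝ) := by
          push_cast
          rw [← Complex.mul_conj', map_sub]
          linear_combination (a - z) * h1
        rw [hk', eval_mul, eval_mul] at hr1
        simp only [eval_sub, eval_X, eval_C, eval_one, eval_mul] at hr1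
        rw [h2] at hr1
        have h3 : ((‖z - a‖ ^ 2 : ℝ) : ℂ) ≠ 0 := by
          exact_mod_cast (pow_pos (norm_pos_iff.2 hza) 2).ne'
        rw [Complex.ofReal_div, div_mul_eq_mul_div, eq_div_iff h3]
        refine mul_left_cancel₀ (hz0 z hz) ?_
        linear_combination hr1
      refine ⟨(X - C a) * g, ?_, ?_⟩
      · exact natDegree_mul_le.trans (by rw [natDegree_X_sub_C]; omega)
      · rw [add_comm q 1, conjReflect_mul (natDegree_X_sub_C_le a) hg]
        have h1 : conjReflect 1 (X - C a) = 1 - C ((starRingEnd ℂ) a) * X := by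
          have e : X - C a = X * 1 + C (-a) * 1 := by rw [C_neg]; ring
          rw [e, conjReflect_add, conjReflect_C_mul, conjReflect_X_mul (by simp),
            conjReflect_succ (by simp)]
          have : conjReflect 0 1 = 1 := by
            rw [conjReflect, Polynomial.map_one, reflect_one]
            simp
          rw [this, map_neg, C_neg]
          ring
        rw [h1, hk', hgh]
        ring

/-- The pairs of polynomials which generalised quantum signal processing realises in `k` steps. -/
inductive SignalReach : ℕ → ℂ[X] → ℂ[X] → Prop
  | zero (u : Matrix (Fin 2) (Fin 2) ℂ) (hu : u ∈ Matrix.unitaryGroup (Fin 2) ℂ) :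
      SignalReach 0 (C (u 0 0)) (C (u 1 0))
  | succ (u : Matrix (Fin 2) (Fin 2) ℂ) (hu : u ∈ Matrix.unitaryGroup (Fin 2) ℂ) {k : ℕ}
      {f g : ℂ[X]} (h : SignalReach k f g) :
      SignalReach (k + 1) (C (u 0 0) * (X * f) + C (u 0 1) * g) (C (u 1 0) * (X * f) + C (u 1 1) * g)

/-- For `p ≠ 0` the first column is taken along `p`: the second is then orthogonal to `p`, and the
first to `r` by hypothesis. For `p = 0` the second column is taken along `r`. -/
theorem exists_unitary_rotating {p₀ p₁ r₀ r₁ : ℂ}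
    (h : (starRingEnd ℂ) p₀ * r₀ + (starRingEnd ℂ) p₁ * r₁ = 0) :
    ∃ u ∈ Matrix.unitaryGroup (Fin 2) ℂ,
      (starRingEnd ℂ) (u 0 1) * p₀ + (starRingEnd ℂ) (u 1 1) * p₁ = 0 ∧
      (starRingEnd ℂ) (u 0 0) * r₀ + (starRingEnd ℂ) (u 1 0) * r₁ = 0 := by
  have orth : ∀ u ∈ Matrix.unitaryGroup (Fin 2) ℂ,
      (starRingEnd ℂ) (u 0 1) * u 0 0 + (starRingEnd ℂ) (u 1 1) * u 1 0 = 0 := by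
    intro u hu
    have := congrFun (congrFun (Matrix.mem_unitaryGroup_iff'.1 hu) 1) 0
    simpa [Matrix.mul_apply, Fin.sum_univ_two, Matrix.star_apply] using this
  by_cases hp : p₀ = 0 ∧ p₁ = 0
  · obtain ⟨u, hu, h0, h1⟩ := exists_unitary_first_column r₀ r₁
    refine ⟨u * pauliX, mul_mem hu pauliX_mem, by simp [hp], ?_⟩
    have e0 : (u * pauliX) 0 0 = u 0 1 := by
      simp [Matrix.mul_apply, pauliX_apply]
    have e1 : (u * pauliX) 1 0 = u 1 1 := by
      simp [Matrix.mul_apply, pauliX_apply]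
    rw [e0, e1]
    linear_combination (Real.sqrt (‖r₀‖ ^ 2 + ‖r₁‖ ^ 2) : ℂ) * orth u hu -
      (starRingEnd ℂ) (u 0 1) * h0 - (starRingEnd ℂ) (u 1 1) * h1
  · obtain ⟨u, hu, h0, h1⟩ := exists_unitary_first_column p₀ p₁
    have hpos : 0 < ‖p₀‖ ^ 2 + ‖p₁‖ ^ 2 := by
      by_contra hn
      have ha : ‖p₀‖ = 0 := by nlinarith [sq_nonneg ‖p₀‖, sq_nonneg ‖p₁‖]
      have hb : ‖p₁‖ = 0 := by nlinarith [sq_nonneg ‖p₀‖, sq_nonneg ‖p₁‖]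
      exact hp ⟨norm_eq_zero.1 ha, norm_eq_zero.1 hb⟩
    have hr : (Real.sqrt (‖p₀‖ ^ 2 + ‖p₁‖ ^ 2) : ℂ) ≠ 0 := by
      exact_mod_cast (Real.sqrt_pos.2 hpos).ne'
    refine ⟨u, hu, ?_, ?_⟩
    · linear_combination (Real.sqrt (‖p₀‖ ^ 2 + ‖p₁‖ ^ 2) : ℂ) * orth u hu -
        (starRingEnd ℂ) (u 0 1) * h0 - (starRingEnd ℂ) (u 1 1) * h1
    · have c0 := congrArg (starRingEnd ℂ) h0
      have c1 := congrArg (starRingEnd ℂ) h1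
      rw [map_mul, Complex.conj_ofReal] at c0 c1
      refine mul_left_cancel₀ hr ?_
      linear_combination h + r₀ * c0 + r₁ * c1

/-- Layer stripping: the normalisation makes the top and the constant coefficient vectors of `(f,
g)` orthogonal. One rotation therefore removes the constant term of the first component and the top
term of the second, and the first component is divided by `X`. -/
theorem signalReach_of_mul_conjReflect (k : ℕ) : ∀ f g : ℂ[X], f.natDegree ≤ k → g.natDegree ≤ k →
    f * conjReflect k f + g * conjReflect k g = X ^ k → SignalReach k f g := by
  induction k with
  | zero =>
    intro f g hf hg h
    rw [eq_C_of_natDegree_le_zero hf, eq_C_of_natDegree_le_zero hg] at h ⊢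
    obtain ⟨u, hu, h0, h1⟩ := exists_unitary_first_column (f.coeff 0) (g.coeff 0)
    have h2 : ‖f.coeff 0‖ ^ 2 + ‖g.coeff 0‖ ^ 2 = 1 := by
      have h3 := congrArg (eval 0) h
      simp only [conjReflect, map_C, reflect_C, pow_zero, mul_one, eval_add, eval_mul, eval_C,
        eval_one, Complex.mul_conj'] at h3
      exact_mod_cast h3
    rw [h2, Real.sqrt_one, Complex.ofReal_one, mul_one] at h0 h1
    rw [← h0, ← h1]
    exact SignalReach.zero u hu
  | succ k ih =>
    intro f g hf hg h
    have h0 : (starRingEnd ℂ) (f.coeff (k + 1)) * f.coeff 0 +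
        (starRingEnd ℂ) (g.coeff (k + 1)) * g.coeff 0 = 0 := by
      have := congrArg (fun p => coeff p 0) h
      simp only [coeff_add, mul_coeff_zero, coeff_conjReflect, coeff_X_pow,
        revAt_le (Nat.zero_le _), Nat.sub_zero, (Nat.succ_ne_zero k).symm, if_false] at this
      linear_combination this
    obtain ⟨u, hu, hp, hr⟩ := exists_unitary_rotating h0
    have huu := Matrix.mem_unitaryGroup_iff.1 hu
    have u00 := congrFun (congrFun huu 0) 0
    have u01 := congrFun (congrFun huu 0) 1
    have u10 := congrFun (congrFun huu 1) 0
    have u11 := congrFun (congrFun huu 1) 1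
    simp only [Matrix.mul_apply, Fin.sum_univ_two, Matrix.star_apply, Matrix.one_apply,
      RCLike.star_def, if_true, Fin.reduceEq, if_false] at u00 u01 u10 u11
    replace u00 := congrArg C u00
    replace u01 := congrArg C u01
    replace u10 := congrArg C u10
    replace u11 := congrArg C u11
    simp only [C_add, C_mul, C_1, C_0] at u00 u01 u10 u11
    obtain ⟨F, hF⟩ : ∃ F, F = C ((starRingEnd ℂ) (u 0 0)) * f + C ((starRingEnd ℂ) (u 1 0)) * g :=
      ⟨_, rfl⟩
    obtain ⟨G, hG⟩ : ∃ G, G = C ((starRingEnd ℂ) (u 0 1)) * f + C ((starRingEnd ℂ) (u 1 1)) * g :=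
      ⟨_, rfl⟩
    have hf' : f = C (u 0 0) * F + C (u 0 1) * G := by
      rw [hF, hG]
      linear_combination (-f) * u00 - g * u01
    have hg' : g = C (u 1 0) * F + C (u 1 1) * G := by
      rw [hF, hG]
      linear_combination (-f) * u10 - g * u11
    have hdeg : ∀ a b : ℂ, (C a * f + C b * g).natDegree ≤ k + 1 := fun a b =>
      (natDegree_add_le _ _).trans (max_le ((natDegree_C_mul_le _ _).trans hf)
        ((natDegree_C_mul_le _ _).trans hg))
    have hFG : F * conjReflect (k + 1) F + G * conjReflect (k + 1) G = X ^ (k + 1) := by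
      rw [← h, hF, hG, conjReflect_add, conjReflect_add, conjReflect_C_mul, conjReflect_C_mul,
        conjReflect_C_mul, conjReflect_C_mul, Complex.conj_conj, Complex.conj_conj,
        Complex.conj_conj, Complex.conj_conj]
      linear_combination f * conjReflect (k + 1) f * u00 + g * conjReflect (k + 1) f * u01 +
        f * conjReflect (k + 1) g * u10 + g * conjReflect (k + 1) g * u11
    have hFX : X * F.divX = F := by
      have h1 := divX_mul_X_add F
      have h2 : F.coeff 0 = 0 := by
        rw [hF, coeff_add, coeff_C_mul, coeff_C_mul, hr]
      rw [h2, C_0, add_zero, mul_comm] at h1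
      exact h1
    have hFd : F.divX.natDegree ≤ k := by
      rw [natDegree_divX_eq_natDegree_tsub_one, hF]
      have := hdeg ((starRingEnd ℂ) (u 0 0)) ((starRingEnd ℂ) (u 1 0))
      omega
    have hGd : G.natDegree ≤ k := by
      have h1 : G.natDegree ≤ k + 1 := by
        rw [hG]
        exact hdeg _ _
      have h2 : G.coeff (k + 1) = 0 := by
        rw [hG, coeff_add, coeff_C_mul, coeff_C_mul, hp]
      by_contra h3
      have h4 : G.natDegree = k + 1 := by omega
      rw [← h4, coeff_natDegree, leadingCoeff_eq_zero] at h2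
      rw [h2, natDegree_zero] at h4
      omega
    have key : F.divX * conjReflect k F.divX + G * conjReflect k G = X ^ k := by
      refine mul_left_cancel₀ (X_ne_zero (R := ℂ)) ?_
      rw [conjReflect_succ hGd, ← hFX, conjReflect_X_mul hFd] at hFG
      rw [← pow_succ', ← hFG]
      ring
    have := SignalReach.succ u hu (ih F.divX G hFd hGd key)
    rwa [hFX, ← hf', ← hg'] at this

/-- The polynomial `f` of degree `q` with `f (w²) = w ^ q * P ((w + w⁻¹) / 2)`. -/
noncomputable def signalPoly (P : ℝ[X]) : ℂ[X] :=
  ∑ e ∈ P.support, C ((P.coeff e : ℝ) : ℂ) *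
    (X ^ ((P.natDegree - e) / 2) * (C (1 / 2) * (X + 1)) ^ e)

theorem natDegree_signalPoly_le (P : ℝ[X]) : (signalPoly P).natDegree ≤ P.natDegree := by
  refine natDegree_sum_le_of_forall_le _ _ fun e he => ?_
  have h1 : (C (1 / 2) * (X + 1) : ℂ[X]).natDegree ≤ 1 :=
    (natDegree_C_mul_le _ _).trans (natDegree_X_add_C (1 : ℂ)).le
  have h2 := natDegree_pow_le_of_le e h1
  have h3 : e ≤ P.natDegree := le_natDegree_of_mem_supp e he
  refine (natDegree_C_mul_le _ _).trans (natDegree_mul_le.trans ?_)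
  rw [natDegree_X_pow]
  omega

/-- An arbitrary algebra is needed because the identity is used twice: at a point of the unit
circle, for the norm bound, and at the operator `W`. -/
theorem aeval_signalPoly {A : Type} [Ring A] [Algebra ℂ A] {P : ℝ[X]}
    (hP : ∀ e, P.coeff e ≠ 0 → e % 2 = P.natDegree % 2) {w w' : A} (h : w * w' = 1)
    (h' : w' * w = 1) :
    aeval (w * w) (signalPoly P) =
      w ^ P.natDegree * aeval ((1 / 2 : ℂ) • (w + w')) (P.map Complex.ofRealHom) := by
  have hc : Commute w ((1 / 2 : ℂ) • (w + w')) := by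
    refine Commute.smul_right ?_ _
    exact (Commute.refl w).add_right (h.trans h'.symm)
  have hm : P.map Complex.ofRealHom = ∑ e ∈ P.support, C ((P.coeff e : ℝ) : ℂ) * X ^ e := by
    conv_lhs => rw [P.as_sum_support_C_mul_X_pow]
    simp [Polynomial.map_sum]
  rw [hm, signalPoly, map_sum, map_sum, Finset.mul_sum]
  refine Finset.sum_congr rfl fun e he => ?_
  have h3 : e ≤ P.natDegree := le_natDegree_of_mem_supp e he
  have h4 := hP e (mem_support_iff.1 he)
  -- Parity makes the halved exponent in `signalPoly` exact.
  obtain ⟨j, hj⟩ : ∃ j, P.natDegree = 2 * j + e := ⟨(P.natDegree - e) / 2, by omega⟩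
  have h5 : (P.natDegree - e) / 2 = j := by omega
  have h6 : aeval (w * w) (C (1 / 2) * (X + 1) : ℂ[X]) = w * ((1 / 2 : ℂ) • (w + w')) := by
    simp only [map_mul, map_add, aeval_C, aeval_X, map_one, mul_smul_comm, mul_add, h]
    rw [Algebra.smul_def, mul_add]
  rw [h5, map_mul, map_mul, map_mul, map_pow, map_pow, map_pow, aeval_X, aeval_X, h6, hc.mul_pow,
    aeval_C, aeval_C, hj, pow_add, pow_mul, pow_two w, ← Algebra.smul_def, ← Algebra.smul_def,
    mul_smul_comm, mul_assoc]

/-- Quantum signal processing for a real polynomial of definite parity. -/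
theorem exists_signalReach {P : ℝ[X]} (hP : ∀ e, P.coeff e ≠ 0 → e % 2 = P.natDegree % 2)
    (hb : ∀ x ∈ Set.Icc (-1 : ℝ) 1, |P.eval x| < 1) :
    ∃ g, SignalReach P.natDegree (signalPoly P) g := by
  have hd := natDegree_signalPoly_le P
  have hlt : ∀ z : ℂ, ‖z‖ = 1 → ‖(signalPoly P).eval z‖ < 1 := by
    intro z hz
    -- With a square root `ζ` of `z` on the circle, the modulus of `signalPoly P` at `z` is that of
    -- `P` at `Re ζ`, a point of `[-1, 1]`.
    have hs : Complex.exp ((z.arg / 2 : ℝ) * Complex.I) *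
        Complex.exp ((z.arg / 2 : ℝ) * Complex.I) = z := by
      rw [← Complex.exp_add, ← add_mul, ← Complex.ofReal_add, add_halves]
      have := Complex.norm_mul_exp_arg_mul_I z
      rwa [hz, Complex.ofReal_one, one_mul] at this
    obtain ⟨ζ, hζ⟩ : ∃ ζ, ζ = Complex.exp ((z.arg / 2 : ℝ) * Complex.I) := ⟨_, rfl⟩
    have hn : ‖ζ‖ = 1 := by rw [hζ, Complex.norm_exp_ofReal_mul_I]
    rw [← hζ] at hs
    have h1 : ζ * (starRingEnd ℂ) ζ = 1 := by
      rw [Complex.mul_conj', hn]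
      simp
    have key := aeval_signalPoly hP h1 (by rw [mul_comm, h1])
    rw [hs] at key
    have h2 : (1 / 2 : ℂ) • (ζ + (starRingEnd ℂ) ζ) = ((ζ.re : ℝ) : ℂ) := by
      rw [Complex.add_conj, smul_eq_mul]
      push_cast
      ring
    have h3 : aeval ((ζ.re : ℝ) : ℂ) (P.map Complex.ofRealHom) = ((P.eval ζ.re : ℝ) : ℂ) := by
      rw [coe_aeval_eq_eval, eval_map]
      exact eval₂_hom Complex.ofRealHom ζ.re
    rw [h2, h3, coe_aeval_eq_eval] at key
    rw [key, norm_mul, norm_pow, hn, one_pow, one_mul, Complex.norm_real, Real.norm_eq_abs]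
    exact hb _ (abs_le.1 ((Complex.abs_re_le_norm ζ).trans hn.le))
  obtain ⟨g, hg, hgh⟩ := exists_spectral_factor P.natDegree
    (X ^ P.natDegree - signalPoly P * conjReflect P.natDegree (signalPoly P)) (by
      have h1 : (conjReflect P.natDegree (signalPoly P)).natDegree ≤ P.natDegree :=
        (natDegree_reflect_le).trans (max_le le_rfl (natDegree_map_le.trans hd))
      have h2 := (natDegree_mul_le (p := signalPoly P)
        (q := conjReflect P.natDegree (signalPoly P))).trans (add_le_add hd h1)
      refine (natDegree_sub_le _ _).trans (max_le ?_ (by omega))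
      rw [natDegree_X_pow]
      omega) fun z hz => by
      refine ⟨1 - ‖(signalPoly P).eval z‖ ^ 2, ?_, ?_⟩
      · have := hlt z hz
        nlinarith [norm_nonneg ((signalPoly P).eval z)]
      · rw [eval_sub, eval_mul, eval_conjReflect_of_norm_eq_one hd hz, eval_pow, eval_X]
        push_cast
        rw [← Complex.mul_conj']
        ring
  refine ⟨g, signalReach_of_mul_conjReflect _ _ _ hd hg ?_⟩
  rw [← hgh]
  ring

end SignalProcessing

/-! ## Polynomials of diagonal matrices by signal processing -/

section SignalCircuit

variable {V : Type} [Fintype V] [DecidableEq V]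

/-- The state `|ψ₀⟩|0⟩ + |ψ₁⟩|1⟩`. -/
def pairState (ψ₀ ψ₁ : QBasis V → ℂ) (x : QBasis (V ⊕ Fin 1)) : ℂ :=
  if x newQubit = 0 then ψ₀ (x ∘ Sum.inl) else ψ₁ (x ∘ Sum.inl)

theorem sum_qbasis_newQubit (G : QBasis (V ⊕ Fin 1) → ℂ) :
    ∑ w, G w = ∑ x : QBasis V, G (Sum.elim x fun _ => 0) + ∑ x : QBasis V, G (Sum.elim x fun _ => 1) := by
  rw [sum_qbasis_sum, ← Finset.sum_add_distrib]
  refine Finset.sum_congr rfl fun x _ => ?_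
  rw [← Fin.sum_univ_two (fun b => G (Sum.elim x fun _ => b))]
  exact Fintype.sum_equiv (Equiv.funUnique (Fin 1) (Fin 2)) _ _ fun z => by
    congr 2
    funext i
    rw [Subsingleton.elim i 0]
    rfl

theorem qbasis_eq_elim (x : QBasis (V ⊕ Fin 1)) :
    x = Sum.elim (x ∘ Sum.inl) fun _ => x newQubit := by
  funext s
  rcases s with s | s
  · rfl
  · rw [Subsingleton.elim s 0]
    rfl

theorem mulVec_pairState {M : QOp (V ⊕ Fin 1)} (N : Fin 2 → Fin 2 → QOp V)
    (h : ∀ x y b b', M (Sum.elim x fun _ => b) (Sum.elim y fun _ => b') = N b b' x y)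
    (ψ₀ ψ₁ : QBasis V → ℂ) :
    M *ᵥ pairState ψ₀ ψ₁ =
      pairState (N 0 0 *ᵥ ψ₀ + N 0 1 *ᵥ ψ₁) (N 1 0 *ᵥ ψ₀ + N 1 1 *ᵥ ψ₁) := by
  funext x
  rw [qbasis_eq_elim x, Matrix.mulVec, dotProduct, sum_qbasis_newQubit]
  simp only [h]
  rcases fin_two_cases (x newQubit) with hx | hx <;> rw [hx] <;>
    simp [pairState, Matrix.mulVec, dotProduct]

theorem elim_const_agreeOff {x y : QBasis V} {b b' : Fin 2} :
    (∀ s, s ≠ (newQubit : V ⊕ Fin 1) → (Sum.elim x fun _ => b : QBasis (V ⊕ Fin 1)) s =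
      (Sum.elim y fun _ => b' : QBasis (V ⊕ Fin 1)) s) ↔ x = y := by
  constructor
  · intro h
    funext s
    exact h (Sum.inl s) (by simp)
  · rintro rfl s hs
    rcases s with s | s
    · rfl
    · exact absurd (congrArg Sum.inr (Subsingleton.elim s 0)) hs

theorem rotation_mulVec_pairState (u : Matrix (Fin 2) (Fin 2) ℂ) (ψ₀ ψ₁ : QBasis V → ℂ) :
    mux (newQubit : V ⊕ Fin 1) (fun _ => u) *ᵥ pairState ψ₀ ψ₁ =
      pairState (u 0 0 • ψ₀ + u 0 1 • ψ₁) (u 1 0 • ψ₀ + u 1 1 • ψ₁) := by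
  rw [mulVec_pairState (fun b b' => u b b' • (1 : QOp V))]
  · simp only [Matrix.smul_mulVec, Matrix.one_mulVec]
  · intro x y b b'
    rw [Matrix.smul_apply, Matrix.one_apply]
    by_cases h : x = y
    · rw [mux_of_agree (elim_const_agreeOff.2 h), if_pos h]
      simp
    · rw [mux_of_not_agree (fun h' => h (elim_const_agreeOff.1 h')), if_neg h, smul_zero]

theorem onReg_inl_mulVec_pairState (A : QOp V) (ψ₀ ψ₁ : QBasis V → ℂ) :
    onReg (Function.Embedding.inl : V ↪ V ⊕ Fin 1) A *ᵥ pairState ψ₀ ψ₁ =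
      pairState (A *ᵥ ψ₀) (A *ᵥ ψ₁) := by
  rw [mulVec_pairState (fun b b' => if b = b' then A else 0)]
  · simp
  · intro x y b b'
    by_cases h : b = b'
    · rw [if_pos h, onReg, multiplex_of_agree (agreeOff_inl.2 (by rw [h]))]
      rfl
    · rw [if_neg h, onReg, multiplex_of_not_agree]
      · rfl
      · intro h'
        exact h (congrFun (agreeOff_inl.1 h') 0)

theorem controlled_diagonal_mulVec_pairState (ρ : QBasis V → ℂ) (c : Fin 2)
    (ψ₀ ψ₁ : QBasis V → ℂ) :
    mux (newQubit : V ⊕ Fin 1) (fun y => Matrix.diagonal fun b =>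
        if b = c then ρ (y ∘ Sum.inl) else 1) *ᵥ pairState ψ₀ ψ₁ =
      pairState (if 0 = c then Matrix.diagonal ρ *ᵥ ψ₀ else ψ₀)
        (if 1 = c then Matrix.diagonal ρ *ᵥ ψ₁ else ψ₁) := by
  rw [mux_diagonal]
  funext x
  rw [Matrix.mulVec_diagonal]
  rcases fin_two_cases (x newQubit) with hx | hx
  · simp only [pairState, hx, if_true]
    split_ifs
    · rw [Matrix.mulVec_diagonal]
    · rw [one_mul]
  · simp only [pairState, hx, if_neg (by decide : ¬ (1 : Fin 2) = 0)]
    split_ifs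
    · rw [Matrix.mulVec_diagonal]
    · rw [one_mul]

/-- Generalised quantum signal processing with a signal operator `W ⊕ W⁻¹`. -/
theorem exists_signalCircuit {W W' : QOp V} (h : W * W' = 1) (h' : W' * W = 1)
    {Λ : QOp (V ⊕ Fin 1)} {c : ℕ} (hΛ : Synth Λ c)
    (hW : ∀ ψ₀ ψ₁, Λ *ᵥ pairState ψ₀ ψ₁ = pairState (W *ᵥ ψ₀) (W' *ᵥ ψ₁)) {k : ℕ}
    {f g : Polynomial ℂ} (hfg : SignalReach k f g) :
    ∃ A : QOp (V ⊕ Fin 1), Synth A (k * (c + 1) + 1) ∧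
      ∀ v, A *ᵥ pairState v 0 = pairState ((W' ^ k * Polynomial.aeval (W * W) f) *ᵥ v)
        ((W' ^ k * Polynomial.aeval (W * W) g) *ᵥ v) := by
  induction hfg with
  | zero u hu =>
    refine ⟨_, (Synth.single newQubit hu).mono (by omega), fun v => ?_⟩
    rw [rotation_mulVec_pairState]
    simp [Algebra.algebraMap_eq_smul_one, Matrix.smul_mulVec]
  | @succ u hu k f g _ ih =>
    obtain ⟨A, hA, hAv⟩ := ih
    refine ⟨_, ((Synth.single newQubit hu).mul (hΛ.mul hA)).mono (by ring_nf; omega), fun v => ?_⟩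
    -- Once the common factor `W' ^ (k + 1)` is pulled out, the signal operator multiplies the first
    -- component by `W²` and fixes the second, as `X` does in `SignalReach`.
    have e1 : W * W' ^ k = W' ^ (k + 1) * (W * W) := by
      have hc : Commute W W' := h.trans h'.symm
      rw [pow_succ, Matrix.mul_assoc, ← Matrix.mul_assoc W', h', Matrix.one_mul,
        (hc.pow_right k).eq]
    rw [← Matrix.mulVec_mulVec, ← Matrix.mulVec_mulVec, hAv, hW, rotation_mulVec_pairState,
      Matrix.mulVec_mulVec, Matrix.mulVec_mulVec, ← Matrix.mul_assoc, ← Matrix.mul_assoc, e1,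
      ← pow_succ']
    simp only [map_add, map_mul, Polynomial.aeval_C, Polynomial.aeval_X,
      Algebra.algebraMap_eq_smul_one, Matrix.smul_mul, Matrix.one_mul, Matrix.mul_add,
      Matrix.mul_smul, Matrix.add_mulVec, Matrix.smul_mulVec, Matrix.mul_assoc]

theorem multiplex_diagonal {S S' : Type} [Fintype S] [DecidableEq S] [Fintype S'] [DecidableEq S']
    (f : S' ↪ S) (d : QBasis S → QBasis S' → ℂ) :
    multiplex f (fun y => Matrix.diagonal (d y)) = Matrix.diagonal fun y => d y (y ∘ f) := by
  ext x y
  by_cases h : AgreeOff f x y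
  · rw [multiplex_of_agree h]
    by_cases hxy : x ∘ f = y ∘ f
    · have := h.ext hxy
      subst this
      rw [Matrix.diagonal_apply_eq, Matrix.diagonal_apply_eq]
    · rw [Matrix.diagonal_apply_ne _ hxy, Matrix.diagonal_apply_ne]
      rintro rfl
      exact hxy rfl
  · rw [multiplex_of_not_agree h, Matrix.diagonal_apply_ne]
    rintro rfl
    exact h (AgreeOff.refl f x)

theorem aeval_mulVec_of_eigenvector {ι : Type} [Fintype ι] [DecidableEq ι] {M : Matrix ι ι ℂ}
    {v : ι → ℂ} {μ : ℂ} (h : M *ᵥ v = μ • v) (p : Polynomial ℂ) :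
    Polynomial.aeval M p *ᵥ v = p.eval μ • v := by
  induction p using Polynomial.induction_on' with
  | add p q hp hq => rw [map_add, Matrix.add_mulVec, hp, hq, Polynomial.eval_add, add_smul]
  | monomial n a =>
    rw [Polynomial.aeval_monomial, Polynomial.eval_monomial, Algebra.algebraMap_eq_smul_one,
      Matrix.smul_mul, Matrix.one_mul, Matrix.smul_mulVec, mul_smul]
    congr 1
    induction n with
    | zero => simp
    | succ n ih =>
      rw [pow_succ, ← Matrix.mulVec_mulVec, h, Matrix.mulVec_smul, ih, smul_smul, pow_succ']

/-- A polynomial of a diagonal operator which is a convex combination of signs. -/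
theorem exists_polynomialCircuit {ℓ : ℕ} (scr : Fin ℓ ↪ V) [Nonempty V]
    (wt : QBasis (Fin ℓ) → ℝ) (hwt : ∀ k, 0 ≤ wt k) (hwt1 : ∑ k, wt k = 1)
    (sg : QBasis V → QBasis (Fin ℓ) → ℝ) (hsg : ∀ y k, sg y k * sg y k = 1)
    (hind : IndepOf scr sg) {c : ℕ}
    (hsel : Synth (Matrix.diagonal fun y : QBasis V => ((sg y (y ∘ scr) : ℝ) : ℂ)) c)
    {P : Polynomial ℝ} (hP : ∀ e, P.coeff e ≠ 0 → e % 2 = P.natDegree % 2)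
    (hb : ∀ x ∈ Set.Icc (-1 : ℝ) 1, |P.eval x| < 1) :
    ∃ A : QOp (V ⊕ Fin 1), Synth A (P.natDegree * (60 * 2 ^ ℓ + c + 1) + 1) ∧
      ∀ y : QBasis V, y ∘ scr = 0 → ∀ x : QBasis (V ⊕ Fin 1), x newQubit = 0 →
        A x (Sum.elim y 0) =
          if x = Sum.elim y 0 then ((P.eval (∑ k, wt k * sg y k) : ℝ) : ℂ) else 0 := by
  obtain ⟨U, hU, hU0, hUs⟩ := exists_statePreparation ℓ (fun k => ((Real.sqrt (wt k) : ℝ) : ℂ)) (by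
    rw [← hwt1]
    refine Finset.sum_congr rfl fun k _ => ?_
    rw [Complex.norm_real, Real.norm_eq_abs, sq_abs, Real.sq_sqrt (hwt k)])
  have hU' := Matrix.mem_unitaryGroup_iff.1 hU
  have hU'' := Matrix.mem_unitaryGroup_iff'.1 hU
  rw [Matrix.star_eq_conjTranspose] at hU' hU''
  have hDD : ∀ y : QBasis V, Matrix.diagonal (fun k => ((sg y k : ℝ) : ℂ)) *
      Matrix.diagonal (fun k => ((sg y k : ℝ) : ℂ)) = 1 := by
    intro y
    rw [Matrix.diagonal_mul_diagonal, ← Matrix.diagonal_one]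
    congr 1
    funext k
    exact_mod_cast hsg y k
  have hindD : IndepOf scr fun y : QBasis V => Matrix.diagonal (fun k => ((sg y k : ℝ) : ℂ)) :=
    hind.comp fun s => Matrix.diagonal (fun k => ((s k : ℝ) : ℂ))
  -- `R` and `T` are involutions, so `R T` and `T R` are mutually inverse; the zero block of `T` is
  -- the weighted mean of the signs.
  obtain ⟨R, hR⟩ : ∃ R, R = fun y : QBasis V => if y ∘ scr = 0 then (1 : ℂ) else -1 := ⟨_, rfl⟩
  obtain ⟨T, hT⟩ : ∃ T, T = multiplex scr
    (fun y => Uᴴ * (Matrix.diagonal (fun k => ((sg y k : ℝ) : ℂ)) * U)) := ⟨_, rfl⟩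
  have hTs : Synth T (15 * 2 ^ ℓ + (c + 15 * 2 ^ ℓ)) := by
    have h1 := (hUs V scr)
    have h2 := h1.conjTranspose.mul (hsel.mul h1)
    rw [onReg, multiplex_conjTranspose _ (IndepOf.const _ _), ← multiplex_diagonal scr
      (fun y k => ((sg y k : ℝ) : ℂ)), multiplex_mul _ _ hindD,
      multiplex_mul _ _ (IndepOf.const _ _)] at h2
    rw [hT]
    exact h2
  have hTT : T * T = 1 := by
    rw [hT, multiplex_mul _ _ (hindD.comp fun D => Uᴴ * (D * U)), ← multiplex_one scr]
    congr 1
    funext y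
    calc Uᴴ * (Matrix.diagonal (fun k => ((sg y k : ℝ) : ℂ)) * U) *
          (Uᴴ * (Matrix.diagonal (fun k => ((sg y k : ℝ) : ℂ)) * U)) =
          Uᴴ * (Matrix.diagonal (fun k => ((sg y k : ℝ) : ℂ)) * (U * Uᴴ) *
            Matrix.diagonal (fun k => ((sg y k : ℝ) : ℂ))) * U := by
          simp only [Matrix.mul_assoc]
      _ = 1 := by rw [hU', Matrix.mul_one, hDD, Matrix.mul_one, hU'']
  have hRR : Matrix.diagonal R * Matrix.diagonal R = 1 := by
    rw [Matrix.diagonal_mul_diagonal, ← Matrix.diagonal_one, hR]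
    congr 1
    funext y
    simp only
    split_ifs <;> norm_num
  have hWW : Matrix.diagonal R * T * (T * Matrix.diagonal R) = 1 := by
    rw [Matrix.mul_assoc, ← Matrix.mul_assoc T, hTT, Matrix.one_mul, hRR]
  have hWW' : T * Matrix.diagonal R * (Matrix.diagonal R * T) = 1 := by
    rw [Matrix.mul_assoc, ← Matrix.mul_assoc _ _ T, hRR, Matrix.one_mul, hTT]
  have hcR : ∀ b : Fin 2, Synth (mux (newQubit : V ⊕ Fin 1) (fun y => Matrix.diagonal fun b' =>
        if b' = b then R (y ∘ Sum.inl) else 1)) (15 * 2 ^ ℓ) := by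
    intro b
    refine (synth_mux (K := Finset.univ.map (scr.trans Function.Embedding.inl)) (by simp) ?_
      fun y => ?_).mono (by simp)
    · intro x y hxy
      have : (x ∘ Sum.inl) ∘ scr = (y ∘ Sum.inl) ∘ scr :=
        funext fun i => hxy (Sum.inl (scr i)) (by simp)
      simp only [hR, this]
    · rw [Matrix.mem_unitaryGroup_iff, Matrix.star_eq_conjTranspose, Matrix.diagonal_conjTranspose,
        Matrix.diagonal_mul_diagonal, ← Matrix.diagonal_one]
      congr 1
      funext b'
      rw [hR]
      simp only [Pi.star_apply]
      split_ifs <;> simp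
  obtain ⟨g, hg⟩ := exists_signalReach hP hb
  -- `R` controlled on `0` after `T` and `R` controlled on `1` before it give `R T` in one branch
  -- and `T R` in the other, with a single uncontrolled `T`.
  obtain ⟨A, hA, hAv⟩ := exists_signalCircuit hWW hWW'
    ((hcR 0).mul ((hTs.onReg Function.Embedding.inl).mul (hcR 1))) (fun ψ₀ ψ₁ => by
      rw [← Matrix.mulVec_mulVec, ← Matrix.mulVec_mulVec, controlled_diagonal_mulVec_pairState,
        onReg_inl_mulVec_pairState, controlled_diagonal_mulVec_pairState]
      simp [Matrix.mulVec_mulVec]) hg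
  refine ⟨A, hA.mono ?_, fun y hy x hx => ?_⟩
  · refine Nat.add_le_add_right (Nat.mul_le_mul_left _ ?_) 1
    omega
  have hcol : A x (Sum.elim y 0) = (A *ᵥ pairState (Pi.single y 1) 0) x := by
    have : pairState (Pi.single y 1) 0 = Pi.single (Sum.elim y (0 : QBasis (Fin 1))) (1 : ℂ) := by
      funext x
      rw [qbasis_eq_elim x]
      rcases fin_two_cases (x newQubit) with h0 | h0
      · rw [h0]
        by_cases h1 : x ∘ Sum.inl = y
        · subst h1
          simp [pairState]
          exact (Pi.single_eq_same (M := fun _ => ℂ) (Sum.elim (x ∘ Sum.inl) 0 : QBasis (V ⊕ Fin 1)) 1).symm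
        · rw [Pi.single_eq_of_ne]
          · simp [pairState, Pi.single_eq_of_ne h1]
          · intro h2
            exact h1 (funext fun s => congrFun h2 (Sum.inl s))
      · rw [h0, Pi.single_eq_of_ne]
        · simp [pairState]
        · intro h2
          exact absurd (congrFun h2 newQubit) (by simp)
    rw [this, Matrix.mulVec_single_one, Matrix.col_apply]
  -- The anticommutator cancels the part of `T` that leaves the zero scratch space, so every basis
  -- state in that space is an exact eigenvector.
  have hev : ((1 / 2 : ℂ) • (Matrix.diagonal R * T + T * Matrix.diagonal R)) *ᵥ Pi.single y 1 =
      (((∑ k, wt k * sg y k : ℝ)) : ℂ) • Pi.single y (1 : ℂ) := by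
    funext x
    rw [Matrix.mulVec_single_one, Matrix.col_apply, Matrix.smul_apply, Matrix.add_apply,
      Matrix.diagonal_mul, Matrix.mul_diagonal, Pi.smul_apply]
    have hRy : R y = 1 := by simp [hR, hy]
    rw [hRy]
    by_cases hxs : x ∘ scr = 0
    · have hRx : R x = 1 := by simp [hR, hxs]
      rw [hRx]
      by_cases hxy : AgreeOff scr x y
      · have := hxy.ext (hxs.trans hy.symm)
        subst this
        rw [Pi.single_eq_same, hT, multiplex_of_agree hxy, hy, Matrix.mul_apply]
        simp only [Matrix.diagonal_mul, Matrix.conjTranspose_apply, hU0, smul_eq_mul]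
        push_cast
        rw [mul_one, one_mul, mul_one, ← two_mul, ← mul_assoc, one_div,
          inv_mul_cancel₀ two_ne_zero, one_mul]
        refine Finset.sum_congr rfl fun k _ => ?_
        rw [show star ((Real.sqrt (wt k) : ℝ) : ℂ) = ((Real.sqrt (wt k) : ℝ) : ℂ) from
          Complex.conj_ofReal _, mul_left_comm, ← Complex.ofReal_mul, Real.mul_self_sqrt (hwt k),
          mul_comm]
      · rw [hT, multiplex_of_not_agree hxy, Pi.single_eq_of_ne]
        · simp
        · rintro rfl
          exact hxy (AgreeOff.refl _ _)
    · have hRx : R x = -1 := by simp [hR, hxs]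
      rw [hRx, Pi.single_eq_of_ne]
      · simp
      · rintro rfl
        exact hxs hy
  have hmat : (T * Matrix.diagonal R) ^ P.natDegree *
      Polynomial.aeval (Matrix.diagonal R * T * (Matrix.diagonal R * T)) (signalPoly P) =
      Polynomial.aeval ((1 / 2 : ℂ) • (Matrix.diagonal R * T + T * Matrix.diagonal R))
        (P.map Complex.ofRealHom) := by
    rw [aeval_signalPoly hP hWW hWW', ← mul_assoc, ← Commute.mul_pow (hWW'.trans hWW.symm), hWW',
      one_pow, one_mul]
  rw [hcol, hAv, hmat, aeval_mulVec_of_eigenvector hev, pairState, if_pos hx, Polynomial.eval_map,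
    ← Complex.ofRealHom_eq_coe, Polynomial.eval₂_at_apply, Pi.smul_apply]
  by_cases hxy : x = Sum.elim y 0
  · subst hxy
    rw [if_pos rfl, Sum.elim_comp_inl, Pi.single_eq_same]
    simp
  · rw [if_neg hxy, Pi.single_eq_of_ne, smul_zero]
    rintro rfl
    refine hxy ?_
    conv_lhs => rw [qbasis_eq_elim x, hx]
    rfl

end SignalCircuit

/-! ## Polynomials of the coordinate -/

section CoordinateCircuit

/-- The weights of a grid coordinate as a convex combination of `1`, `-1` and the signs of the
binary digits. -/
noncomputable def gridWeight (g : ModeGrid) : ℕ → ℝ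
  | 0 => (1 + g.a) / 2
  | 1 => (1 - g.b) / 2
  | j + 2 => if j < g.n then g.Δx * 2 ^ j / 2 else 0

/-- The signs of a grid coordinate with the given binary digits. -/
def gridSign {n : ℕ} (bits : QBasis (Fin n)) : ℕ → ℝ
  | 0 => 1
  | 1 => -1
  | j + 2 => if h : j < n then (if bits ⟨j, h⟩ = 1 then 1 else -1) else 1

theorem ModeGrid.two_pow_sub_one_pos (g : ModeGrid) : (0 : ℝ) < 2 ^ g.n - 1 :=
  sub_pos.2 (one_lt_pow₀ one_lt_two g.n_pos.ne')

theorem ModeGrid.Δx_pos (g : ModeGrid) : 0 < g.Δx :=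
  div_pos (sub_pos.2 g.a_lt_b) g.two_pow_sub_one_pos

theorem ModeGrid.Δx_mul (g : ModeGrid) : g.Δx * (2 ^ g.n - 1) = g.b - g.a :=
  div_mul_cancel₀ _ g.two_pow_sub_one_pos.ne'

theorem gridWeight_nonneg (g : ModeGrid) (k : ℕ) : 0 ≤ gridWeight g k := by
  have h1 := g.neg_one_le_a
  have h2 := g.b_le_one
  have h3 := g.Δx_pos
  match k with
  | 0 => simp only [gridWeight]; linarith
  | 1 => simp only [gridWeight]; linarith
  | j + 2 => simp only [gridWeight]; split_ifs <;> positivity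

theorem gridSign_mul_self {n : ℕ} (bits : QBasis (Fin n)) (k : ℕ) :
    gridSign bits k * gridSign bits k = 1 := by
  match k with
  | 0 => simp [gridSign]
  | 1 => simp [gridSign]
  | j + 2 => simp only [gridSign]; split_ifs <;> norm_num

theorem sum_qbasis_range {ℓ : ℕ} (F : ℕ → ℝ) :
    ∑ k : QBasis (Fin ℓ), F (finFunctionFinEquiv k : Fin (2 ^ ℓ)) =
      ∑ k ∈ Finset.range (2 ^ ℓ), F k := by
  rw [Finset.sum_range]
  exact Fintype.sum_equiv finFunctionFinEquiv _ _ fun _ => rfl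

theorem sum_gridWeight_mul (g : ModeGrid) {ℓ : ℕ} (hℓ : g.n + 2 ≤ 2 ^ ℓ) (F : ℕ → ℝ) :
    ∑ k ∈ Finset.range (2 ^ ℓ), gridWeight g k * F k =
      (1 + g.a) / 2 * F 0 + (1 - g.b) / 2 * F 1 +
        ∑ j : Fin g.n, g.Δx * 2 ^ (j : ℕ) / 2 * F (j + 2) := by
  rw [← Finset.sum_subset (Finset.range_subset_range.2 hℓ), Finset.sum_range_succ',
    Finset.sum_range_succ', Finset.sum_range]
  · simp only [gridWeight, Fin.is_lt, if_true]
    ring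
  · intro k _ hk
    obtain ⟨j, rfl⟩ : ∃ j, k = j + 2 := ⟨k - 2, by rw [Finset.mem_range] at hk; omega⟩
    rw [Finset.mem_range] at hk
    rw [gridWeight, if_neg (by omega), zero_mul]

theorem sum_gridWeight (g : ModeGrid) {ℓ : ℕ} (hℓ : g.n + 2 ≤ 2 ^ ℓ) :
    ∑ k : QBasis (Fin ℓ), gridWeight g (finFunctionFinEquiv k : Fin (2 ^ ℓ)) = 1 := by
  have h := sum_gridWeight_mul g hℓ fun _ => 1
  simp only [mul_one] at h
  rw [sum_qbasis_range, h, ← Finset.sum_div, ← Finset.mul_sum, Fin.sum_univ_eq_sum_range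
    (fun j => (2 : ℝ) ^ j), geom_sum_eq (by norm_num)]
  have := g.Δx_mul
  norm_num
  linarith

theorem sum_gridWeight_mul_gridSign (g : ModeGrid) {ℓ : ℕ} (hℓ : g.n + 2 ≤ 2 ^ ℓ)
    (bits : QBasis (Fin g.n)) :
    ∑ k : QBasis (Fin ℓ), gridWeight g (finFunctionFinEquiv k : Fin (2 ^ ℓ)) *
      gridSign bits (finFunctionFinEquiv k : Fin (2 ^ ℓ)) =
      g.point (finFunctionFinEquiv bits) := by
  have h1 := sum_qbasis_range (ℓ := ℓ) fun k => gridWeight g k * gridSign bits k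
  rw [h1, sum_gridWeight_mul g hℓ, ModeGrid.point, finFunctionFinEquiv_apply]
  have h2 : ∀ j : Fin g.n, g.Δx * 2 ^ (j : ℕ) / 2 * gridSign bits (j + 2) =
      ((bits j : ℕ) : ℝ) * 2 ^ (j : ℕ) * g.Δx - g.Δx / 2 * 2 ^ (j : ℕ) := by
    intro j
    rw [gridSign, dif_pos j.2]
    rcases fin_two_cases (bits j) with h | h
    · rw [h, if_neg (by decide)]
      simp
      ring
    · rw [h, if_pos rfl]
      simp
      ring
  simp only [h2]
  rw [gridSign, gridSign, Finset.sum_sub_distrib, ← Finset.mul_sum, Fin.sum_univ_eq_sum_range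
    (fun j => (2 : ℝ) ^ j), geom_sum_eq (by norm_num), ← Finset.sum_mul]
  have := g.Δx_mul
  push_cast
  norm_num
  linarith

/-- The selected sign becomes a product of `n + 1` signs, each a function of the selector and at
most one digit, hence a cheap uniformly controlled gate. -/
theorem gridSign_eq_prod {n : ℕ} (bits : QBasis (Fin n)) (k : ℕ) :
    gridSign bits k = (if k = 1 then -1 else 1) *
      ∏ b : Fin n, (if k = b + 2 ∧ bits b = 0 then -1 else 1) := by
  match k with
  | 0 => simp [gridSign]
  | 1 => simp [gridSign]
  | j + 2 =>
    rw [gridSign, if_neg (by omega), one_mul]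
    split_ifs with h h'
    · rw [Finset.prod_eq_one]
      intro b _
      rw [if_neg]
      rintro ⟨hb, hb'⟩
      obtain rfl : b = ⟨j, h⟩ := Fin.ext (by simp only; omega)
      rw [h'] at hb'
      exact absurd hb' (by decide)
    · rw [Finset.prod_eq_single (⟨j, h⟩ : Fin n)]
      · rw [if_pos ⟨rfl, (fin_two_cases _).resolve_right h'⟩]
      · intro b _ hb
        rw [if_neg]
        rintro ⟨hb', _⟩
        exact hb (Fin.ext (by simp only; omega))
      · simp
    · rw [Finset.prod_eq_one]
      intro b _
      rw [if_neg]
      rintro ⟨hb, _⟩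
      omega

theorem synth_diagonal_prod {V ι : Type} [Fintype V] [DecidableEq V] (s : Finset ι)
    (D : ι → QBasis V → ℂ) {c : ℕ} (h : ∀ i ∈ s, Synth (Matrix.diagonal (D i)) c) :
    Synth (Matrix.diagonal fun y => ∏ i ∈ s, D i y) (s.card * c) := by
  classical
  induction s using Finset.induction_on with
  | empty => simpa using Synth.one
  | @insert i s hi ih =>
    have := (h i (Finset.mem_insert_self _ _)).mul
      (ih fun j hj => h j (Finset.mem_insert_of_mem hj))
    rw [Matrix.diagonal_mul_diagonal] at this
    simp only [Finset.prod_insert hi, Finset.card_insert_of_notMem hi]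
    exact this.mono (le_of_eq (by ring))

/-- A diagonal sign depending on `K` and `t` is a diagonal one-qubit gate on `t` multiplexed over
`K`. -/
theorem synth_sign {V : Type} [Fintype V] [DecidableEq V] {t : V} {K : Finset V} (ht : t ∉ K)
    (p : QBasis V → Prop) [DecidablePred p] (hp : DependsOnBits (insert t K) p) :
    Synth (Matrix.diagonal fun y => if p y then (-1 : ℂ) else 1) (15 * 2 ^ K.card) := by
  have hd := mux_diagonal t fun (y : QBasis V) b => if p (Function.update y t b) then (-1 : ℂ) else 1
  simp only [Function.update_eq_self] at hd
  rw [← hd]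
  refine synth_mux ht (fun x y h => ?_) fun y => ?_
  · congr 1
    funext b
    refine if_congr (iff_of_eq (hp _ _ fun s hs => ?_)) rfl rfl
    by_cases hst : s = t
    · subst hst
      simp
    · rw [Function.update_of_ne hst, Function.update_of_ne hst]
      exact h s ((Finset.mem_insert.1 hs).resolve_left hst)
  · rw [Matrix.mem_unitaryGroup_iff, Matrix.star_eq_conjTranspose, Matrix.diagonal_conjTranspose,
      Matrix.diagonal_mul_diagonal, ← Matrix.diagonal_one]
    congr 1
    funext b
    rw [Pi.star_apply]
    split_ifs <;> simp

theorem synth_gridSign {n ℓ : ℕ} (hn : 0 < n) :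
    Synth (Matrix.diagonal fun y : QBasis (Fin ℓ ⊕ Fin n) =>
      ((gridSign (y ∘ Sum.inr) (finFunctionFinEquiv (y ∘ Sum.inl) : Fin (2 ^ ℓ)) : ℝ) : ℂ))
      ((n + 1) * (15 * 2 ^ ℓ)) := by
  have hK : ∀ b : Fin n, (Sum.inr b : Fin ℓ ⊕ Fin n) ∉
      (Finset.univ.map Function.Embedding.inl : Finset (Fin ℓ ⊕ Fin n)) := by simp
  have hdep : ∀ (b : Fin n) {x y : QBasis (Fin ℓ ⊕ Fin n)},
      (∀ s ∈ insert (Sum.inr b) (Finset.univ.map Function.Embedding.inl), x s = y s) →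
        x ∘ Sum.inl = y ∘ Sum.inl := fun b x y h => funext fun i => h (Sum.inl i) (by simp)
  have h1 := synth_sign (hK ⟨0, hn⟩)
    (fun y => ((finFunctionFinEquiv (y ∘ Sum.inl) : Fin (2 ^ ℓ)) : ℕ) = 1) fun x y h => by
      simp only [hdep _ h]
  have h2 := synth_diagonal_prod Finset.univ _ fun (b : Fin n) _ => synth_sign (hK b)
    (fun y => ((finFunctionFinEquiv (y ∘ Sum.inl) : Fin (2 ^ ℓ)) : ℕ) = b + 2 ∧ y (Sum.inr b) = 0)
    fun x y h => by
      simp only [hdep _ h, h (Sum.inr b) (by simp)]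
  have h3 := h1.mul h2
  rw [Matrix.diagonal_mul_diagonal] at h3
  refine Synth.mono ?_ (le_of_eq ?_) (c := 15 * 2 ^ ℓ + n * (15 * 2 ^ ℓ))
  · rw [Finset.card_map, Finset.card_univ, Finset.card_univ, Fintype.card_fin,
      Fintype.card_fin] at h3
    refine Eq.subst (motive := fun A => Synth A _) ?_ h3
    refine congrArg Matrix.diagonal (funext fun y => ?_)
    rw [gridSign_eq_prod]
    push_cast [apply_ite]
    rfl
  · ring

/-- `A` multiplies by `P` of the grid point in the column register while the scratch register and
the flag are zero. -/
def IsCoordinateCircuit (g : ModeGrid) (P : Polynomial ℝ) {ℓ : ℕ}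
    (A : QOp ((Fin ℓ ⊕ Fin g.n) ⊕ Fin 1)) : Prop :=
  ∀ y : QBasis (Fin ℓ ⊕ Fin g.n), y ∘ Sum.inl = 0 → ∀ x, x newQubit = 0 →
    A x (Sum.elim y 0) = if x = Sum.elim y 0 then
      ((P.eval (g.point (finFunctionFinEquiv (y ∘ Sum.inr))) : ℝ) : ℂ) else 0

theorem exists_coordinateCircuit_of_signalProcessing (g : ModeGrid) {P : Polynomial ℝ}
    (hP : ∀ e, P.coeff e ≠ 0 → e % 2 = P.natDegree % 2)
    (hb : ∀ x ∈ Set.Icc (-1 : ℝ) 1, |P.eval x| < 1) {ℓ : ℕ} (hℓ : g.n + 2 ≤ 2 ^ ℓ)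
    (hℓ' : 2 ^ ℓ ≤ 6 * g.n) :
    ∃ A : QOp ((Fin ℓ ⊕ Fin g.n) ⊕ Fin 1), Synth A (541 * (P.natDegree * g.n ^ 2) + 1) ∧
      IsCoordinateCircuit g P A := by
  have : Nonempty (Fin ℓ ⊕ Fin g.n) := ⟨Sum.inr ⟨0, g.n_pos⟩⟩
  obtain ⟨A, hA, hAy⟩ := exists_polynomialCircuit
    (Function.Embedding.inl : Fin ℓ ↪ Fin ℓ ⊕ Fin g.n)
    (fun k => gridWeight g (finFunctionFinEquiv k : Fin (2 ^ ℓ))) (fun k => gridWeight_nonneg g _)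
    (sum_gridWeight g hℓ)
    (fun y k => gridSign (y ∘ Sum.inr) (finFunctionFinEquiv k : Fin (2 ^ ℓ)))
    (fun y k => gridSign_mul_self _ _)
    (fun x y h => by
      have : x ∘ Sum.inr = y ∘ Sum.inr := funext fun i => h (Sum.inr i) (by simp)
      simp only [this])
    (synth_gridSign g.n_pos) hP hb
  refine ⟨A, hA.mono ?_, fun y hy x hx => ?_⟩
  · have hn := g.n_pos
    -- With `2 ^ ℓ ≤ 6 n` the left side is at most `360 n + 90 n (n + 1) + 1`, and `360 + 90 + 90 +
    -- 1 = 541`.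
    have h : 60 * 2 ^ ℓ + (g.n + 1) * (15 * 2 ^ ℓ) + 1 ≤ 541 * g.n ^ 2 := by nlinarith
    calc _ ≤ P.natDegree * (541 * g.n ^ 2) + 1 :=
          Nat.add_le_add_right (Nat.mul_le_mul_left _ h) 1
      _ = _ := by ring
  · rw [hAy y hy x hx, sum_gridWeight_mul_gridSign g hℓ]

theorem rotation_mem_unitaryGroup {p : ℝ} (hp : |p| < 1) :
    !![(p : ℂ), -(Real.sqrt (1 - p ^ 2) : ℝ); (Real.sqrt (1 - p ^ 2) : ℝ), (p : ℂ)] ∈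
      Matrix.unitaryGroup (Fin 2) ℂ := by
  have h : (p : ℂ) * p + (Real.sqrt (1 - p ^ 2) : ℝ) * (Real.sqrt (1 - p ^ 2) : ℝ) = 1 := by
    rw [← Complex.ofReal_mul, ← Complex.ofReal_mul, Real.mul_self_sqrt, ← Complex.ofReal_add]
    · norm_num [sq]
    · nlinarith [abs_lt.1 hp]
  rw [Matrix.mem_unitaryGroup_iff, Matrix.star_eq_conjTranspose]
  ext a b
  fin_cases a <;> fin_cases b <;>
    simp [Matrix.mul_apply, Fin.sum_univ_two, Matrix.conjTranspose_apply]
  · exact h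
  · ring
  · ring
  · rw [add_comm]; exact h

/-- The fallback without scratch qubits: one rotation of the flag, tabulated over all grid points.
Its exponential price is acceptable only on small grids. -/
theorem exists_coordinateCircuit_of_rotations (g : ModeGrid) {P : Polynomial ℝ}
    (hb : ∀ i, |P.eval (g.point i)| < 1) :
    ∃ A : QOp ((Fin 0 ⊕ Fin g.n) ⊕ Fin 1), Synth A (15 * 2 ^ g.n) ∧
      IsCoordinateCircuit g P A := by
  refine ⟨mux newQubit fun y =>
    !![((P.eval (g.point (finFunctionFinEquiv (y ∘ Sum.inl ∘ Sum.inr))) : ℝ) : ℂ),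
      -(Real.sqrt (1 - (P.eval (g.point (finFunctionFinEquiv (y ∘ Sum.inl ∘ Sum.inr)))) ^ 2) : ℝ);
      (Real.sqrt (1 - (P.eval (g.point (finFunctionFinEquiv (y ∘ Sum.inl ∘ Sum.inr)))) ^ 2) : ℝ),
      ((P.eval (g.point (finFunctionFinEquiv (y ∘ Sum.inl ∘ Sum.inr))) : ℝ) : ℂ)], ?_, ?_⟩
  · refine (synth_mux (K := Finset.univ.map
      ((Function.Embedding.inr : Fin g.n ↪ Fin 0 ⊕ Fin g.n).trans Function.Embedding.inl))
      (by simp) (fun x y h => ?_) fun y => rotation_mem_unitaryGroup (hb _)).mono (by simp)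
    have : x ∘ Sum.inl ∘ Sum.inr = y ∘ Sum.inl ∘ Sum.inr :=
      funext fun i => h (Sum.inl (Sum.inr i)) (by simp)
    simp only [this]
  · intro y _ x hx
    by_cases h : x = Sum.elim y 0
    · subst h
      rw [if_pos rfl, mux_of_agree fun _ _ => rfl]
      simp [newQubit, ← Function.comp_assoc]
    · rw [if_neg h, mux_of_not_agree]
      intro h'
      refine h (funext fun s => ?_)
      by_cases hs : s = newQubit
      · rw [hs, hx]
        rfl
      · exact h' s hs

theorem ModeGrid.point_mem (g : ModeGrid) (i : Fin (2 ^ g.n)) : g.point i ∈ Set.Icc (-1 : ℝ) 1 := by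
  have h1 := g.neg_one_le_a
  have h2 := g.b_le_one
  have h3 := g.Δx_pos
  have h4 := g.Δx_mul
  have h5 : ((i : ℕ) : ℝ) + 1 ≤ 2 ^ g.n := by exact_mod_cast i.2
  constructor
  · rw [ModeGrid.point]
    have : 0 ≤ ((i : ℕ) : ℝ) * g.Δx := by positivity
    linarith
  · rw [ModeGrid.point]
    nlinarith

/-- Multiplication by `P` of the coordinate, with a scratch register of at most `n - w` qubits. -/
theorem exists_coordinateCircuit (g : ModeGrid) {P : Polynomial ℝ}
    (hP : ∀ e, P.coeff e ≠ 0 → e % 2 = P.natDegree % 2)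
    (hb : ∀ x ∈ Set.Icc (-1 : ℝ) 1, |P.eval x| < 1) {w : ℕ} (hw : w ≤ g.n) :
    ∃ ℓ, w + ℓ ≤ g.n ∧ ∃ A : QOp ((Fin ℓ ⊕ Fin g.n) ⊕ Fin 1),
      Synth A (541 * (P.natDegree * g.n ^ 2) + 1 + 90 * (2 ^ w * g.n)) ∧
        IsCoordinateCircuit g P A := by
  have hn := g.n_pos
  have h1 : g.n + 2 ≤ 2 ^ Nat.clog 2 (g.n + 2) := Nat.le_pow_clog one_lt_two _
  have h2 : 2 ^ Nat.clog 2 (g.n + 2) ≤ 6 * g.n := by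
    have h3 := Nat.pow_pred_clog_lt_self one_lt_two (x := g.n + 2) (by omega)
    have h4 : 0 < Nat.clog 2 (g.n + 2) := Nat.clog_pos one_lt_two (by omega)
    rw [← Nat.succ_pred_eq_of_pos h4, pow_succ]
    omega
  by_cases h : w + Nat.clog 2 (g.n + 2) ≤ g.n
  · obtain ⟨A, hA, hA'⟩ := exists_coordinateCircuit_of_signalProcessing g hP hb h1 h2
    exact ⟨_, h, A, hA.mono (by omega), hA'⟩
  · obtain ⟨A, hA, hA'⟩ := exists_coordinateCircuit_of_rotations g fun i => hb _ (g.point_mem i)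
    refine ⟨0, hw, A, hA.mono ?_, hA'⟩
    -- Lack of room for the scratch register means that `n` is below `w` plus a logarithm, so `15 *
    -- 2 ^ n` is at most `90 * 2 ^ w * n`.
    have h3 : 2 ^ g.n ≤ 2 ^ w * 2 ^ Nat.clog 2 (g.n + 2) := by
      rw [← pow_add]
      exact Nat.pow_le_pow_right two_pos (by omega)
    have h4 := Nat.mul_le_mul_left (2 ^ w) h2
    nlinarith

end CoordinateCircuit

/-! ## Block encodings of the tensor factors -/

section Momentum

theorem intCast_fin_sub {N : ℕ} (i j : Fin (2 ^ N)) :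
    (((i - j : Fin (2 ^ N)) : ℕ) : ℤ) ≡ (i : ℕ) - (j : ℕ) [ZMOD 2 ^ N] := by
  have hj := j.2.le
  rw [Fin.val_sub, Int.natCast_mod, Nat.cast_add, Nat.cast_sub hj]
  refine (Int.mod_modEq _ _).trans ?_
  push_cast
  refine Int.modEq_iff_dvd.2 ⟨-1, by ring⟩

theorem intCast_fin_injective {N : ℕ} {i j : Fin (2 ^ N)}
    (h : ((i : ℕ) : ℤ) ≡ (j : ℕ) [ZMOD 2 ^ N]) : i = j := by
  have h' : (i : ℕ) ≡ j [MOD 2 ^ N] := by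
    rw [← Int.natCast_modEq_iff]
    exact_mod_cast h
  exact Fin.ext (h'.eq_of_lt_of_lt i.2 j.2)

/-- A power of the momentum is a circulant matrix supported in a window. -/
theorem exists_momentum_pow_eq_circulant (g : ModeGrid) (m : ℕ) :
    ∃ κ : Fin (2 ^ g.n) → ℂ, g.momentum ^ m = Matrix.circulant κ ∧
      ∀ d, κ d ≠ 0 → ∃ t : ℤ, |t| ≤ (g.radius * m : ℕ) ∧ ((d : ℕ) : ℤ) ≡ t [ZMOD 2 ^ g.n] := by
  induction m with
  | zero =>
    refine ⟨Pi.single 0 1, ?_, fun d hd => ⟨0, by simp, ?_⟩⟩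
    · rw [pow_zero, Matrix.circulant_single_one]
    · have : d = 0 := by
        by_contra h
        exact hd (Pi.single_eq_of_ne h _)
      rw [this]
      rfl
  | succ m ih =>
    obtain ⟨κ, hκ, hs⟩ := ih
    -- `Matrix.circulant` reads its vector at `i - j`, whereas the stencil is indexed by `j - i`;
    -- hence the reversed sign of `t`.
    obtain ⟨μ, hμ⟩ : ∃ μ : Fin (2 ^ g.n) → ℂ, μ = fun d : Fin (2 ^ g.n) =>
      ∑ t ∈ Finset.Icc (-(g.radius : ℤ)) g.radius,
        if (0 : ℤ) ≡ ((d : ℕ) : ℤ) + t [ZMOD 2 ^ g.n] then g.stencil t else 0 := ⟨_, rfl⟩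
    have hM : g.momentum = Matrix.circulant μ := by
      ext i j
      rw [Matrix.circulant_apply, hμ, ModeGrid.momentum]
      refine Finset.sum_congr rfl fun t _ => if_congr ?_ rfl rfl
      have h := intCast_fin_sub i j
      constructor
      · intro h'
        refine (Int.ModEq.trans ?_ ((h.add_right t).symm))
        have := h'.sub_right ((j : ℕ) : ℤ)
        rw [sub_self] at this
        convert this using 1
        ring
      · intro h'
        have := (h'.trans (h.add_right t)).add_right ((j : ℕ) : ℤ)
        rw [zero_add] at this
        convert this using 1
        ring
    refine ⟨Matrix.circulant κ *ᵥ μ, ?_, fun d hd => ?_⟩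
    · rw [pow_succ, hκ, hM, Matrix.circulant_mul]
    · rw [Matrix.mulVec, dotProduct] at hd
      obtain ⟨e, _, he⟩ := Finset.exists_ne_zero_of_sum_ne_zero hd
      have h1 := left_ne_zero_of_mul he
      have h2 := right_ne_zero_of_mul he
      rw [Matrix.circulant_apply] at h1
      obtain ⟨t, ht, htd⟩ := hs _ h1
      rw [hμ] at h2
      obtain ⟨u, hu, hu'⟩ := Finset.exists_ne_zero_of_sum_ne_zero h2
      rw [Finset.mem_Icc] at hu
      have hu'' : (0 : ℤ) ≡ ((e : ℕ) : ℤ) + u [ZMOD 2 ^ g.n] := by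
        by_contra h
        exact hu' (if_neg h)
      refine ⟨t + -u, ?_, ?_⟩
      · refine (abs_add_le _ _).trans ?_
        rw [abs_neg, Nat.mul_succ, Nat.cast_add]
        exact add_le_add ht (abs_le.2 hu)
      · have h3 := (htd.symm.trans (intCast_fin_sub d e)).add_right ((e : ℕ) : ℤ)
        have h4 := (hu''.sub_right u).symm
        rw [add_sub_cancel_right, zero_sub] at h4
        rw [sub_add_cancel] at h3
        exact h3.symm.trans (h4.add_left t)

/-- The first row is `κ` reversed, with `sparsity` non-zero entries, each of squared modulus at most
`Np`. This is why the normalised stencil has norm at most one. -/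
theorem sum_norm_sq_circulant_le (g : ModeGrid) (m : ℕ) {κ : Fin (2 ^ g.n) → ℂ}
    (hκ : g.momentum ^ m = Matrix.circulant κ) {Np : ℝ} (hpos : 0 < Np)
    (hN : ∀ i j, ‖(g.momentum ^ m) i j‖ ^ 2 ≤ Np) :
    ∑ d, ‖κ d‖ ^ 2 ≤ 2 ^ g.logSparsity m * Np := by
  classical
  have h1 : ∑ d, ‖κ d‖ ^ 2 =
      ∑ j, ‖(g.momentum ^ m) ⟨0, Nat.two_pow_pos g.n⟩ j‖ ^ 2 := by
    refine Fintype.sum_equiv (Equiv.neg _) _ _ fun d => ?_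
    rw [hκ, Matrix.circulant_apply]
    congr 3
    rw [Equiv.neg_apply, sub_neg_eq_add]
    exact (zero_add d).symm
  have h2 : ((g.sparsity m : ℕ) : ℝ) ≤ 2 ^ g.logSparsity m := by
    exact_mod_cast Nat.le_pow_clog one_lt_two (g.sparsity m)
  rw [h1]
  refine le_trans ?_ (mul_le_mul_of_nonneg_right h2 hpos.le)
  rw [ModeGrid.sparsity, ← nsmul_eq_mul, ← Finset.sum_const, Finset.sum_filter]
  refine Finset.sum_le_sum fun j _ => ?_
  split_ifs with h
  · exact hN _ _
  · rw [not_not.1 h]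
    simp

theorem coordinatePoly_eq_diagonal (g : ModeGrid) (P : Polynomial ℝ) :
    g.coordinatePoly P = Matrix.diagonal fun i => ((P.eval (g.point i) : ℝ) : ℂ) := by
  have h := Polynomial.aeval_algHom_apply
    (Matrix.diagonalAlgHom ℝ : (Fin (2 ^ g.n) → ℂ) →ₐ[ℝ] _)
    (fun i => ((g.point i : ℝ) : ℂ)) P
  rw [ModeGrid.coordinatePoly]
  refine h.trans ?_
  rw [Matrix.diagonalAlgHom_apply]
  congr 1
  funext i
  have h2 := Polynomial.aeval_algHom_apply (Pi.evalAlgHom ℝ (fun _ : Fin (2 ^ g.n) => ℂ) i)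
    (fun i => ((g.point i : ℝ) : ℂ)) P
  refine h2.symm.trans ?_
  exact Polynomial.aeval_algebraMap_apply_eq_algebraMap_eval (g.point i) P

theorem ModeFactor.matrix_apply (f : ModeFactor) (g : ModeGrid) {κ : Fin (2 ^ g.n) → ℂ}
    (hκ : g.momentum ^ f.m = Matrix.circulant κ) (i j : Fin (2 ^ g.n)) :
    f.matrix g i j = ((f.P.eval (g.point (if f.L = 0 then i else j)) : ℝ) : ℂ) * κ (i - j) := by
  rw [ModeFactor.matrix, coordinatePoly_eq_diagonal, hκ]
  split_ifs
  · rw [Matrix.diagonal_mul, Matrix.circulant_apply]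
  · rw [Matrix.mul_diagonal, Matrix.circulant_apply, mul_comm]

end Momentum

/-! ### Register arithmetic on the basis states of one mode. -/

section ModeRegisters

variable {n : ℕ}

/-- The row register of a mode. -/
def rowReg : Fin n ↪ ModeQubits n := Function.Embedding.inl.trans Function.Embedding.inr

/-- The column register of a mode. -/
def colReg : Fin n ↪ ModeQubits n := Function.Embedding.inr.trans Function.Embedding.inr

theorem rowReg_ne_colReg (i j : Fin n) : (rowReg i : ModeQubits n) ≠ colReg j := by
  rintro h
  cases Sum.inr.inj h

theorem colReg_ne_rowReg (i j : Fin n) : (colReg i : ModeQubits n) ≠ rowReg j :=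
  (rowReg_ne_colReg j i).symm

theorem finFunctionFinEquiv_ket (i : Fin (2 ^ n)) : finFunctionFinEquiv (ket i) = i :=
  Equiv.apply_symm_apply _ _

theorem ket_finFunctionFinEquiv (x : QBasis (Fin n)) : ket (finFunctionFinEquiv x) = x :=
  Equiv.symm_apply_apply _ _

theorem regNum_rowReg_modeKet (f : QBasis (Fin 3)) (i j : Fin (2 ^ n)) :
    regNum rowReg (modeKet f i j) = i := finFunctionFinEquiv_ket i

theorem regNum_colReg_modeKet (f : QBasis (Fin 3)) (i j : Fin (2 ^ n)) :
    regNum colReg (modeKet f i j) = j := finFunctionFinEquiv_ket j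

theorem setReg_rowReg_modeKet (f : QBasis (Fin 3)) (i j v : Fin (2 ^ n)) :
    setReg rowReg v (modeKet f i j) = modeKet f v j := by
  refine (eq_setReg (fun s hs => ?_) (regNum_rowReg_modeKet f v j)).symm
  rcases s with s | s | s
  · rfl
  · exact absurd rfl (hs s)
  · rfl

theorem setReg_colReg_modeKet (f : QBasis (Fin 3)) (i j v : Fin (2 ^ n)) :
    setReg colReg v (modeKet f i j) = modeKet f i v := by
  refine (eq_setReg (fun s hs => ?_) (regNum_colReg_modeKet f i v)).symm
  rcases s with s | s | s
  · rfl
  · rfl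
  · exact absurd rfl (hs s)

theorem subReg_col_row_modeKet (f : QBasis (Fin 3)) (i j : Fin (2 ^ n)) :
    subReg colReg rowReg (modeKet f i j) = modeKet f (i - j) j := by
  rw [subReg, regNum_rowReg_modeKet, regNum_colReg_modeKet, setReg_rowReg_modeKet]

theorem addReg_row_col_modeKet (f : QBasis (Fin 3)) (i j : Fin (2 ^ n)) :
    addReg rowReg colReg (modeKet f i j) = modeKet f i (j + i) := by
  rw [addReg, regNum_rowReg_modeKet, regNum_colReg_modeKet, setReg_colReg_modeKet]

theorem subReg_row_col_modeKet (f : QBasis (Fin 3)) (i j : Fin (2 ^ n)) :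
    subReg rowReg colReg (modeKet f i j) = modeKet f i (j - i) := by
  rw [subReg, regNum_rowReg_modeKet, regNum_colReg_modeKet, setReg_colReg_modeKet]

theorem addConst_col_modeKet (v : Fin (2 ^ n)) (f : QBasis (Fin 3)) (i j : Fin (2 ^ n)) :
    addConst v colReg (modeKet f i j) = modeKet f i (j + v) := by
  rw [addConst, regNum_colReg_modeKet, setReg_colReg_modeKet]

theorem addConst_addConst_neg {S : Type} [Fintype S] [DecidableEq S] (v : Fin (2 ^ n)) (b : Fin n ↪ S) (y : QBasis S) :
    addConst v b (addConst (-v) b y) = y := by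
  rw [addConst, addConst, setReg_setReg, regNum_setReg, neg_add_cancel_right, setReg_regNum]

theorem addConst_neg_addConst {S : Type} [Fintype S] [DecidableEq S]
    (v : Fin (2 ^ n)) (b : Fin n ↪ S) (y : QBasis S) :
    addConst (-v) b (addConst v b y) = y := by
  rw [addConst, addConst, setReg_setReg, regNum_setReg, add_neg_cancel_right, setReg_regNum]

end ModeRegisters

/-! ### Stencil preparation and coordinate polynomial on the registers of one mode. -/

section BlockEncoding

variable {n w ℓ : ℕ}

/-- The qubits on which the stencil is prepared: the first flag and the low part of the row
register. -/
def stencilReg (hw : w ≤ n) : Fin (w + 1) ↪ ModeQubits n :=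
  ⟨Fin.cons (Sum.inl 0) fun i : Fin w => rowReg (Fin.castLE hw i), by
    intro i j
    refine Fin.cases ?_ (fun i => ?_) i <;> refine Fin.cases ?_ (fun j => ?_) j
    · exact fun _ => rfl
    · intro h
      cases h
    · intro h
      cases h
    · intro h
      exact congrArg Fin.succ (Fin.castLE_injective hw (rowReg.injective h))⟩

/-- The qubits on which a polynomial of the coordinate is computed: the high part of the row
register as scratch space, the column register and the second flag. -/
def coordinateReg (h : w + ℓ ≤ n) : (Fin ℓ ⊕ Fin n) ⊕ Fin 1 ↪ ModeQubits n :=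
  ⟨Sum.elim (Sum.elim (fun i => rowReg ⟨w + i, by omega⟩) colReg) fun _ => Sum.inl 1, by
    rintro ((i | i) | i) ((j | j) | j) hij
    · have := congrArg Fin.val (rowReg.injective hij)
      simp only [Nat.add_left_cancel_iff] at this
      rw [Fin.ext this]
    · exact absurd hij (rowReg_ne_colReg _ _)
    · cases hij
    · exact absurd hij (colReg_ne_rowReg _ _)
    · rw [colReg.injective hij]
    · cases hij
    · cases hij
    · cases hij
    · rw [Subsingleton.elim i j]⟩

/-- `IsCoordinateCircuit` speaks only about inputs with zero scratch and flag, which `hN`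
guarantees. For a zero output flag such inputs are merely scaled, so only the diagonal term of the
product survives. -/
theorem onReg_coordinateReg_mul_apply {g : ModeGrid} {P : Polynomial ℝ} (h : w + ℓ ≤ g.n)
    {A : QOp ((Fin ℓ ⊕ Fin g.n) ⊕ Fin 1)} (hA : IsCoordinateCircuit g P A)
    {N : QOp (ModeQubits g.n)} {x y : QBasis (ModeQubits g.n)} (hx : x (Sum.inl 1) = 0)
    (hN : ∀ z, N z y ≠ 0 → z (Sum.inl 1) = 0 ∧ ∀ i : Fin g.n, w ≤ i → z (rowReg i) = 0) :
    (onReg (coordinateReg h) A * N) x y =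
      ((P.eval (g.point (regNum colReg x)) : ℝ) : ℂ) * N x y := by
  rw [Matrix.mul_apply, Finset.sum_eq_single x]
  · by_cases hz : N x y = 0
    · rw [hz, mul_zero, mul_zero]
    · obtain ⟨h1, h2⟩ := hN x hz
      rw [onReg, multiplex_of_agree (AgreeOff.refl _ x)]
      have e : x ∘ coordinateReg h =
          Sum.elim ((x ∘ coordinateReg h) ∘ Sum.inl) (0 : QBasis (Fin 1)) := by
        funext s
        rcases s with s | s
        · rfl
        · exact h1
      have hAx := hA ((x ∘ coordinateReg h) ∘ Sum.inl) (funext fun i => h2 _ (Nat.le_add_right _ _))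
        (x ∘ coordinateReg h) h1
      rw [← e, if_pos rfl] at hAx
      rw [hAx]
      rfl
  · intro z _ hzx
    by_cases hz : N z y = 0
    · rw [hz, mul_zero]
    · obtain ⟨h1, h2⟩ := hN z hz
      by_cases hag : AgreeOff (coordinateReg h) x z
      · rw [onReg, multiplex_of_agree hag]
        have e : z ∘ coordinateReg h =
            Sum.elim ((z ∘ coordinateReg h) ∘ Sum.inl) (0 : QBasis (Fin 1)) := by
          funext s
          rcases s with s | s
          · rfl
          · exact h1
        have hAz := hA ((z ∘ coordinateReg h) ∘ Sum.inl)
          (funext fun i => h2 _ (Nat.le_add_right _ _)) (x ∘ coordinateReg h) hx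
        rw [← e, if_neg] at hAz
        · rw [hAz, zero_mul]
        · exact fun h' => hzx (hag.ext h').symm
      · rw [onReg, multiplex_of_not_agree hag, zero_mul]
  · simp

theorem agreeOff_stencilReg (hw : w ≤ n) {z y : QBasis (ModeQubits n)}
    (h : AgreeOff (stencilReg hw) z y) :
    z (Sum.inl 1) = y (Sum.inl 1) ∧
      (∀ i : Fin n, w ≤ i → z (rowReg i) = y (rowReg i)) ∧ ∀ i, z (colReg i) = y (colReg i) := by
  have key : ∀ s, s ≠ Sum.inl 0 → (∀ i : Fin w, s ≠ rowReg (Fin.castLE hw i)) → z s = y s := by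
    intro s h0 hs
    refine h s ?_
    rintro ⟨i, rfl⟩
    revert h0 hs
    refine Fin.cases ?_ (fun i => ?_) i
    · exact fun h0 _ => h0 rfl
    · exact fun _ hs => hs i rfl
  refine ⟨key (Sum.inl 1) (by simp) fun i hi => (by cases hi),
    fun i hi => key (rowReg i) (fun h => (by cases h)) fun j hj => ?_,
    fun i => key (colReg i) (fun h => (by cases h)) fun j => colReg_ne_rowReg _ _⟩
  have := congrArg Fin.val (rowReg.injective hj)
  have hj := j.2
  simp only [Fin.val_castLE] at this
  omega

/-- The state with amplitudes `a s / N` on the low part of the row register. -/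
theorem exists_stencilPreparation (hw : w ≤ n) (a : Fin (2 ^ n) → ℂ)
    (hsupp : ∀ s : Fin (2 ^ n), 2 ^ w ≤ (s : ℕ) → a s = 0) (ha : ∑ s, ‖a s‖ ^ 2 ≤ 1) :
    ∃ V : QOp (Fin (w + 1)), Synth (onReg (stencilReg hw) V) (15 * 2 ^ (w + 1)) ∧
      ∀ s j j' : Fin (2 ^ n), onReg (stencilReg hw) V (modeKet 0 s j')
        (modeKet 0 ⟨0, Nat.two_pow_pos n⟩ j) = if j' = j then a s else 0 := by
  have hlt : ∀ x : QBasis (Fin w), ((finFunctionFinEquiv x : Fin (2 ^ w)) : ℕ) < 2 ^ n :=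
    fun x => (Fin.is_lt _).trans_le (Nat.pow_le_pow_right two_pos hw)
  have hsum : ∑ x : QBasis (Fin w), ‖a ⟨finFunctionFinEquiv x, hlt x⟩‖ ^ 2 ≤ 1 := by
    obtain ⟨e, he⟩ : ∃ e : QBasis (Fin w) ↪ Fin (2 ^ n),
        ∀ x, e x = ⟨(finFunctionFinEquiv x : Fin (2 ^ w)), hlt x⟩ :=
      ⟨⟨_, fun x y h => finFunctionFinEquiv.injective (Fin.ext (Fin.mk.inj h))⟩, fun _ => rfl⟩
    have h1 := Finset.sum_map Finset.univ e fun s => ‖a s‖ ^ 2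
    simp only [he] at h1
    rw [← h1]
    exact (Finset.sum_le_sum_of_subset_of_nonneg (Finset.subset_univ _)
      fun _ _ _ => by positivity).trans ha
  -- The norm missing from `a` is placed on a single state with the first flag raised.
  obtain ⟨v, hv⟩ : ∃ v : QBasis (Fin (w + 1)) → ℂ, v = fun x =>
    if x 0 = 0 then a ⟨finFunctionFinEquiv (Fin.tail x), hlt (Fin.tail x)⟩
    else if Fin.tail x = 0 then ((Real.sqrt (1 - ∑ x : QBasis (Fin w),
      ‖a ⟨finFunctionFinEquiv x, hlt x⟩‖ ^ 2) : ℝ) : ℂ) else 0 := ⟨_, rfl⟩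
  have hv1 : ∑ x, ‖v x‖ ^ 2 = 1 := by
    rw [sum_qbasis_succ, hv]
    simp only [Fin.cons_zero, if_true, Fin.tail_cons, one_ne_zero, if_false]
    rw [Finset.sum_eq_single_of_mem (0 : QBasis (Fin w)) (Finset.mem_univ _)
      (fun x _ hx => by rw [if_neg hx]; simp)
      (f := fun x => ‖(if x = 0 then _ else (0 : ℂ))‖ ^ 2), if_pos rfl, Complex.norm_real,
      Real.norm_eq_abs, sq_abs, Real.sq_sqrt (sub_nonneg.2 hsum)]
    ring
  obtain ⟨V, _, hV, hVs⟩ := exists_statePreparation (w + 1) v hv1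
  refine ⟨V, hVs _ _, fun s j j' => ?_⟩
  have hy : modeKet 0 (⟨0, Nat.two_pow_pos n⟩ : Fin (2 ^ n)) j ∘ stencilReg hw = 0 := by
    funext i
    refine Fin.cases rfl (fun i => ?_) i
    change ket (⟨0, Nat.two_pow_pos n⟩ : Fin (2 ^ n)) (Fin.castLE hw i) = 0
    simp [ket, finFunctionFinEquiv]
  by_cases hag : AgreeOff (stencilReg hw) (modeKet 0 s j') (modeKet 0 ⟨0, Nat.two_pow_pos n⟩ j)
  · obtain ⟨-, h1, h2⟩ := agreeOff_stencilReg hw hag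
    have hjj : j' = j := by
      have : ket j' = ket j := funext h2
      exact finFunctionFinEquiv.symm.injective this
    rw [if_pos hjj, onReg, multiplex_of_agree hag, hy, hV, hv]
    have h0 : (modeKet 0 s j' ∘ stencilReg hw) 0 = 0 := rfl
    simp only [h0, if_true]
    congr 1
    have hval := congrArg Fin.val (finFunctionFinEquiv_ket s)
    refine Fin.ext (Eq.trans ?_ hval)
    rw [finFunctionFinEquiv_apply, finFunctionFinEquiv_apply]
    obtain ⟨e, rfl⟩ := Nat.exists_eq_add_of_le hw
    rw [Fin.sum_univ_add, Finset.sum_eq_zero (s := (Finset.univ : Finset (Fin e))), add_zero]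
    · rfl
    · intro i _
      have h3 : ket s (Fin.natAdd w i) =
        ket (⟨0, Nat.two_pow_pos _⟩ : Fin (2 ^ (w + e))) (Fin.natAdd w i) :=
        h1 (Fin.natAdd w i) (by simp)
      rw [h3]
      simp [ket, finFunctionFinEquiv]
  · rw [onReg, multiplex_of_not_agree hag]
    -- If the columns agree, the states can differ outside the prepared qubits only when `s` has a
    -- high bit set, that is, outside the support of `a`.
    split_ifs with hjj
    · symm
      refine hsupp s ?_
      by_contra hlt'
      refine hag fun t ht => ?_
      rcases t with t | t | t
      · rfl
      · by_cases htw : (t : ℕ) < w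
        · exact absurd ⟨Fin.succ ⟨t, htw⟩, rfl⟩ ht
        · change ket s t = ket (⟨0, Nat.two_pow_pos n⟩ : Fin (2 ^ n)) t
          have : (s : ℕ) / 2 ^ (t : ℕ) = 0 := Nat.div_eq_of_lt
            ((not_le.1 hlt').trans_le (Nat.pow_le_pow_right two_pos (not_lt.1 htw)))
          simp [ket, finFunctionFinEquiv, this]
      · rw [hjj]
        rfl
    · rfl

end BlockEncoding

/-! ### The block encoding of one tensor factor and its cost. -/

section ModeCircuit

/-- Arithmetic permutes basis states, so an entry is followed backwards through `G₂` and `G₁` to an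
entry of the stencil preparation. Since `G₁` alters the column register only, the high row qubits
and the second flag are still zero when `A` acts. -/
theorem blockEncoding_apply {g : ModeGrid} {P : Polynomial ℝ} {w ℓ : ℕ} (h : w + ℓ ≤ g.n)
    (hw : w ≤ g.n) {A : QOp ((Fin ℓ ⊕ Fin g.n) ⊕ Fin 1)} (hA : IsCoordinateCircuit g P A)
    (V : QOp (Fin (w + 1))) {F₁ G₁ F₂ G₂ : QBasis (ModeQubits g.n) → QBasis (ModeQubits g.n)}
    (h₁ : Function.LeftInverse G₁ F₁) (h₁' : Function.RightInverse G₁ F₁)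
    (h₂ : Function.LeftInverse G₂ F₂) (h₂' : Function.RightInverse G₂ F₂)
    (hG₁ : ∀ z s, (∀ i, colReg i ≠ s) → G₁ z s = z s)
    {x : QBasis (ModeQubits g.n)} (hx : G₂ x (Sum.inl 1) = 0) (j : Fin (2 ^ g.n)) :
    (basisMap F₂ * (onReg (coordinateReg h) A * (basisMap F₁ * onReg (stencilReg hw) V))) x
        (modeKet 0 ⟨0, Nat.two_pow_pos _⟩ j) =
      ((P.eval (g.point (regNum colReg (G₂ x))) : ℝ) : ℂ) *
        onReg (stencilReg hw) V (G₁ (G₂ x)) (modeKet 0 ⟨0, Nat.two_pow_pos _⟩ j) := by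
  rw [basisMap_mul_apply h₂ h₂', onReg_coordinateReg_mul_apply h hA hx,
    basisMap_mul_apply h₁ h₁']
  intro z hz
  rw [basisMap_mul_apply h₁ h₁'] at hz
  have hag : AgreeOff (stencilReg hw) (G₁ z) (modeKet 0 ⟨0, Nat.two_pow_pos _⟩ j) := by
    by_contra hag
    exact hz (multiplex_of_not_agree hag)
  obtain ⟨h3, h4, -⟩ := agreeOff_stencilReg hw hag
  rw [hG₁ _ _ fun i => by simp [colReg]] at h3
  refine ⟨h3, fun i hi => ?_⟩
  have h5 := h4 i hi
  rw [hG₁ _ _ fun j => colReg_ne_rowReg _ _] at h5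
  rw [h5]
  change ket (⟨0, Nat.two_pow_pos _⟩ : Fin (2 ^ g.n)) i = 0
  simp [ket, finFunctionFinEquiv]

theorem two_pow_clog_two_mul_add_one_le (K : ℕ) : 2 ^ Nat.clog 2 (2 * K + 1) ≤ 4 * K + 2 := by
  rcases Nat.eq_zero_or_pos K with rfl | hK
  · simp
  · have h3 := Nat.pow_pred_clog_lt_self one_lt_two (x := 2 * K + 1) (by omega)
    have h4 : 0 < Nat.clog 2 (2 * K + 1) := Nat.clog_pos one_lt_two (by omega)
    rw [← Nat.succ_pred_eq_of_pos h4, pow_succ]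
    omega

/-- The summand of the gate bound which belongs to a tensor factor. -/
def modeBound (q m n : ℕ) : ℕ := q * n ^ 2 + m * n + if q = 0 ∧ m = 0 then n else 0

/-- The lower bound by `n` pays for the adders and relies on the separate convention for constant
factors. -/
theorem le_modeBound (q m : ℕ) {n : ℕ} (hn : 0 < n) :
    n ≤ modeBound q m n ∧ q * n ^ 2 ≤ modeBound q m n ∧ m * n ≤ modeBound q m n := by
  refine ⟨?_, by rw [modeBound]; omega, by rw [modeBound]; omega⟩
  rw [modeBound]
  split_ifs with h
  · omega
  · rcases Nat.eq_zero_or_pos m with hm | hm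
    · have hq : 0 < q := Nat.pos_of_ne_zero fun hq => h ⟨hq, hm⟩
      have : n * 1 ≤ n * n := Nat.mul_le_mul_left n hn
      have : 1 * n ^ 2 ≤ q * n ^ 2 := Nat.mul_le_mul_right _ hq
      rw [sq] at *
      omega
    · have : 1 * n ≤ m * n := Nat.mul_le_mul_right _ hm
      omega

/-- A block encoding of a tensor factor. -/
theorem exists_modeCircuit (g : ModeGrid) (f : ModeFactor) {Np : ℝ} (hpos : 0 < Np)
    (hN : ∀ i j, ‖(g.momentum ^ f.m) i j‖ ^ 2 ≤ Np) :
    ∃ B : QOp (ModeQubits g.n),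
      SynthAnc B ((2000 + 480 * g.radius) * modeBound f.q f.m g.n) (g.n + 1) ∧
      ∀ i j j' : Fin (2 ^ g.n), B (modeKet 0 i j') (modeKet 0 ⟨0, Nat.two_pow_pos _⟩ j) =
        if j' = j then (-Complex.I) ^ f.m /
          ((Real.sqrt (2 ^ g.logSparsity f.m * Np) : ℝ) : ℂ) * f.matrix g i j else 0 := by
  obtain ⟨κ, hκ, hsupp⟩ := exists_momentum_pow_eq_circulant g f.m
  obtain ⟨K, hK⟩ : ∃ K, K = g.radius * f.m := ⟨_, rfl⟩
  rw [← hK] at hsupp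
  -- Either `w` qubits hold the whole window of `2 * K + 1` shifts, or the window is as large as the
  -- grid and the whole row register is used.
  obtain ⟨w, hw, hwK, hwK'⟩ : ∃ w, w ≤ g.n ∧ 2 ^ w ≤ 4 * K + 2 ∧
      (2 * K + 1 ≤ 2 ^ w ∨ w = g.n) := by
    rcases le_total (Nat.clog 2 (2 * K + 1)) g.n with h | h
    · exact ⟨_, h, two_pow_clog_two_mul_add_one_le K, Or.inl (Nat.le_pow_clog one_lt_two _)⟩
    · exact ⟨_, le_rfl, (Nat.pow_le_pow_right two_pos h).trans (two_pow_clog_two_mul_add_one_le K),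
        Or.inr rfl⟩
  -- Translation by `K` moves the window from `[-K, K]` to `[0, 2 * K]`.
  obtain ⟨v, hv⟩ : ∃ v : Fin (2 ^ g.n), v = ⟨K % 2 ^ g.n, Nat.mod_lt _ (Nat.two_pow_pos _)⟩ :=
    ⟨_, rfl⟩
  have hvK : ((v : ℕ) : ℤ) ≡ K [ZMOD 2 ^ g.n] := by
    rw [hv]
    push_cast
    exact Int.mod_modEq _ _
  set c : ℝ := Real.sqrt (2 ^ g.logSparsity f.m * Np) with hc
  have hc2 : c ^ 2 = 2 ^ g.logSparsity f.m * Np := Real.sq_sqrt (by positivity)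
  have hc0 : 0 < c := Real.sqrt_pos.2 (by positivity)
  obtain ⟨V, hV, hVa⟩ := exists_stencilPreparation hw
    (fun s => (-Complex.I) ^ f.m / (c : ℂ) * κ (s - v)) (fun s hs => by
      rcases hwK' with h | h
      · by_contra hne
        obtain ⟨t, ht, ht'⟩ := hsupp _ (right_ne_zero_of_mul hne)
        rw [abs_le] at ht
        obtain ⟨u, hu⟩ := Int.eq_ofNat_of_zero_le (show 0 ≤ t + K by omega)
        have hu' : u < 2 ^ w := by omega
        have h1 := ((intCast_fin_sub s v).symm.trans ht').add hvK
        rw [sub_add_cancel, hu] at h1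
        have h2 := intCast_fin_injective
          (j := ⟨u, hu'.trans_le (Nat.pow_le_pow_right two_pos hw)⟩) h1
        rw [h2] at hs
        exact absurd hu' (not_lt.2 hs)
      · rw [h] at hs
        exact absurd s.2 (not_lt.2 hs)) (by
    have h1 := sum_norm_sq_circulant_le g f.m hκ hpos hN
    simp only [norm_mul, norm_div, norm_pow, norm_neg, Complex.norm_I, one_pow, Complex.norm_real,
      Real.norm_eq_abs, abs_of_pos hc0, mul_pow, div_pow]
    rw [← Finset.mul_sum, Fintype.sum_equiv (Equiv.subRight v) (fun s => ‖κ (s - v)‖ ^ 2)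
      (fun d => ‖κ d‖ ^ 2) fun _ => rfl, hc2, one_div_mul_eq_div]
    exact div_le_one_of_le₀ h1 (by positivity))
  obtain ⟨ℓ, hℓ, A, hA, hA'⟩ := exists_coordinateCircuit g f.parity f.bounded hw
  have hB := (hA.onReg (coordinateReg hℓ)).anc (g.n + 1)
  have hVs := hV.anc (g.n + 1)
  have hadd := (synthAnc_addReg (n := g.n) colReg_ne_rowReg).mono le_rfl (Nat.le_add_left 1 g.n)
  have hadd' := (synthAnc_addReg (n := g.n) rowReg_ne_colReg).mono le_rfl (Nat.le_add_left 1 g.n)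
  have hsub' := (synthAnc_subReg (n := g.n) rowReg_ne_colReg).mono le_rfl (Nat.le_add_left 1 g.n)
  have hv1 := synthAnc_addConst v (colReg (n := g.n))
  have hv2 := synthAnc_addConst (-v) (colReg (n := g.n))
  -- From `2 ^ w ≤ 4 * K + 2`, the terms in `K * n` sum to `4 * (90 + 30) = 480`. The remaining ones
  -- sum to `541 + 1206 + 240 + 1 ≤ 2000`.
  have hcost : 1206 * g.n + (541 * (f.P.natDegree * g.n ^ 2) + 1 + 90 * (2 ^ w * g.n)) +
      15 * 2 ^ (w + 1) ≤ (2000 + 480 * g.radius) * modeBound f.q f.m g.n := by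
    obtain ⟨b1, b2, b3⟩ := le_modeBound f.q f.m g.n_pos
    rw [ModeFactor.q] at *
    have h1 : 2 ^ w * g.n ≤ (4 * K + 2) * g.n := Nat.mul_le_mul_right _ hwK
    have h2 : 2 ^ w ≤ 2 ^ w * g.n := Nat.le_mul_of_pos_right _ g.n_pos
    have h3 : K * g.n ≤ g.radius * modeBound f.P.natDegree f.m g.n := by
      rw [hK, mul_assoc]
      exact Nat.mul_le_mul_left _ b3
    have h4 := g.n_pos
    have h5 : 2 ^ (w + 1) = 2 * 2 ^ w := pow_succ' 2 w
    have h6 : (4 * K + 2) * g.n = 4 * (K * g.n) + 2 * g.n := by ring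
    have h7 : (2000 + 480 * g.radius) * modeBound f.P.natDegree f.m g.n =
      2000 * modeBound f.P.natDegree f.m g.n +
        480 * (g.radius * modeBound f.P.natDegree f.m g.n) := by ring
    omega
  -- Here `P` needs the row index. With shift `s`, the column register becomes `j - v + s = i`, `P`
  -- acts, and the additions are then rearranged into `i` in the row and `j` in the column register.
  by_cases hL : f.L = 0
  · refine ⟨_, ((hv1.mul (hadd.mul hsub')).mul (hB.mul ((hadd'.mul hv2).mul hVs))).mono
      (by omega) le_rfl, fun i j j' => ?_⟩
    simp only [basisMap_mul]
    have key : (addReg rowReg colReg ∘ subReg colReg rowReg ∘ addConst (-v) colReg)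
        (modeKet 0 i j') = modeKet 0 (i - (j' + -v)) i := by
      simp only [Function.comp_apply, addConst_col_modeKet, subReg_col_row_modeKet,
        addReg_row_col_modeKet, add_sub_cancel]
    have key' : (addConst v colReg ∘ subReg rowReg colReg)
        (modeKet 0 (i - (j' + -v)) i) = modeKet 0 (i - (j' + -v)) j' := by
      simp only [Function.comp_apply, addConst_col_modeKet, subReg_row_col_modeKet]
      congr 1
      abel
    rw [blockEncoding_apply hℓ hw hA' V
      (G₁ := addConst v colReg ∘ subReg rowReg colReg)
      (G₂ := addReg rowReg colReg ∘ subReg colReg rowReg ∘ addConst (-v) colReg)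
      (fun z => by
        simp only [Function.comp_apply, subReg_addReg rowReg_ne_colReg, addConst_addConst_neg])
      (fun z => by
        simp only [Function.comp_apply, addReg_subReg rowReg_ne_colReg, addConst_neg_addConst])
      (fun z => by
        simp only [Function.comp_apply, addConst_neg_addConst, subReg_addReg colReg_ne_rowReg,
          addReg_subReg rowReg_ne_colReg])
      (fun z => by
        simp only [Function.comp_apply, subReg_addReg rowReg_ne_colReg,
          addReg_subReg colReg_ne_rowReg, addConst_addConst_neg])
      (fun z s hs => by
        simp only [Function.comp_apply, addConst, subReg, setReg_apply_of_ne _ _ _ hs])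
      (by rw [key]; rfl), key, key', hVa, regNum_colReg_modeKet, f.matrix_apply g hκ, if_pos hL]
    split_ifs with hj
    · rw [show i - (j' + -v) - v = i - j by rw [hj]; abel]
      ring
    · rw [mul_zero]
  -- Here `P` acts on the original column index, so no arithmetic precedes it; afterwards `j - v` is
  -- added to the row register.
  · refine ⟨_, ((hv1.mul (hadd.mul hv2)).mul (hB.mul
      (((Synth.one (S := ModeQubits g.n)).anc _).mul hVs))).mono (by omega) le_rfl,
      fun i j j' => ?_⟩
    rw [← basisMap_id]
    simp only [basisMap_mul]
    have key : (addConst v colReg ∘ subReg colReg rowReg ∘ addConst (-v) colReg)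
        (modeKet 0 i j') = modeKet 0 (i - (j' + -v)) j' := by
      simp only [Function.comp_apply, addConst_col_modeKet, subReg_col_row_modeKet,
        neg_add_cancel_right]
    rw [blockEncoding_apply hℓ hw hA' V (G₁ := id)
      (G₂ := addConst v colReg ∘ subReg colReg rowReg ∘ addConst (-v) colReg)
      (fun z => rfl) (fun z => rfl)
      (fun z => by
        simp only [Function.comp_apply, addConst_neg_addConst, subReg_addReg colReg_ne_rowReg,
          addConst_addConst_neg])
      (fun z => by
        simp only [Function.comp_apply, addConst_neg_addConst, addReg_subReg colReg_ne_rowReg,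
          addConst_addConst_neg])
      (fun z s hs => rfl)
      (by rw [key]; rfl), key, id, hVa, regNum_colReg_modeKet, f.matrix_apply g hκ, if_neg hL]
    split_ifs with hj
    · rw [show i - (j' + -v) - v = i - j by rw [hj]; abel, hj]
      ring
    · rw [mul_zero]

end ModeCircuit

/-! ## The linear combination of unitaries -/

section Select

variable {S S' : Type} [Fintype S] [DecidableEq S] [Fintype S'] [DecidableEq S']

/-- Selection by `γ` control bits, with `O(log γ)` ancillas besides those of the branches. -/
theorem synthAnc_multiplex_register {γ a N : ℕ} (hγ : γ ≤ 2 ^ N) (f : S' ↪ S) (c : Fin γ ↪ S)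
    (A : QBasis (Fin γ) → QOp S') (cost : QBasis (Fin γ) → ℕ) (hcf : ∀ i, c i ∉ Set.range f)
    (hA : ∀ b, SynthAnc (A b) (cost b) a) :
    SynthAnc (multiplex f (fun y => A (y ∘ c))) (60 * ∑ b, cost b + 360 * 2 ^ γ)
      (a + 4 * N + 1) := by
  -- `L` is about `2 log γ`: small enough for one ancilla per bit, yet large enough that the `4 ^
  -- clog T` gates of a pattern test are at most the `2 ^ L` branches it governs.
  obtain ⟨T, L, rfl, hL, hTL⟩ : ∃ T L, γ = T + L ∧ L ≤ 2 * N ∧ 2 * Nat.clog 2 T ≤ L := by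
    have hN : Nat.clog 2 γ ≤ N := (Nat.clog_le_iff_le_pow one_lt_two).2 hγ
    rcases le_total γ (2 * Nat.clog 2 γ) with h | h
    · exact ⟨0, γ, (zero_add γ).symm, by omega, by simp⟩
    · refine ⟨γ - 2 * Nat.clog 2 γ, 2 * Nat.clog 2 γ, by omega, by omega, ?_⟩
      exact Nat.mul_le_mul_left 2 (Nat.clog_mono_right 2 (Nat.sub_le _ _))
  have h := synthAnc_select a T L (Nat.clog 2 T) (Nat.le_pow_clog one_lt_two T) f
    ((Fin.castAddEmb L).trans c) ((Fin.natAddEmb T).trans c) (fun t b => A (Fin.append t b))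
    (fun t b => cost (Fin.append t b)) (fun _ => hcf _) (fun _ => hcf _) fun _ _ => hA _
  have hy : ∀ y : QBasis S, Fin.append (y ∘ (Fin.castAddEmb L).trans c)
      (y ∘ (Fin.natAddEmb T).trans c) = y ∘ c := by
    intro y
    funext i
    refine Fin.addCases (fun i => ?_) (fun i => ?_) i
    · rw [Fin.append_left]
      rfl
    · rw [Fin.append_right]
      rfl
  simp only [hy] at h
  have hsum : ∑ t, ∑ b, cost (Fin.append t b) = ∑ b, cost b := by
    rw [← Fintype.sum_prod_type' (f := fun t b => cost (Fin.append t b))]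
    exact Fintype.sum_equiv (Fin.appendEquiv T L) _ _ fun _ => rfl
  rw [hsum] at h
  refine h.mono ?_ (by omega)
  have h4 : 4 ^ Nat.clog 2 T ≤ 2 ^ L := by
    rw [show 4 = 2 ^ 2 from rfl, ← pow_mul]
    exact Nat.pow_le_pow_right two_pos hTL
  refine Nat.add_le_add_left ?_ _
  calc 2 ^ T * (240 * 2 ^ L + 120 * 4 ^ Nat.clog 2 T) ≤ 2 ^ T * (360 * 2 ^ L) :=
        Nat.mul_le_mul_left _ (by omega)
    _ = 360 * 2 ^ (T + L) := by rw [pow_add]; ring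

theorem extend_inl {α β : Type} (v x : QBasis α) (y : QBasis β) :
    Function.extend (Function.Embedding.inl : α ↪ α ⊕ β) v (Sum.elim x y) = Sum.elim v y := by
  funext s
  rcases s with s | s
  · exact (Function.Embedding.inl : α ↪ α ⊕ β).injective.extend_apply _ _ _
  · exact Function.extend_apply' _ _ _ (by rintro ⟨_, h⟩; cases h)

theorem extend_inr {α β : Type} (v x : QBasis β) (y : QBasis α) :
    Function.extend (Function.Embedding.inr : β ↪ α ⊕ β) v (Sum.elim y x) = Sum.elim y v := by
  funext s
  rcases s with s | s
  · exact Function.extend_apply' _ _ _ (by rintro ⟨_, h⟩; cases h)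
  · exact (Function.Embedding.inr : β ↪ α ⊕ β).injective.extend_apply _ _ _

/-- The select operator is block diagonal in the control state, so a single sum over that state
survives. -/
theorem linearCombination_apply (U U' : QOp S) (D : QBasis S → QOp S') (x y : QBasis S)
    (X Y : QBasis S') :
    (onReg (Function.Embedding.inl : S ↪ S ⊕ S') U' *
      multiplex (Function.Embedding.inr : S' ↪ S ⊕ S') (fun y => D (y ∘ Sum.inl)) *
      onReg (Function.Embedding.inl : S ↪ S ⊕ S') U) (Sum.elim x X) (Sum.elim y Y) =
      ∑ v, U' x v * D v X Y * U v y := by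
  rw [Matrix.mul_apply, onReg, onReg, sum_mul_multiplex]
  refine Finset.sum_congr rfl fun v _ => ?_
  rw [extend_inl, Matrix.mul_apply, sum_mul_multiplex, Finset.sum_eq_single X]
  · rw [extend_inr, multiplex_of_agree (agreeOff_inl.2 rfl)]
    rfl
  · intro Z _ hZ
    rw [extend_inr, multiplex_of_not_agree (fun h => hZ (agreeOff_inl.1 h).symm), zero_mul]
  · simp

end Select

/-! ### Matrix entries and normalisation of the linear combination. -/

namespace MultiModeHamiltonian

variable {d γ : ℕ} (H : MultiModeHamiltonian d γ)

theorem agreeOff_inl_iff (x x' : QBasis H.Qubits) :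
    AgreeOff (Function.Embedding.inl : Fin γ ↪ H.Qubits) x x' ↔ ∀ y, H.mode x y = H.mode x' y := by
  constructor
  · intro h y
    funext s
    exact h _ (by rintro ⟨_, h⟩; cases h)
  · rintro h (s | ⟨y, s⟩) hs
    · exact absurd ⟨s, rfl⟩ hs
    · exact congrFun (h y) s

theorem agreeOff_inr_iff (x x' : QBasis H.Qubits) :
    AgreeOff (Function.Embedding.inr : ((y : Fin d) × ModeQubits (H.n y)) ↪ H.Qubits) x x' ↔
      H.ctrl x = H.ctrl x' := by
  constructor
  · intro h
    funext s
    exact h _ (by rintro ⟨_, h⟩; cases h)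
  · rintro h (s | s) hs
    · exact congrFun h s
    · exact absurd ⟨s, rfl⟩ hs

theorem onCtrl_eq_onReg (U : QOp (Fin γ)) : H.onCtrl U = onReg Function.Embedding.inl U := by
  ext x x'
  by_cases h : ∀ y, H.mode x y = H.mode x' y
  · rw [onReg, multiplex_of_agree ((H.agreeOff_inl_iff x x').2 h), onCtrl, if_pos h]
    rfl
  · rw [onReg, multiplex_of_not_agree (fun h' => h ((H.agreeOff_inl_iff x x').1 h')), onCtrl,
      if_neg h]

open Classical in
theorem multiControl_eq_multiplex (k : Fin (2 ^ γ))
    (B : (y : Fin d) → QOp (ModeQubits (H.n y))) :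
    H.multiControl k B = multiplex Function.Embedding.inr
      (fun x => if finFunctionFinEquiv (x ∘ Sum.inl) = k then tensorOp B else 1) := by
  ext x x'
  by_cases h : H.ctrl x = H.ctrl x'
  · rw [multiplex_of_agree ((H.agreeOff_inr_iff x x').2 h), multiControl, if_pos h]
    by_cases hk : H.ctrl x = ket k
    · rw [if_pos hk, if_pos]
      · rfl
      · rw [← finFunctionFinEquiv_ket k, ← hk, h]
        rfl
    · have hk' : ¬ finFunctionFinEquiv (x' ∘ Sum.inl) = k := by
        intro h'
        rw [← h', ket_finFunctionFinEquiv] at hk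
        exact hk h
      simp only [if_neg hk, if_neg hk', Matrix.one_apply]
      refine if_congr ⟨fun hx => by rw [hx], fun hx => ?_⟩ rfl rfl
      exact AgreeOff.ext ((H.agreeOff_inr_iff x x').2 h) hx
  · rw [multiplex_of_not_agree (fun h' => h ((H.agreeOff_inr_iff x x').1 h')), multiControl,
      if_neg h]

/-- Each control state activates exactly one factor. As a single select operator, the product can be
synthesised jointly instead of paying for a full multi-control per term. -/
theorem prod_multiControl (B : Fin (2 ^ γ) → (y : Fin d) → QOp (ModeQubits (H.n y))) :
    (List.ofFn fun k => H.multiControl k (B k)).prod = multiplex Function.Embedding.inr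
      (fun x => tensorOp (B (finFunctionFinEquiv (x ∘ Sum.inl)))) := by
  classical
  have key : ∀ ks : List (Fin (2 ^ γ)), ks.Nodup →
      (ks.map fun k => H.multiControl k (B k)).prod = multiplex Function.Embedding.inr
        (fun x => if finFunctionFinEquiv (x ∘ Sum.inl) ∈ ks then
          tensorOp (B (finFunctionFinEquiv (x ∘ Sum.inl))) else 1) := by
    intro ks hks
    induction ks with
    | nil =>
      simp only [List.map_nil, List.prod_nil, List.not_mem_nil, if_false]
      exact (multiplex_one _).symm
    | cons k ks ih =>
      obtain ⟨hk, hks⟩ := List.nodup_cons.1 hks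
      rw [List.map_cons, List.prod_cons, ih hks, multiControl_eq_multiplex, multiplex_mul]
      · congr 1
        funext x
        by_cases hx : finFunctionFinEquiv (x ∘ Sum.inl) = k
        · rw [if_pos hx, if_neg (by rw [hx]; exact hk), if_pos (by rw [hx]; simp), hx,
            Matrix.mul_one]
        · rw [if_neg hx, Matrix.one_mul]
          simp only [List.mem_cons, hx, false_or]
      · intro x y hxy
        have : x ∘ Sum.inl = y ∘ Sum.inl := (H.agreeOff_inr_iff x y).1 hxy
        simp only [this]
  rw [List.ofFn_eq_map, key _ (List.nodup_finRange _)]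
  simp only [List.mem_finRange, if_true]

/-- Both control states are zero, so `Uᵀ 0 k * U k 0` is the plain square of an amplitude, with no
conjugation. -/
theorem lcu_sysKet (U : QOp (Fin γ)) (B : Fin (2 ^ γ) → (y : Fin d) → QOp (ModeQubits (H.n y)))
    (i j i' j' : H.Index) :
    H.lcu U B (H.sysKet i j) (H.sysKet i' j') = ∑ k, U (ket k) 0 ^ 2 *
      ∏ y, B k y (modeKet 0 (i y) (j y)) (modeKet 0 (i' y) (j' y)) := by
  rw [lcu, onCtrl_eq_onReg, onCtrl_eq_onReg, prod_multiControl]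
  refine (linearCombination_apply U Uᵀ (fun v => tensorOp (B (finFunctionFinEquiv v))) _ _ _ _).trans
    ?_
  refine Fintype.sum_equiv finFunctionFinEquiv _ _ fun v => ?_
  rw [ket_finFunctionFinEquiv, Matrix.transpose_apply, sq, mul_right_comm]
  rfl

theorem exists_eq_sysKet {x : QBasis H.Qubits} (hx : H.Flagged x) : ∃ i j, x = H.sysKet i j := by
  refine ⟨fun y => finFunctionFinEquiv fun b => H.mode x y (Sum.inr (Sum.inl b)),
    fun y => finFunctionFinEquiv fun b => H.mode x y (Sum.inr (Sum.inr b)), ?_⟩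
  funext s
  rcases s with s | ⟨y, s | s | s⟩
  · exact congrFun hx.1 s
  · exact hx.2 y s
  · exact (congrFun (ket_finFunctionFinEquiv fun b => H.mode x y (Sum.inr (Sum.inl b))) s).symm
  · exact (congrFun (ket_finFunctionFinEquiv fun b => H.mode x y (Sum.inr (Sum.inr b))) s).symm

theorem sysKet_inj {i j i' j' : H.Index} : H.sysKet i j = H.sysKet i' j' ↔ i = i' ∧ j = j' := by
  constructor
  · intro h
    constructor
    · funext y
      refine finFunctionFinEquiv.symm.injective (funext fun b => ?_)
      exact congrFun h (Sum.inr ⟨y, Sum.inr (Sum.inl b)⟩)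
    · funext y
      refine finFunctionFinEquiv.symm.injective (funext fun b => ?_)
      exact congrFun h (Sum.inr ⟨y, Sum.inr (Sum.inr b)⟩)
  · rintro ⟨rfl, rfl⟩
    rfl

theorem targetState_sysKet (φ : H.Index → ℂ) (i j : H.Index) :
    H.targetState φ (H.sysKet i j) = H.matrix i j * φ j := by
  rw [targetState]
  simp only [Finset.sum_apply, Pi.smul_apply, Pi.single_apply, sysKet_inj, smul_eq_mul]
  rw [Finset.sum_eq_single i, Finset.sum_eq_single j]
  · simp
  · intro j' _ hj
    simp [hj.symm]
  · simp
  · intro i' _ hi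
    simp [hi.symm]
  · simp

theorem mulVec_inputState (M : QOp H.Qubits) (φ : H.Index → ℂ) (x : QBasis H.Qubits) :
    M.mulVec (H.inputState φ) x =
      ∑ j, φ j * M x (H.sysKet (fun _ => ⟨0, Nat.two_pow_pos _⟩) j) := by
  rw [inputState, Matrix.mulVec_sum, Finset.sum_apply]
  refine Finset.sum_congr rfl fun j _ => ?_
  rw [Matrix.mulVec_smul, Matrix.mulVec_single_one]
  rfl

variable {H} {Np : Fin (2 ^ γ) → Fin d → ℝ}

theorem modeNorm_pos (hNp : H.IsMomentumNorm Np) (k : Fin (2 ^ γ)) (y : Fin d) :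
    0 < H.modeNorm Np k y := by
  have := (hNp k y).1
  exact Real.sqrt_pos.2 (by positivity)

theorem norm_pos (hNp : H.IsMomentumNorm Np) (hα : ∃ k, H.α k ≠ 0) : 0 < H.norm Np := by
  obtain ⟨k, hk⟩ := hα
  refine Finset.sum_pos' (fun k _ => mul_nonneg (norm_nonneg _)
    (Finset.prod_nonneg fun y _ => (modeNorm_pos hNp k y).le)) ⟨k, Finset.mem_univ _, ?_⟩
  exact mul_pos (norm_pos_iff.2 hk) (Finset.prod_pos fun y _ => modeNorm_pos hNp k y)

theorem lcuAmplitude_sq (hNp : H.IsMomentumNorm Np) (hα : ∃ k, H.α k ≠ 0) (k : Fin (2 ^ γ)) :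
    H.lcuAmplitude Np k ^ 2 = Complex.I ^ (∑ y, (H.factor k y).m) * H.α k *
      ((∏ y, H.modeNorm Np k y : ℝ) : ℂ) / (H.norm Np : ℂ) := by
  have h := Complex.cpow_nat_inv_pow (Complex.I ^ (∑ y, (H.factor k y).m) * H.α k *
    ((∏ y, H.modeNorm Np k y : ℝ) : ℂ)) two_ne_zero
  rw [lcuAmplitude, div_pow, ← Complex.ofReal_pow, Real.sq_sqrt (norm_pos hNp hα).le, one_div]
  rw [Nat.cast_ofNat] at h
  rw [h]

/-- The squared moduli are the summands of `H.norm Np` divided by their sum, so the amplitudes can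
be prepared as a state. -/
theorem sum_norm_lcuAmplitude_sq (hNp : H.IsMomentumNorm Np) (hα : ∃ k, H.α k ≠ 0) :
    ∑ k, ‖H.lcuAmplitude Np k‖ ^ 2 = 1 := by
  have h : ∀ k, ‖H.lcuAmplitude Np k‖ ^ 2 =
      ‖H.α k‖ * (∏ y, H.modeNorm Np k y) / H.norm Np := by
    intro k
    rw [← norm_pow, lcuAmplitude_sq hNp hα, norm_div, norm_mul, norm_mul, norm_pow, Complex.norm_I,
      one_pow, one_mul, Complex.norm_real, Complex.norm_real, Real.norm_eq_abs, Real.norm_eq_abs,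
      abs_of_pos (norm_pos hNp hα),
      abs_of_pos (Finset.prod_pos fun y _ => modeNorm_pos hNp k y)]
  simp only [h]
  rw [← Finset.sum_div]
  exact div_self (norm_pos hNp hα).ne'

theorem lcu_sysKet_of_isOneModeAuxiliary (hNp : H.IsMomentumNorm Np) (hα : ∃ k, H.α k ≠ 0)
    {U : QOp (Fin γ)} {B : Fin (2 ^ γ) → (y : Fin d) → QOp (ModeQubits (H.n y))}
    (hU : ∀ k, U (ket k) 0 = H.lcuAmplitude Np k)
    (hB : ∀ k y, H.IsOneModeAuxiliary Np k y (B k y)) (i j j' : H.Index) :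
    H.lcu U B (H.sysKet i j') (H.sysKet (fun _ => ⟨0, Nat.two_pow_pos _⟩) j) =
      if j' = j then ((1 / H.norm Np : ℝ) : ℂ) * H.matrix i j else 0 := by
  rw [lcu_sysKet]
  simp only [(hB _ _).2]
  split_ifs with hj
  · subst hj
    simp only [if_true]
    rw [matrix, Finset.mul_sum]
    refine Finset.sum_congr rfl fun k _ => ?_
    -- The phase in the amplitudes undoes the phases of the one-mode blocks.
    have hI : Complex.I ^ (∑ y, (H.factor k y).m) * ∏ y, (-Complex.I) ^ (H.factor k y).m = 1 := by
      rw [Finset.prod_pow_eq_pow_sum, ← mul_pow, mul_neg, Complex.I_mul_I, neg_neg, one_pow]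
    have hn : ((∏ y, H.modeNorm Np k y : ℝ) : ℂ) ≠ 0 := Complex.ofReal_ne_zero.2
      (Finset.prod_pos fun y _ => modeNorm_pos hNp k y).ne'
    have hn' : (H.norm Np : ℂ) ≠ 0 := Complex.ofReal_ne_zero.2 (norm_pos hNp hα).ne'
    rw [hU, lcuAmplitude_sq hNp hα, Finset.prod_mul_distrib, Finset.prod_div_distrib,
      ← Complex.ofReal_prod]
    push_cast at hn ⊢
    field_simp
    linear_combination (H.α k * ∏ y, (H.factor k y).matrix (H.grid y) (i y) (j' y)) * hI
  · refine Finset.sum_eq_zero fun k _ => ?_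
    obtain ⟨y, hy⟩ := Function.ne_iff.1 hj
    rw [Finset.prod_eq_zero (Finset.mem_univ y) (if_neg hy), mul_zero]

end MultiModeHamiltonian

/-! ### Assembly of the circuit and the final count. -/

theorem mainTheorem10 (r : ℕ) :
    ∃ C : ℕ, ∀ (d γ : ℕ) (H : MultiModeHamiltonian d γ) (Np : Fin (2 ^ γ) → Fin d → ℝ),
      0 < d →
      (∀ y, (H.grid y).radius ≤ r) →
      γ ≤ 2 ^ (∑ y, H.n y) →
      (∃ k, H.α k ≠ 0) →
      H.IsMomentumNorm Np →
      ∃ (U : QOp (Fin γ)) (B : Fin (2 ^ γ) → (y : Fin d) → QOp (ModeQubits (H.n y)))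
        (a : ℕ) (gs : List (QGate (H.Qubits ⊕ Fin a))),
        U ∈ Matrix.unitaryGroup (QBasis (Fin γ)) ℂ ∧
        (∀ k, U (ket k) 0 = H.lcuAmplitude Np k) ∧
        (∀ k y, H.IsOneModeAuxiliary Np k y (B k y)) ∧
        H.lcu U B ∈ Matrix.unitaryGroup (QBasis H.Qubits) ℂ ∧
        (∀ φ : H.Index → ℂ, ∃ ψ : QBasis H.Qubits → ℂ,
          (∀ x, H.Flagged x → ψ x = 0) ∧
          (H.lcu U B).mulVec (H.inputState φ) =
            ((1 / H.norm Np : ℝ) : ℂ) • H.targetState φ + ψ) ∧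
        ImplementsWithPureAncillas gs (H.lcu U B) ∧
        gs.length ≤ C * H.gateBound ∧
        a ≤ C * ∑ y, H.n y := by
  -- The factor `60` is the price of controlling the mode circuits; `390` collects `360` from the
  -- selection and twice `15` from `U` and `Uᵀ`, each per term.
  refine ⟨60 * (2000 + 480 * r) + 390, fun d γ H Np hd hr hγ hα hNp => ?_⟩
  have : Nonempty H.Qubits := ⟨Sum.inr ⟨⟨0, hd⟩, Sum.inl 0⟩⟩
  have hmode : ∀ k y, ∃ B : QOp (ModeQubits (H.n y)),
      SynthAnc B ((2000 + 480 * r) * modeBound (H.factor k y).q (H.factor k y).m (H.n y))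
        (H.n y + 1) ∧ H.IsOneModeAuxiliary Np k y B := fun k y => by
    obtain ⟨B, hBs, hBe⟩ :=
      exists_modeCircuit (H.grid y) (H.factor k y) (hNp k y).1 (hNp k y).2
    exact ⟨B, hBs.mono (Nat.mul_le_mul_right _ (Nat.add_le_add_left (Nat.mul_le_mul_left _ (hr y)) _))
      le_rfl, hBs.mem_unitaryGroup, hBe⟩
  choose B hBs hB using hmode
  obtain ⟨U, hU, hUk, hUs⟩ := exists_statePreparation γ
    (fun x => H.lcuAmplitude Np (finFunctionFinEquiv x)) (by
      rw [← MultiModeHamiltonian.sum_norm_lcuAmplitude_sq hNp hα]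
      exact Fintype.sum_equiv finFunctionFinEquiv _ _ fun _ => rfl)
  have hU0 : ∀ k, U (ket k) 0 = H.lcuAmplitude Np k := fun k => by
    rw [hUk, finFunctionFinEquiv_ket]
  have hUs' := hUs H.Qubits Function.Embedding.inl
  obtain ⟨N, hN⟩ : ∃ N, N = ∑ y, H.n y := ⟨_, rfl⟩
  have hNy : ∀ y, H.n y ≤ N := fun y => by
    rw [hN]
    exact Finset.single_le_sum (fun _ _ => Nat.zero_le _) (Finset.mem_univ y)
  have hN1 : 0 < N := lt_of_lt_of_le (H.grid ⟨0, hd⟩).n_pos (hNy ⟨0, hd⟩)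
  have hsel := synthAnc_multiplex_register (S := H.Qubits) (hN ▸ hγ) Function.Embedding.inr
    Function.Embedding.inl (fun x => tensorOp (B (finFunctionFinEquiv x))) _
    (fun i => by rintro ⟨_, h⟩; cases h)
    fun x => synthAnc_tensorOp fun y => (hBs (finFunctionFinEquiv x) y).mono le_rfl
      (Nat.add_le_add_right (hNy y) 1)
  -- The mode circuits share `N + 1` ancillas and the selection adds `4 * N + 1`; `5 * N + 2 ≤ 7 *
  -- N` because `N` is positive.
  have hlcu : SynthAnc (H.lcu U B) ((60 * (2000 + 480 * r) + 390) * H.gateBound) (7 * N) := by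
    rw [MultiModeHamiltonian.lcu, H.onCtrl_eq_onReg, H.onCtrl_eq_onReg, H.prod_multiControl]
    have hT := hUs'.transpose
    rw [onReg, multiplex_transpose _ (IndepOf.const _ _)] at hT
    refine (((hT.anc _).mul hsel).mul (hUs'.anc _)).mono ?_ (by omega)
    have h1 : ∑ x : QBasis (Fin γ), ∑ y, (2000 + 480 * r) *
        modeBound (H.factor (finFunctionFinEquiv x) y).q (H.factor (finFunctionFinEquiv x) y).m
          (H.n y) = (2000 + 480 * r) * H.gateBound := by
      rw [MultiModeHamiltonian.gateBound, Finset.mul_sum]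
      refine Fintype.sum_equiv finFunctionFinEquiv _ _ fun x => ?_
      rw [Finset.mul_sum]
      rfl
    -- Every term contributes at least one to the bound, thanks to the convention for constant
    -- factors, so costs proportional to the number of terms are absorbed.
    have h2 : 2 ^ γ ≤ H.gateBound := by
      have : ∀ k : Fin (2 ^ γ), 1 ≤ ∑ y, modeBound (H.factor k y).q (H.factor k y).m (H.n y) :=
        fun k => ((H.grid ⟨0, hd⟩).n_pos.trans_le (le_modeBound _ _ (H.grid ⟨0, hd⟩).n_pos).1).trans_le
          (Finset.single_le_sum (f := fun y => modeBound (H.factor k y).q (H.factor k y).m (H.n y))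
            (fun _ _ => Nat.zero_le _) (Finset.mem_univ (⟨0, hd⟩ : Fin d)))
      have h := Finset.sum_le_sum fun k (_ : k ∈ Finset.univ) => this k
      rw [Finset.sum_const, Finset.card_univ, Fintype.card_fin, smul_eq_mul, mul_one] at h
      exact h
    rw [h1]
    nlinarith
  obtain ⟨gs, hgs, himp⟩ := hlcu
  refine ⟨U, B, 7 * N, gs, hU, hU0, hB, SynthAnc.mem_unitaryGroup ⟨gs, hgs, himp⟩,
    -- The residual vector is the difference of the two sides; only its vanishing on flagged states,
    -- which all have the form `sysKet`, has to be checked.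
    fun φ => ⟨_, fun x hx => ?_, (add_sub_cancel _ _).symm⟩, himp, hgs, ?_⟩
  · obtain ⟨i, j, rfl⟩ := H.exists_eq_sysKet hx
    rw [Pi.sub_apply, H.mulVec_inputState, Pi.smul_apply, H.targetState_sysKet]
    simp only [MultiModeHamiltonian.lcu_sysKet_of_isOneModeAuxiliary hNp hα hU0 hB, mul_ite,
      mul_zero, Finset.sum_ite_eq, Finset.mem_univ, if_true, smul_eq_mul]
    ring
  · rw [← hN]
    exact Nat.mul_le_mul_right _ (by omega)
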